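/- Let $\mathbb{F}_q$ be a finite field with $q$ elements, $A=\mathbb{F}_q[\theta]$, and let $A_+\subset A$ be the set of monic polynomials. Let $\phi$ be a Drinfeld $A$-module of rank $r\ge 1$ over $A$, i.e. the $\mathbb{F}_q$-algebra homomorphism $\phi\colon A\to A\{\tau\}$ given by $$\phi_\theta=\theta+\phi_{\theta,1}\tau+\dots+\phi_{\theta,r}\tau^r,\qquad \phi_{\theta,i}\in A,\ \phi_{\theta,r}\ne 0,$$ where $\tau x=x^q\tau$. *The function $\mu$.* Let $f\in A_+$ be irreducible of degree $d$, let $\overline{\phi}$ be the reduction of $\phi$ modulo $f$, and let $r_0\in\{0,\dots,r\}$ be its degree in $\tau$ (with $r_0=0$ if $f\mid\phi_{\theta,i}$ for all $i\ge 1$). For every irreducible $h\in A_+$ with $h\neq f$, the Tate module $T_h(\overline{\phi})=\varprojlim_m\overline{\phi}[h^m]$, formed in an algebraic closure of $A/fA$, is a free module of rank $r_0$ over the $h$-adic completion of $A$. The characteristic polynomial $P(x)=x^{r_0}+p_{r_0-1}x^{r_0-1}+\dots+p_0$ of the action of $\tau^d$ on it lies in $A[x]$ and does not depend on $h$, and if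 $r_0\ge1$ then $p_0=c(f)^{-1}f$ with $c(f)\in\mathbb{F}_q^\times$. Put $p_{r_0}=1$ and $$D_f(x)=1+\sum_{i=1}^{r_0}c(f)\,p_i\,f^{i-1}x^i$$ (so $D_f=1$ if $r_0=0$). Let $\mu\colon A_+\to A$ be the multiplicative function with $\sum_{i\ge0}\mu(f^i)x^i=D_f(x)^{-1}$ for all irreducible $f\in A_+$; that is, $\mu(a)$ are the coefficients of the dual Goss $L$-series $L(\phi^\vee,s-1)=\prod_f D_f(f^{-s})^{-1}=\sum_{a\in A_+}\mu(a)a^{-s}$. *The Taelman $L$-value.* Let $n\ge0$, let $z_1,\dots,z_n$ be indeterminates, put $k=\mathbb{F}_q(z_1,\dots,z_n)$ and $\mathbb{A}=k[\theta]$, and let $\tau\colon\mathbb{A}\to\mathbb{A}$ be the $k$-algebra homomorphism with $\tau(\theta)=\theta^q$. Put $\ell_i(z_j)=\prod_{m=0}^{i-1}(z_j-\theta^{q^m})$, and let $\varphi\colon\mathbb{A}\to\mathbb{A}\{\tau\}$ be the Drinfeld $\mathbb{A}$-module, i.e. the $k$-algebra homomorphism, given by $$\varphi_\theta=\sum_{i=0}^r\ell_i(z_1)\cdots\ell_i(z_n)\,\phi_{\theta,i}\,\tau^i,\qquad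 \phi_{\theta,0}=\theta.$$ For irreducible $f\in A_+$ let $\varphi(\mathbb{A}/f\mathbb{A})$ be the quotient $\mathbb{A}/f\mathbb{A}$ with the $\mathbb{A}$-module structure in which $\theta$ acts as $\varphi_\theta$. For an $\mathbb{A}$-module $M$ of finite dimension over $k$, let $[M]_{\mathbb{A}}\in\mathbb{A}$ be the monic generator of its Fitting ideal, i.e. $[M]_{\mathbb{A}}=f_1\cdots f_s$ if $M\cong\bigoplus_{i=1}^s\mathbb{A}/f_i\mathbb{A}$ with $f_i$ monic in $\theta$. **Theorem.** The Euler product $$L(\varphi,\mathbb{A})=\prod_{f}\frac{[\mathbb{A}/f\mathbb{A}]_{\mathbb{A}}}{[\varphi(\mathbb{A}/f\mathbb{A})]_{\mathbb{A}}}$$ over the irreducible $f\in A_+$ converges in $\mathbb{F}_q(z_1,\dots,z_n)((\theta^{-1}))$ with its $\theta^{-1}$-adic topology, and there $$L(\varphi,\mathbb{A})=\sum_{a\in A_+}\frac{\mu(a)\,a(z_1)\cdots a(z_n)}{a},$$ where the series converges as well, both unconditionally (in any order), and $a(z_j)$ denotes the evaluation of $a$ at $\theta=z_j$. -/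

import Mathlib

open Polynomial

noncomputable section

namespace Taelman

/-! ### Tate modules -/

section TateModule

variable {R : Type*} [CommRing R]

/-- The `h ^ m`-torsion of the `R`-module `V`, as a type of its own. -/
def Torsion (V : Type*) [AddCommGroup V] [Module R V] (h : R) (m : ℕ) : Type _ :=
  Submodule.torsionBySet R V ((Ideal.span {h} ^ m : Ideal R) : Set R)

variable (V : Type*) [AddCommGroup V] [Module R V] (h : R)

instance (m : ℕ) : AddCommGroup (Torsion V h m) :=
  inferInstanceAs
    (AddCommGroup (Submodule.torsionBySet R V ((Ideal.span {h} ^ m : Ideal R) : Set R)))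

/-- The `h ^ m`-torsion is a module over `R ⧸ (h) ^ m`. -/
instance (m : ℕ) : Module (R ⧸ (Ideal.span {h} ^ m : Ideal R)) (Torsion V h m) :=
  inferInstanceAs (Module (R ⧸ (Ideal.span {h} ^ m : Ideal R))
    (Submodule.torsionBySet R V ((Ideal.span {h} ^ m : Ideal R) : Set R)))

/-- Through the projection `R_h → R ⧸ (h) ^ m`, the `h ^ m`-torsion is a module over the `h`-adic
completion `R_h` of `R`. -/
instance (m : ℕ) : Module (AdicCompletion (Ideal.span {h}) R) (Torsion V h m) :=
  Module.compHom _ (AdicCompletion.evalₐ (Ideal.span {h}) m).toRingHom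

variable {V h} in
/-- The element of `V` underlying a torsion element. -/
def Torsion.val {m : ℕ} (x : Torsion V h m) : V := Subtype.val x

variable {V h} in
theorem Torsion.val_add {m : ℕ} (x y : Torsion V h m) : (x + y).val = x.val + y.val := rfl

variable {V h} in
theorem Torsion.val_zero {m : ℕ} : (0 : Torsion V h m).val = 0 := rfl

variable {V h} in
/-- An element `a` of the completion acts on the `h ^ m`-torsion as any `r : R` that is congruent
to `a` modulo `h ^ m`. -/
theorem Torsion.val_smul {m : ℕ} (a : AdicCompletion (Ideal.span {h}) R) (x : Torsion V h m)
    (r : R) (hr : AdicCompletion.evalₐ (Ideal.span {h}) m a = Ideal.Quotient.mk _ r) :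
    (a • x).val = r • x.val := by
  change ((AdicCompletion.evalₐ (Ideal.span {h}) m a) • x).val = _
  rw [hr]
  rfl

/-- The `h`-adic Tate module `T_h(V)`: the inverse limit of the torsion modules `V[h ^ m]` along
multiplication by `h`, a module over the `h`-adic completion of `R`. -/
def tateModule : Submodule (AdicCompletion (Ideal.span {h}) R) ((m : ℕ) → Torsion V h m) where
  carrier := {x | ∀ m, h • (x (m + 1)).val = (x m).val}
  add_mem' := by
    intro x y hx hy m
    simp only [Pi.add_apply, Torsion.val_add, smul_add, hx m, hy m]
  zero_mem' := by
    intro m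
    simp [Torsion.val_zero]
  smul_mem' := by
    intro a x hx m
    obtain ⟨r, hr⟩ := Ideal.Quotient.mk_surjective
      (AdicCompletion.evalₐ (Ideal.span {h}) (m + 1) a)
    have hr' : AdicCompletion.evalₐ (Ideal.span {h}) m a = Ideal.Quotient.mk _ r := by
      obtain ⟨s, rfl⟩ := AdicCompletion.mk_surjective (Ideal.span {h}) R a
      rw [AdicCompletion.evalₐ_mk] at hr ⊢
      rw [Ideal.Quotient.eq] at hr ⊢
      have h1 := s.2 (Nat.le_succ m)
      rw [SModEq.sub_mem] at h1
      have h2 := Ideal.pow_le_pow_right (Nat.le_succ m) hr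
      have h3 : s.val m - s.val (m + 1) ∈ (Ideal.span {h} ^ m : Ideal R) := by
        simpa using h1
      have := sub_mem h3 h2
      simpa using this
    simp only [Pi.smul_apply]
    rw [Torsion.val_smul a _ r hr.symm, Torsion.val_smul a _ r hr', smul_comm, hx m]

variable {V} in
/-- An `R`-linear endomorphism of `V` acts on `T_h(V)`, componentwise. -/
def tateMap (F : V →ₗ[R] V) :
    tateModule V h →ₗ[AdicCompletion (Ideal.span {h}) R] tateModule V h where
  toFun x := ⟨fun m => ⟨F (x.1 m).val, by
      have hx := (Submodule.mem_torsionBySet_iff _ _).1 (x.1 m).2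
      refine (Submodule.mem_torsionBySet_iff _ _).2 fun a => ?_
      rw [← map_smul]
      exact (congrArg F (hx a)).trans (map_zero F)⟩, fun m => by
      change h • F (x.1 (m + 1)).val = F (x.1 m).val
      rw [← map_smul, x.2 m]⟩
  map_add' x y := by
    refine Subtype.ext (funext fun m => Subtype.ext ?_)
    exact map_add F (x.1 m).val (y.1 m).val
  map_smul' a x := by
    refine Subtype.ext (funext fun m => ?_)
    obtain ⟨r, hr⟩ := Ideal.Quotient.mk_surjective (AdicCompletion.evalₐ (Ideal.span {h}) m a)
    refine Subtype.ext ?_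
    refine Eq.trans ?_ (Torsion.val_smul a _ r hr.symm).symm
    change F (a • x.1 m).val = r • F (x.1 m).val
    rw [Torsion.val_smul a _ r hr.symm, map_smul]

end TateModule

/-! ### Fitting ideals -/

/-- `IsFittingGenerator k M g`: the `k[θ]`-module `M` is isomorphic to a finite direct sum
`⨁ k[θ] / (g i)` with all `g i` monic, and `g = ∏ g i`. -/
def IsFittingGenerator (k : Type*) [Field k] (M : Type*) [AddCommGroup M] [Module k[X] M]
    (g : k[X]) : Prop :=
  ∃ (s : ℕ) (c : Fin s → k[X]), (∀ i, (c i).Monic) ∧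
    Nonempty (M ≃ₗ[k[X]] ((i : Fin s) → k[X] ⧸ Ideal.span {c i})) ∧ g = ∏ i, c i

open Classical in
/-- The monic generator `[M]` of the Fitting ideal of a `k[θ]`-module `M` of finite dimension
over `k`. -/
def fittingGenerator (k : Type*) [Field k] (M : Type*) [AddCommGroup M] [Module k[X] M] : k[X] :=
  if hM : ∃ g, IsFittingGenerator k M g then hM.choose else 1

/-! ### Drinfeld modules -/

/-- The action `x ↦ ∑ c i * τ ^ i x` of the skew polynomial `∑ c i τ ^ i` on a `k`-algebra `B` with
a `k`-algebra endomorphism `τ`. -/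
def skewAction {k B : Type*} [Field k] [CommRing B] [Algebra k B] (τ : B →ₐ[k] B) {r : ℕ}
    (c : Fin (r + 1) → B) : B →ₗ[k] B :=
  ∑ i, LinearMap.mulLeft k (c i) ∘ₗ (τ ^ (i : ℕ)).toLinearMap

theorem skewAction_apply {k B : Type*} [Field k] [CommRing B] [Algebra k B] (τ : B →ₐ[k] B)
    {r : ℕ} (c : Fin (r + 1) → B) (x : B) :
    skewAction τ c x = ∑ i, c i * (τ ^ (i : ℕ)) x := by
  simp [skewAction]

variable (Fq : Type*) [Field Fq]

/-- A Drinfeld `A`-module of rank `r` over `A = Fq[θ]`. An `Fq`-algebra homomorphism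
`A → A{τ}` is the same as an element `φ_θ = ∑ coeff i τ ^ i` of `A{τ}`. -/
structure DrinfeldModule (r : ℕ) where
  coeff : Fin (r + 1) → Fq[X]
  rank_pos : 1 ≤ r
  coeff_zero : coeff 0 = X
  coeff_last : coeff (Fin.last r) ≠ 0

/-- The set `A₊` of monic polynomials. -/
abbrev MonicPoly := {a : Fq[X] // a.Monic}

/-- The set of monic irreducible polynomials. -/
abbrev MonicPrime := {f : Fq[X] // f.Monic ∧ Irreducible f}

variable {Fq}

instance (f : MonicPrime Fq) : Fact (Irreducible f.1) := ⟨f.2.2⟩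

/-- An algebraic closure of the residue field `A / f`. -/
abbrev ResidueClosure (f : MonicPrime Fq) := AlgebraicClosure (AdjoinRoot f.1)

/-- The image of `θ` in the algebraic closure of `A / f`. -/
def thetaBar (f : MonicPrime Fq) : ResidueClosure f :=
  algebraMap (AdjoinRoot f.1) (ResidueClosure f) (AdjoinRoot.root f.1)

variable [Fintype Fq]

theorem thetaBar_pow (f : MonicPrime Fq) :
    thetaBar f ^ Fintype.card Fq ^ f.1.natDegree = thetaBar f := by
  have hf : f.1 ≠ 0 := f.2.2.ne_zero
  let pb := AdjoinRoot.powerBasis hf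
  have : Module.Finite Fq (AdjoinRoot f.1) := pb.finite
  have : Finite (AdjoinRoot f.1) := Module.finite_of_finite Fq
  let _ := Fintype.ofFinite (AdjoinRoot f.1)
  have hc : Fintype.card (AdjoinRoot f.1) = Fintype.card Fq ^ f.1.natDegree := by
    rw [Module.card_eq_pow_finrank (K := Fq) (V := AdjoinRoot f.1), pb.finrank]
    rfl
  rw [thetaBar, ← map_pow, ← hc, FiniteField.pow_card]

namespace DrinfeldModule

variable {r : ℕ} (φ : DrinfeldModule Fq r)

/-- The reduction of `φ_θ` modulo `f` acting on the algebraic closure of `A / f`, with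
`τ x = x ^ q`. -/
def reductionAction (f : MonicPrime Fq) : ResidueClosure f →ₗ[Fq] ResidueClosure f :=
  skewAction (FiniteField.frobeniusAlgHom Fq (ResidueClosure f))
    fun i => aeval (thetaBar f) (φ.coeff i)

/-- The algebraic closure of `A / f` as an `A`-module through the reduction of `φ` at `f`. -/
abbrev ReductionModule (f : MonicPrime Fq) : Type _ := Module.AEval' (φ.reductionAction f)

theorem frobenius_pow_apply (f : MonicPrime Fq) (n : ℕ) (x : ResidueClosure f) :
    (FiniteField.frobeniusAlgHom Fq (ResidueClosure f) ^ n) x = x ^ Fintype.card Fq ^ n := by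
  induction n generalizing x with
  | zero => simp
  | succ n ih =>
    rw [pow_succ, AlgHom.mul_apply, ih, FiniteField.coe_frobeniusAlgHom, pow_succ', pow_mul]

theorem frobenius_reductionAction (f : MonicPrime Fq) (x : ResidueClosure f) :
    (FiniteField.frobeniusAlgHom Fq (ResidueClosure f) ^ f.1.natDegree) (φ.reductionAction f x) =
      φ.reductionAction f
        ((FiniteField.frobeniusAlgHom Fq (ResidueClosure f) ^ f.1.natDegree) x) := by
  simp only [reductionAction, skewAction_apply, map_sum, map_mul]
  refine Finset.sum_congr rfl fun i _ => ?_
  congr 1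
  · rw [← Polynomial.aeval_algHom_apply, frobenius_pow_apply, thetaBar_pow]
  · rw [← AlgHom.mul_apply, ← AlgHom.mul_apply, ← pow_add, ← pow_add, add_comm]

/-- The Frobenius `τ ^ d : x ↦ x ^ (q ^ d)`, `d = deg f`, as an endomorphism of the `A`-module
given by the reduction of `φ` at `f`. -/
def frobenius (f : MonicPrime Fq) : φ.ReductionModule f →ₗ[Fq[X]] φ.ReductionModule f :=
  LinearMap.ofAEval _
    ((Module.AEval'.of (φ.reductionAction f)).toLinearMap ∘ₗ
      (FiniteField.frobeniusAlgHom Fq (ResidueClosure f) ^ f.1.natDegree).toLinearMap)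
    (fun x => by
      have := φ.frobenius_reductionAction f x
      simp only [LinearMap.comp_apply, AlgHom.toLinearMap_apply, LinearEquiv.coe_coe,
        Module.AEval'.X_smul_of, Module.End.smul_def]
      rw [this])

/-- `P` is the characteristic polynomial of the action of `τ ^ d` on the Tate module `T_h` of
the reduction of `φ` at `f` (which is free of finite rank over the completion `A_h`). -/
def IsFrobeniusCharpolyAt (f h : MonicPrime Fq) (P : Fq[X][X]) : Prop :=
  ∃ (s : ℕ) (b : Module.Basis (Fin s) (AdicCompletion (Ideal.span {h.1}) Fq[X])
      (tateModule (φ.ReductionModule f) h.1)),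
    (LinearMap.toMatrix b b (tateMap h.1 (φ.frobenius f))).charpoly =
      P.map (algebraMap Fq[X] (AdicCompletion (Ideal.span {h.1}) Fq[X]))

open Classical in
/-- The characteristic polynomial `P ∈ A[x]` of the action of `τ ^ d` on the Tate modules `T_h` of
the reduction of `φ` at `f`; it is the same for all monic irreducible `h ≠ f`. -/
def frobeniusCharpoly (f : MonicPrime Fq) : Fq[X][X] :=
  if hP : ∃ P, ∀ h : MonicPrime Fq, h ≠ f → φ.IsFrobeniusCharpolyAt f h P then hP.choose else 1

/-- The rank `r₀` of the reduction of `φ` at `f`: the largest `i` such that `φ_{θ,i}` is not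
divisible by `f` (and `0` if there is no `i ≥ 1` of that kind). -/
def reductionRank (f : MonicPrime Fq) : ℕ :=
  sSup {i : ℕ | ∃ hi : i < r + 1, ¬ f.1 ∣ φ.coeff ⟨i, hi⟩}

/-- The constant `c(f) ∈ Fqˣ` with `P(0) = c(f)⁻¹ f`. -/
def frobeniusConst (f : MonicPrime Fq) : Fq :=
  ((φ.frobeniusCharpoly f).coeff 0).leadingCoeff⁻¹

/-- The Euler factor `D_f(x) = 1 + ∑_{i=1}^{r₀} c(f) p_i f^{i-1} x^i`, where `p_i` are the
coefficients of the characteristic polynomial of Frobenius; it is `1` if `r₀ = 0`. -/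
def eulerFactor (f : MonicPrime Fq) : Fq[X][X] :=
  1 + ∑ i ∈ Finset.Icc 1 (φ.reductionRank f),
    C (C (φ.frobeniusConst f) * (φ.frobeniusCharpoly f).coeff i * f.1 ^ (i - 1)) * X ^ i

/-- The value `μ(f ^ i)`, given by `∑ μ(f ^ i) x ^ i = D_f(x)⁻¹`. -/
def muPrimePow (f : MonicPrime Fq) (i : ℕ) : Fq[X] :=
  PowerSeries.coeff i (PowerSeries.invOfUnit (φ.eulerFactor f : PowerSeries Fq[X]) 1)

/-- The multiplicative function `μ : A₊ → A` with `L(φ^∨, s - 1) = ∏_f D_f(f^{-s})⁻¹ =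
∑_a μ(a) / a^s`. -/
def mu (a : MonicPoly Fq) : Fq[X] :=
  ∏ᶠ f : MonicPrime Fq, φ.muPrimePow f (multiplicity f.1 a.1)

end DrinfeldModule

/-! ### The twisted module over `𝔸 = Fq(z_1, …, z_n)[θ]` -/

variable (Fq) in
/-- The field `Fq(z_1, …, z_n)`; the ring `𝔸` is `(ZField Fq n)[X]`. -/
abbrev ZField (n : ℕ) := FractionRing (MvPolynomial (Fin n) Fq)

variable (Fq) in
/-- The variable `z_k` as an element of `Fq(z_1, …, z_n)`. -/
def z {n : ℕ} (k : Fin n) : ZField Fq n :=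
  algebraMap (MvPolynomial (Fin n) Fq) (ZField Fq n) (MvPolynomial.X k)

variable (Fq) in
/-- The inclusion `A → 𝔸`. -/
def toZ (n : ℕ) : Fq[X] →+* (ZField Fq n)[X] := mapRingHom (algebraMap Fq (ZField Fq n))

variable (Fq) in
/-- `τ : 𝔸 → 𝔸`, the `Fq(z_1, …, z_n)`-algebra homomorphism with `τ θ = θ ^ q`. -/
def tauZ (n : ℕ) : (ZField Fq n)[X] →ₐ[ZField Fq n] (ZField Fq n)[X] :=
  expand (ZField Fq n) (Fintype.card Fq)

variable (Fq) in
/-- `ℓ_i(z_k) = ∏_{j=0}^{i-1} (z_k - θ^{q^j})`. -/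
def ell {n : ℕ} (i : ℕ) (k : Fin n) : (ZField Fq n)[X] :=
  ∏ j ∈ Finset.range i, (C (z Fq k) - X ^ Fintype.card Fq ^ j)

variable (Fq) in
theorem tauZ_toZ (n : ℕ) (f : Fq[X]) : tauZ Fq n (toZ Fq n f) = toZ Fq n f ^ Fintype.card Fq := by
  rw [tauZ, toZ, coe_mapRingHom, ← map_expand, FiniteField.expand_card, Polynomial.map_pow]

theorem tauZ_pow_mem (n : ℕ) (f : Fq[X]) (i : ℕ) {x : (ZField Fq n)[X]}
    (hx : x ∈ Ideal.span {toZ Fq n f}) : (tauZ Fq n ^ i) x ∈ Ideal.span {toZ Fq n f} := by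
  induction i with
  | zero => simpa using hx
  | succ i ih =>
    rw [pow_succ', AlgHom.mul_apply]
    obtain ⟨y, hy⟩ := Ideal.mem_span_singleton.1 ih
    rw [hy, map_mul, tauZ_toZ]
    exact Ideal.mul_mem_right _ _ (Ideal.pow_mem_of_mem _ (Ideal.mem_span_singleton_self _) _
      Fintype.card_pos)

namespace DrinfeldModule

variable {r : ℕ} (φ : DrinfeldModule Fq r) (n : ℕ)

/-- The coefficients `ℓ_i(z_1) ⋯ ℓ_i(z_n) φ_{θ,i}` of the Drinfeld `𝔸`-module `ϕ` attached
to `φ`. -/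
def twistCoeff (i : Fin (r + 1)) : (ZField Fq n)[X] :=
  (∏ k : Fin n, ell Fq (i : ℕ) k) * toZ Fq n (φ.coeff i)

/-- The action of `ϕ_θ` on `𝔸`. -/
def twistAction : (ZField Fq n)[X] →ₗ[ZField Fq n] (ZField Fq n)[X] :=
  skewAction (tauZ Fq n) (φ.twistCoeff n)

/-- The action of `ϕ_θ` on `𝔸 / f𝔸`. -/
def twistQuotientAction (f : Fq[X]) :
    ((ZField Fq n)[X] ⧸ (Ideal.span {toZ Fq n f}).restrictScalars (ZField Fq n)) →ₗ[ZField Fq n]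
      ((ZField Fq n)[X] ⧸ (Ideal.span {toZ Fq n f}).restrictScalars (ZField Fq n)) :=
  Submodule.mapQ _ _ (φ.twistAction n) (by
    intro x hx
    rw [Submodule.mem_comap, Submodule.restrictScalars_mem, twistAction, skewAction_apply]
    exact sum_mem fun i _ => Ideal.mul_mem_left _ _ (tauZ_pow_mem n f _ hx))

/-- The `𝔸`-module `ϕ(𝔸 / f𝔸)`: the space `𝔸 / f𝔸` on which `θ` acts as `ϕ_θ`. -/
abbrev TwistModule (f : Fq[X]) : Type _ := Module.AEval' (φ.twistQuotientAction n f)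

end DrinfeldModule

variable (Fq) in
/-- The inclusion of `𝔸` in the complete field `Fq(z_1, …, z_n)((θ⁻¹))`. The latter is the field of
Laurent series in the variable `θ⁻¹` with its valuation topology, so `θ` is the
monomial of exponent `-1`. -/
def toLaurent (n : ℕ) : (ZField Fq n)[X] →ₐ[ZField Fq n] LaurentSeries (ZField Fq n) :=
  aeval (HahnSeries.single (-1 : ℤ) (1 : ZField Fq n))

namespace DrinfeldModule

variable {r : ℕ} (φ : DrinfeldModule Fq r) (n : ℕ)

/-- The factor `[𝔸 / f𝔸] / [ϕ(𝔸 / f𝔸)]` of the Taelman `L`-value. -/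
def taelmanFactor (f : MonicPrime Fq) : LaurentSeries (ZField Fq n) :=
  toLaurent Fq n
      (fittingGenerator (ZField Fq n) ((ZField Fq n)[X] ⧸ Ideal.span {toZ Fq n f.1})) /
    toLaurent Fq n (fittingGenerator (ZField Fq n) (φ.TwistModule n f.1))

/-- The Taelman `L`-value `L(ϕ, 𝔸)`, an infinite product over the monic irreducible `f`. -/
def taelmanLValue : LaurentSeries (ZField Fq n) := ∏' f : MonicPrime Fq, φ.taelmanFactor n f

/-- The term `μ(a) a(z_1) ⋯ a(z_n) / a`. -/
def pellarinTerm (a : MonicPoly Fq) : LaurentSeries (ZField Fq n) :=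
  toLaurent Fq n (toZ Fq n (φ.mu a) * ∏ k : Fin n, C (aeval (z Fq k) a.1)) /
    toLaurent Fq n (toZ Fq n a.1)

end DrinfeldModule

end Taelman

end

/-! Fix a monic irreducible `f` of degree d with a root β. The heart of the matter is that [ϕ(𝔸/f𝔸)]
and the Frobenius polynomial P are two readings of one determinant. Consider the difference equation
t x_i = ∑_j a_{ij} x_{i+j}, where a_{ij} is the value of φ_{θ,j} at β^{q^i}; it has period d in i.
Impose x_{i+d} = z x_i. Eliminating the unknowns in two different orders presents the same module by
a d × d matrix (`quasiPeriodicMatrix`) and by z minus the r₀ × r₀ matrix of the shift by d on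
solutions (`monodromy`). Determinants of square presentations of one module divide each other
(`IsPresentedBy.det_dvd_det`), so over E[t][z] the two agree up to a constant
(`exists_charpoly_polyMonodromy`).

Reading in t: evaluating 𝔸/f𝔸 at the conjugates of β, and rescaling by partial products of ∏_k (z_k
- β^{q^m}), turns ϕ_θ into ∑_j a_{ij} S^j, with S the shift, on sequences with multiplier z = ∏_k
f(z_k) (`map_fittingGenerator_twistModule`).

Reading in z: by a residue pairing, a torsion point of the reduction becomes an element of E[t]/h^m
whose Frobenius twists solve the difference equation, and the shift by d becomes τ^d. So the
monodromy has characteristic polynomial P (`charpoly_frobenius_torsion`, `frobeniusCharpoly_map`).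

At z = 0 the determinant is f, which fixes the constant as c(f) and gives [ϕ(𝔸/f𝔸)] = f D_f(∏_k
f(z_k)/f). Each factor of the L-value is therefore ∑_m μ(f^m) ∏_k f(z_k)^m / f^m.

For convergence, giving t weight r₀ and z weight d bounds the degrees of the coefficients of P.
Hence the r-th power of the absolute value of the term of a is at most exp(-deg a). In a complete
nonarchimedean field this yields summability, and unique factorization expands the Euler product
(`hasProd_of_summable_finsuppProd`). -/

noncomputable section

namespace Taelman

/-! ### Square presentations and their determinants -/

section Presentation

variable {R : Type*} [CommRing R] {N : Type*} [AddCommGroup N] [Module R N]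

/-- The module `N` is generated by the family `g`, and the rows of the square matrix `M` generate
all relations between the members of `g`. -/
structure IsPresentedBy {ι : Type*} [Fintype ι] (g : ι → N) (M : Matrix ι ι R) : Prop where
  exists_eq : ∀ x : N, ∃ c : ι → R, x = ∑ i, c i • g i
  relation : ∀ i, ∑ j, M i j • g j = 0
  complete : ∀ c : ι → R, ∑ i, c i • g i = 0 → ∃ y : ι → R, c = Matrix.vecMul y M

/-- Both presentations are enlarged to the joint family of generators by adding relations that
express one family through the other. This makes the matrices block triangular without changing
their determinants. The rows of `A₂` are relations and those of `A₁` generate all relations, so `A₂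
= U * A₁`. -/
theorem IsPresentedBy.det_dvd_det {ι κ : Type*} [Fintype ι] [Fintype κ] [DecidableEq ι]
    [DecidableEq κ] {g : ι → N} {g' : κ → N} {M : Matrix ι ι R} {M' : Matrix κ κ R}
    (h : IsPresentedBy g M) (h' : IsPresentedBy g' M') : M.det ∣ M'.det := by
  choose P hP using fun i => h'.exists_eq (g i)
  choose Q hQ using fun k => h.exists_eq (g' k)
  let A₁ : Matrix (ι ⊕ κ) (ι ⊕ κ) R := Matrix.fromBlocks M 0 (-Matrix.of Q) 1
  let A₂ : Matrix (ι ⊕ κ) (ι ⊕ κ) R := Matrix.fromBlocks 1 (-Matrix.of P) 0 M'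
  -- Substituting `g' = Q g` leaves a relation among the `g` alone, which `M` accounts for.
  have hrel : ∀ (x : ι → R) (y : κ → R), ∑ i, x i • g i + ∑ k, y k • g' k = 0 →
      ∃ u : ι ⊕ κ → R, Sum.elim x y = Matrix.vecMul u A₁ := by
    intro x y hxy
    have h1 : ∑ i, (x + Matrix.vecMul y (Matrix.of Q)) i • g i = 0 := by
      rw [← hxy]
      simp only [Pi.add_apply, add_smul, Finset.sum_add_distrib]
      congr 1
      simp only [Matrix.vecMul, dotProduct, Finset.sum_smul, Matrix.of_apply]
      rw [Finset.sum_comm]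
      refine Finset.sum_congr rfl fun k _ => ?_
      conv_rhs => rw [hQ k]
      rw [Finset.smul_sum]
      exact Finset.sum_congr rfl fun i _ => (smul_smul _ _ _).symm
    obtain ⟨u, hu⟩ := h.complete _ h1
    refine ⟨Sum.elim u y, ?_⟩
    rw [Matrix.vecMul_fromBlocks]
    simp only [Sum.elim_comp_inl, Sum.elim_comp_inr, Matrix.vecMul_zero, Matrix.vecMul_one,
      zero_add, ← hu, Matrix.vecMul_neg]
    simp
  have hrow : ∀ s, ∃ u : ι ⊕ κ → R, A₂ s = Matrix.vecMul u A₁ := by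
    rintro (i | k)
    · obtain ⟨u, hu⟩ := hrel (Pi.single i 1) (-P i) (by
        simp only [Pi.neg_apply, neg_smul, Finset.sum_neg_distrib, ← hP i]
        simp [Pi.single_apply, ite_smul])
      refine ⟨u, hu ▸ ?_⟩
      ext (j | j) <;> simp [A₂, Matrix.one_apply, Pi.single_apply, eq_comm]
    · obtain ⟨u, hu⟩ := hrel 0 (M' k) (by simp [h'.relation k])
      refine ⟨u, hu ▸ ?_⟩
      ext (j | j) <;> simp [A₂]
  choose U hU using hrow
  have hmul : A₂ = Matrix.of U * A₁ := by
    ext s t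
    rw [hU s]
    rfl
  have hdet := congrArg Matrix.det hmul
  rw [Matrix.det_mul, Matrix.det_fromBlocks_zero₂₁, Matrix.det_fromBlocks_zero₁₂] at hdet
  simp only [Matrix.det_one, one_mul, mul_one] at hdet
  exact ⟨_, hdet.trans (mul_comm _ _)⟩

theorem IsPresentedBy.map {N' : Type*} [AddCommGroup N'] [Module R N'] {ι : Type*} [Fintype ι]
    {g : ι → N} {M : Matrix ι ι R} (h : IsPresentedBy g M) (e : N ≃ₗ[R] N') :
    IsPresentedBy (e ∘ g) M where
  exists_eq x := by
    obtain ⟨c, hc⟩ := h.exists_eq (e.symm x)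
    refine ⟨c, ?_⟩
    rw [← e.apply_symm_apply x, hc]
    simp
  relation i := by
    have := congrArg e (h.relation i)
    simpa using this
  complete c hc := h.complete c (e.injective (by simpa using hc))

/-- The standard presentation of a direct sum of cyclic modules. -/
theorem isPresentedBy_pi_quotient {ι : Type*} [Fintype ι] [DecidableEq ι] (c : ι → R) :
    IsPresentedBy (fun i => (Pi.single i 1 : (i : ι) → R ⧸ Ideal.span {c i}))
      (Matrix.diagonal c) := by
  have key : ∀ y : ι → R, (∑ i, y i • (Pi.single i 1 : (i : ι) → R ⧸ Ideal.span {c i})) =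
      fun i => Ideal.Quotient.mk _ (y i) := by
    intro y
    funext j
    rw [Finset.sum_apply, Finset.sum_eq_single j]
    · simp only [Pi.smul_apply, Pi.single_eq_same]
      rw [Algebra.smul_def, mul_one]
      rfl
    · intro i _ hij
      simp [Pi.single_eq_of_ne (Ne.symm hij)]
    · simp
  refine ⟨fun x => ?_, fun i => ?_, fun y hy => ?_⟩
  · choose y hy using fun i => Ideal.Quotient.mk_surjective (x i)
    exact ⟨y, by rw [key]; exact funext fun i => (hy i).symm⟩
  · rw [key]
    funext j
    rw [Pi.zero_apply, Ideal.Quotient.eq_zero_iff_mem, Ideal.mem_span_singleton,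
      Matrix.diagonal_apply]
    split_ifs with h
    · rw [h]
    · exact dvd_zero _
  · rw [key] at hy
    have : ∀ i, ∃ u, y i = c i * u := fun i => by
      have := congrFun hy i
      rwa [Pi.zero_apply, Ideal.Quotient.eq_zero_iff_mem, Ideal.mem_span_singleton] at this
    choose u hu using this
    refine ⟨u, funext fun i => ?_⟩
    rw [Matrix.vecMul_diagonal, hu, mul_comm]

end Presentation

/-! ### Fitting generators as determinants and characteristic polynomials. -/

section FittingGenerator

variable {k : Type*} [Field k]

/-- The characteristic matrix presents the `k[X]`-module given by an endomorphism. -/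
theorem isPresentedBy_aeval {V : Type*} [AddCommGroup V] [Module k V] {ι : Type*} [Fintype ι]
    [DecidableEq ι] (b : Module.Basis ι k V) (T : V →ₗ[k] V) :
    IsPresentedBy (fun i => Module.AEval'.of T (b i))
      (Matrix.charmatrix (LinearMap.toMatrix b b T).transpose) := by
  set A := (LinearMap.toMatrix b b T).transpose with hA
  have hT : ∀ i, T (b i) = ∑ j, A i j • b j := fun i => by
    rw [← b.sum_repr (T (b i))]
    refine Finset.sum_congr rfl fun j _ => ?_
    rw [hA, Matrix.transpose_apply, LinearMap.toMatrix_apply]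
  have hrel : ∀ i, ∑ j, Matrix.charmatrix A i j • Module.AEval'.of T (b j) = 0 := by
    intro i
    simp only [Matrix.charmatrix_apply, Matrix.diagonal_apply, sub_smul, Finset.sum_sub_distrib,
      ite_smul, zero_smul, Finset.sum_ite_eq, Finset.mem_univ, if_true, Module.AEval'.X_smul_of,
      Module.AEval.C_smul]
    rw [hT, map_sum, sub_eq_zero]
    simp
  -- Division with remainder by `X - A`: every row vector is constant modulo the rows of the
  -- characteristic matrix.
  have hdiv : ∀ x : ι → k[X], ∃ (y : ι → k[X]) (c : ι → k),
      x = Matrix.vecMul y (Matrix.charmatrix A) + fun i => C (c i) := by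
    have hadd : ∀ x x' : ι → k[X],
        (∃ (y : ι → k[X]) (c : ι → k), x = Matrix.vecMul y (Matrix.charmatrix A) + fun i => C (c i)) →
        (∃ (y : ι → k[X]) (c : ι → k), x' = Matrix.vecMul y (Matrix.charmatrix A) + fun i => C (c i)) →
        (∃ (y : ι → k[X]) (c : ι → k),
          x + x' = Matrix.vecMul y (Matrix.charmatrix A) + fun i => C (c i)) := by
      rintro _ _ ⟨y, c, rfl⟩ ⟨y', c', rfl⟩
      refine ⟨y + y', c + c', ?_⟩
      rw [Matrix.add_vecMul]
      funext i
      simp only [Pi.add_apply, map_add]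
      ring
    have hX : ∀ x : ι → k[X],
        (∃ (y : ι → k[X]) (c : ι → k), x = Matrix.vecMul y (Matrix.charmatrix A) + fun i => C (c i)) →
        (∃ (y : ι → k[X]) (c : ι → k),
          (X : k[X]) • x = Matrix.vecMul y (Matrix.charmatrix A) + fun i => C (c i)) := by
      rintro _ ⟨y, c, rfl⟩
      -- This is X c = c (X - A) + c A.
      refine ⟨(X : k[X]) • y + fun i => C (c i), Matrix.vecMul c A, ?_⟩
      rw [Matrix.add_vecMul, Matrix.smul_vecMul, smul_add, add_assoc]
      congr 1
      funext j
      simp only [Pi.smul_apply, Pi.add_apply, Matrix.vecMul, dotProduct, Matrix.charmatrix_apply,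
        mul_sub, Finset.sum_sub_distrib, Matrix.diagonal_apply, mul_ite, mul_zero, map_sum, map_mul,
        Finset.sum_ite_eq', Finset.mem_univ, if_true, sub_add_cancel, smul_eq_mul]
      exact mul_comm _ _
    intro x
    have : ∀ (i : ι) (p : k[X]), ∃ (y : ι → k[X]) (c : ι → k),
        (Pi.single i p : ι → k[X]) = Matrix.vecMul y (Matrix.charmatrix A) + fun i => C (c i) := by
      intro i p
      induction p using Polynomial.induction_on with
      | C a =>
        refine ⟨0, Pi.single i a, ?_⟩
        rw [Matrix.zero_vecMul, zero_add]
        funext j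
        simp only [Pi.single_apply]
        split_ifs <;> simp
      | add p q hp hq =>
        rw [Pi.single_add]
        exact hadd _ _ hp hq
      | monomial n a h =>
        have := hX _ h
        rwa [← Pi.single_smul, smul_eq_mul, mul_comm, mul_assoc, ← pow_succ] at this
    rw [← Finset.univ_sum_single x]
    refine Finset.sum_induction _ (fun x : ι → k[X] => ∃ (y : ι → k[X]) (c : ι → k),
      x = Matrix.vecMul y (Matrix.charmatrix A) + fun i => C (c i)) hadd ⟨0, 0, ?_⟩
      fun i _ => this i _
    simp
    rfl
  refine ⟨fun x => ?_, hrel, fun x hx => ?_⟩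
  · refine ⟨fun i => C (b.repr ((Module.AEval'.of T).symm x) i), ?_⟩
    simp only [Module.AEval.C_smul]
    rw [← (Module.AEval'.of T).apply_symm_apply x, ← b.sum_repr ((Module.AEval'.of T).symm x),
      map_sum]
    simp
  -- The constant remainder of a relation is a linear relation over `k` between basis vectors, hence
  -- zero.
  · obtain ⟨y, c, rfl⟩ := hdiv x
    have h1 : ∑ i, Matrix.vecMul y (Matrix.charmatrix A) i • Module.AEval'.of T (b i) = 0 := by
      simp only [Matrix.vecMul, dotProduct, Finset.sum_smul, mul_smul]
      rw [Finset.sum_comm]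
      simp only [← Finset.smul_sum, hrel, smul_zero, Finset.sum_const_zero]
    simp only [Pi.add_apply, add_smul, Finset.sum_add_distrib, h1, zero_add,
      Module.AEval.C_smul, ← map_smul, ← map_sum] at hx
    have hx' := (Module.AEval'.of T).map_eq_zero_iff.1 hx
    have hc := Fintype.linearIndependent_iff.1 b.linearIndependent c hx'
    refine ⟨y, ?_⟩
    funext i
    simp [hc i]

theorem IsFittingGenerator.eq_det {M : Type*} [AddCommGroup M] [Module k[X] M] {g : k[X]}
    (hg : IsFittingGenerator k M g) {ι : Type*} [Fintype ι] [DecidableEq ι] {x : ι → M}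
    {A : Matrix ι ι k[X]} (hA : IsPresentedBy x A) (hmonic : A.det.Monic) : g = A.det := by
  obtain ⟨s, c, hc, ⟨e⟩, rfl⟩ := hg
  have h1 := (isPresentedBy_pi_quotient c).map e.symm
  have h2 := h1.det_dvd_det hA
  have h3 := hA.det_dvd_det h1
  rw [Matrix.det_diagonal] at h2 h3
  exact eq_of_monic_of_associated (monic_prod_of_monic _ _ fun i _ => hc i) hmonic
    (associated_of_dvd_dvd h2 h3)

/-- The structure theorem over a principal ideal domain, with the prime powers normalized to be
monic. It excludes the default value 1 in `fittingGenerator`. -/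
theorem exists_isFittingGenerator (M : Type*) [AddCommGroup M] [Module k[X] M]
    [Module.Finite k[X] M] (hM : Module.IsTorsion k[X] M) : ∃ g, IsFittingGenerator k M g := by
  classical
  obtain ⟨ι, _, p, hp, e, ⟨E⟩⟩ := Module.equiv_directSum_of_isTorsion hM
  let c : ι → k[X] := fun i => normalize (p i ^ e i)
  have hne : ∀ i, p i ^ e i ≠ 0 := fun i => pow_ne_zero _ (hp i).ne_zero
  have hspan : ∀ i, Ideal.span {p i ^ e i} = Ideal.span {c i} := fun i =>
    Ideal.span_singleton_eq_span_singleton.2 (associated_normalize _)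
  let n := Fintype.card ι
  let ε : ι ≃ Fin n := Fintype.equivFin ι
  refine ⟨∏ i, c (ε.symm i), n, fun i => c (ε.symm i), fun i => monic_normalize (hne _), ⟨?_⟩, rfl⟩
  refine E ≪≫ₗ DirectSum.linearEquivFunOnFintype k[X] ι _ ≪≫ₗ
    LinearEquiv.piCongrRight (fun i => Submodule.quotEquivOfEq _ _ (hspan i)) ≪≫ₗ
    (LinearEquiv.piCongrLeft' k[X] (fun i => k[X] ⧸ Ideal.span {c i}) ε)

theorem fittingGenerator_eq_det {M : Type*} [AddCommGroup M] [Module k[X] M]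
    (hM : ∃ g, IsFittingGenerator k M g) {ι : Type*} [Fintype ι] [DecidableEq ι] {x : ι → M}
    {A : Matrix ι ι k[X]} (hA : IsPresentedBy x A) (hmonic : A.det.Monic) :
    fittingGenerator k M = A.det := by
  rw [fittingGenerator, dif_pos hM]
  exact hM.choose_spec.eq_det hA hmonic

theorem fittingGenerator_quotient {g : k[X]} (hg : g.Monic) :
    fittingGenerator k (k[X] ⧸ Ideal.span {g}) = g := by
  let e : (k[X] ⧸ Ideal.span {g}) ≃ₗ[k[X]] (Fin 1 → k[X] ⧸ Ideal.span {g}) :=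
    (LinearEquiv.funUnique (Fin 1) k[X] _).symm
  have h1 : IsFittingGenerator k (k[X] ⧸ Ideal.span {g}) g :=
    ⟨1, fun _ => g, fun _ => hg, ⟨e⟩, by simp⟩
  have h2 := (isPresentedBy_pi_quotient (fun _ : Fin 1 => g)).map e.symm
  have h3 : (Matrix.diagonal (fun _ : Fin 1 => g)).det = g := by simp
  rw [fittingGenerator_eq_det ⟨g, h1⟩ h2 (by rwa [h3]), h3]

theorem fittingGenerator_aeval {V : Type*} [AddCommGroup V] [Module k V] {ι : Type*} [Fintype ι]
    [DecidableEq ι] (b : Module.Basis ι k V) (T : V →ₗ[k] V) :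
    fittingGenerator k (Module.AEval' T) = (LinearMap.toMatrix b b T).charpoly := by
  have : Module.Finite k V := Module.Finite.of_basis b
  have htor : Module.IsTorsion k[X] (Module.AEval' T) := by
    intro x
    -- Cayley–Hamilton supplies the annihilator.
    refine ⟨⟨T.charpoly, mem_nonZeroDivisors_of_ne_zero T.charpoly_monic.ne_zero⟩, ?_⟩
    obtain ⟨v, rfl⟩ := (Module.AEval'.of T).surjective x
    rw [Submonoid.mk_smul, ← Module.AEval.of_aeval_smul, LinearMap.aeval_self_charpoly]
    simp
  have hp := isPresentedBy_aeval b T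
  have hd : (Matrix.charmatrix (LinearMap.toMatrix b b T).transpose).det =
      (LinearMap.toMatrix b b T).charpoly := by
    rw [Matrix.charmatrix_transpose, Matrix.det_transpose]
    rfl
  rw [fittingGenerator_eq_det (exists_isFittingGenerator _ htor) hp
    (by rw [hd]; exact Matrix.charpoly_monic _), hd]

end FittingGenerator

end Taelman

end

noncomputable section

namespace Taelman

/-! ### Periodic difference equations -/

section Difference

variable {R : Type*} [CommRing R]

/-- The sequence `x` solves the difference equation `t x_i = ∑_{j ≤ r} a_{ij} x_{i+j}`. -/
def IsRecSolution {V : Type*} [AddCommGroup V] [Module R V] (t : R) (a : ℕ → ℕ → R) (r : ℕ)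
    (x : ℕ → V) : Prop :=
  ∀ i, t • x i = ∑ j ∈ Finset.range (r + 1), a i j • x (i + j)

/-- The universal solution, with values in `R ^ r`, of the difference equation
`t x_i = ∑_{j ≤ r} a_{ij} x_{i+j}`, which starts with the standard basis. -/
def recSeq (t : R) (a : ℕ → ℕ → R) (r : ℕ) (i : ℕ) : Fin r → R :=
  if h : i < r then Pi.single ⟨i, h⟩ 1
  -- For `r = 0` the recursion would call itself at the same index; the target `Fin 0 → R` is
  -- trivial anyway.
  else if _hr : r = 0 then 0
  else Ring.inverse (a (i - r) r) •
    (t • recSeq t a r (i - r) - ∑ j : Fin r, a (i - r) j • recSeq t a r (i - r + j))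
termination_by i
decreasing_by
  · omega
  · have := j.2
    omega

variable (t : R) (a : ℕ → ℕ → R) (r : ℕ)

theorem recSeq_of_lt (l : Fin r) : recSeq t a r l = Pi.single l 1 := by
  rw [recSeq, dif_pos l.2]

variable {a r}

theorem isRecSolution_recSeq (ha : ∀ i, IsUnit (a i r)) :
    IsRecSolution t a r (recSeq t a r) := by
  intro i
  rcases Nat.eq_zero_or_pos r with hr | hr
  · subst hr
    exact Subsingleton.elim _ _
  · rw [Finset.sum_range_succ, recSeq.eq_1 t a r (i + r), dif_neg (by omega), dif_neg hr.ne',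
      smul_smul, Nat.add_sub_cancel, Ring.mul_inverse_cancel _ (ha i), one_smul,
      Finset.sum_range fun j => a i j • recSeq t a r (i + j)]
    abel

variable {t}

/-- Since the top coefficient is a unit, the equation determines x_{n+r} from earlier values, so a
solution is determined by its first `r` values. This is the universality of `recSeq`. -/
theorem IsRecSolution.eq_sum {V : Type*} [AddCommGroup V] [Module R V] {x : ℕ → V}
    (hx : IsRecSolution t a r x) (ha : ∀ i, IsUnit (a i r)) (i : ℕ) (hr : r ≠ 0) :
    x i = ∑ l, recSeq t a r i l • x l := by
  induction i using Nat.strong_induction_on with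
  | _ i ih =>
    by_cases h : i < r
    · have := recSeq_of_lt t a r ⟨i, h⟩
      simp only at this
      rw [this]
      simp [Pi.single_apply, ite_smul]
    · obtain ⟨n, rfl⟩ : ∃ n, i = n + r := ⟨i - r, by omega⟩
      have h1 := hx n
      have h2 := isRecSolution_recSeq t ha n
      rw [Finset.sum_range_succ] at h1 h2
      have h3 : ∑ l, (t • recSeq t a r n) l • x l = t • x n := by
        rw [ih n (by omega), Finset.smul_sum]
        exact Finset.sum_congr rfl fun l _ => by simp [smul_smul]
      have h4 : ∑ l, (∑ j ∈ Finset.range r, a n j • recSeq t a r (n + j)) l • x l =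
          ∑ j ∈ Finset.range r, a n j • x (n + j) := by
        simp only [Finset.sum_apply, Finset.sum_smul, Pi.smul_apply]
        rw [Finset.sum_comm]
        refine Finset.sum_congr rfl fun j hj => ?_
        rw [ih (n + j) (by have := Finset.mem_range.1 hj; omega), Finset.smul_sum]
        exact Finset.sum_congr rfl fun l _ => by simp [smul_smul]
      rw [h2] at h3
      simp only [Pi.add_apply, add_smul, Finset.sum_add_distrib] at h3
      rw [h4, h1] at h3
      have h5 := add_left_cancel h3
      refine ((ha n).smul_left_cancel).1 ?_
      rw [← h5, Finset.smul_sum]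
      exact Finset.sum_congr rfl fun l _ => by simp [smul_smul]

/-- The image under `ψ` solves the transported equation with the same initial values, so uniqueness
applies. -/
theorem recSeq_map {R' : Type*} [CommRing R'] (ψ : R →+* R') (ha : ∀ i, IsUnit (a i r)) (i : ℕ)
    (l : Fin r) : recSeq (ψ t) (fun i j => ψ (a i j)) r i l = ψ (recSeq t a r i l) := by
  have ha' : ∀ i, IsUnit ((fun i j => ψ (a i j)) i r) := fun i => (ha i).map ψ
  have h1 : IsRecSolution (ψ t) (fun i j => ψ (a i j)) r
      (fun i (l : Fin r) => ψ (recSeq t a r i l)) := by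
    intro i
    funext l
    have := congrArg ψ (congrFun (isRecSolution_recSeq t ha i) l)
    simpa using this
  have hr : r ≠ 0 := by
    have := l.2
    omega
  have h2 := congrFun (h1.eq_sum ha' i hr) l
  rw [h2]
  simp [recSeq_of_lt, Pi.single_apply, apply_ite ψ]

/-- The matrix of the shift by `d` on the solutions of a `d`-periodic difference equation. -/
def monodromy (t : R) (a : ℕ → ℕ → R) (r d : ℕ) : Matrix (Fin r) (Fin r) R :=
  Matrix.of fun l => recSeq t a r (d + l)

theorem IsRecSolution.shift {V : Type*} [AddCommGroup V] [Module R V] {x : ℕ → V} {d : ℕ}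
    (hx : IsRecSolution t a r x) (hd : ∀ i j, a (i + d) j = a i j) :
    IsRecSolution t a r (fun i => x (i + d)) := by
  intro i
  rw [hx (i + d)]
  refine Finset.sum_congr rfl fun j _ => ?_
  rw [hd, add_right_comm]

/-- By periodicity the shifted sequence is again a solution; its initial values are the rows of the
monodromy. -/
theorem recSeq_add_period {d : ℕ} (ha : ∀ i, IsUnit (a i r)) (hd : ∀ i j, a (i + d) j = a i j)
    (i : ℕ) : recSeq t a r (i + d) = Matrix.vecMul (recSeq t a r i) (monodromy t a r d) := by
  rcases Nat.eq_zero_or_pos r with hr | hr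
  · subst hr
    exact Subsingleton.elim _ _
  · have := ((isRecSolution_recSeq t ha).shift hd).eq_sum ha i hr.ne'
    rw [this]
    funext m
    simp [Matrix.vecMul, dotProduct, monodromy, add_comm]

/-- The matrix of `t - ∑_j a_{ij} S ^ j` on the sequences with `x_{i+d} = z x_i`, where `S` is the
shift. -/
def quasiPeriodicMatrix (t : R) (a : ℕ → ℕ → R) (r d : ℕ) (z : R) : Matrix (Fin d) (Fin d) R :=
  Matrix.of fun i l => (if i = l then t else 0) - ∑ j ∈ Finset.range (r + 1),
    if ((i : ℕ) + j) % d = l then a i j * z ^ (((i : ℕ) + j) / d) else 0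

theorem sum_quasiPeriodicMatrix_smul {V : Type*} [AddCommGroup V] [Module R V] {d : ℕ}
    (hd0 : 0 < d) (z : R) (x : Fin d → V) (i : Fin d) :
    ∑ l, quasiPeriodicMatrix t a r d z i l • x l = t • x i - ∑ j ∈ Finset.range (r + 1),
      a i j • z ^ (((i : ℕ) + j) / d) • x ⟨((i : ℕ) + j) % d, Nat.mod_lt _ hd0⟩ := by
  simp only [quasiPeriodicMatrix, Matrix.of_apply, sub_smul, Finset.sum_sub_distrib, ite_smul,
    zero_smul, Finset.sum_ite_eq, Finset.mem_univ, if_true, Finset.sum_smul]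
  rw [Finset.sum_comm]
  congr 1
  refine Finset.sum_congr rfl fun j _ => ?_
  rw [Finset.sum_eq_single ⟨((i : ℕ) + j) % d, Nat.mod_lt _ hd0⟩]
  · simp [smul_smul]
  · intro l _ hl
    rw [if_neg]
    intro h
    exact hl (Fin.ext h.symm)
  · simp

/-- The module of the quasi-periodic solutions (or rather its dual). -/
def quasiPeriodicRelations (t : R) (a : ℕ → ℕ → R) (r d : ℕ) (z : R) : Submodule R (ℕ →₀ R) :=
  Submodule.span R (Set.range (fun i => t • Finsupp.single i (1 : R) -
      ∑ j ∈ Finset.range (r + 1), a i j • Finsupp.single (i + j) (1 : R)) ∪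
    Set.range (fun i => Finsupp.single (i + d) (1 : R) - z • Finsupp.single i (1 : R)))

theorem apply_mod_of_periodic {α : Type*} {a : ℕ → ℕ → α} {d : ℕ}
    (hd : ∀ i j, a (i + d) j = a i j) (i j : ℕ) :
    a (i % d) j = a i j := by
  have : ∀ m, a (i % d + d * m) j = a (i % d) j := by
    intro m
    induction m with
    | zero => simp
    | succ m ih => rw [Nat.mul_succ, ← add_assoc, hd, ih]
  rw [← this (i / d), Nat.mod_add_div]

/-- The two square presentations of the module of quasi-periodic solutions. -/
theorem det_quasiPeriodicMatrix_dvd {d : ℕ} (hd0 : 0 < d) (hr0 : r ≠ 0)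
    (ha : ∀ i, IsUnit (a i r)) (hd : ∀ i j, a (i + d) j = a i j) (z : R) :
    (quasiPeriodicMatrix t a r d z).det ∣ (Matrix.scalar (Fin r) z - monodromy t a r d).det ∧
      (Matrix.scalar (Fin r) z - monodromy t a r d).det ∣
        (quasiPeriodicMatrix t a r d z).det := by
  set K := quasiPeriodicRelations t a r d z with hK
  let x : ℕ → ((ℕ →₀ R) ⧸ K) := fun i => K.mkQ (Finsupp.single i 1)
  have hxrec : IsRecSolution t a r x := by
    intro i
    have : K.mkQ (t • Finsupp.single i (1 : R) -
        ∑ j ∈ Finset.range (r + 1), a i j • Finsupp.single (i + j) (1 : R)) = 0 :=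
      (Submodule.Quotient.mk_eq_zero _).2 (Submodule.subset_span (Or.inl ⟨i, rfl⟩))
    rw [map_sub, map_sum, sub_eq_zero, map_smul] at this
    simpa only [map_smul] using this
  have hxz : ∀ i, x (i + d) = z • x i := by
    intro i
    have : K.mkQ (Finsupp.single (i + d) (1 : R) - z • Finsupp.single i (1 : R)) = 0 :=
      (Submodule.Quotient.mk_eq_zero _).2 (Submodule.subset_span (Or.inr ⟨i, rfl⟩))
    rw [map_sub, sub_eq_zero, map_smul] at this
    exact this
  have hxdiv : ∀ i, x i = z ^ (i / d) • x (i % d) := by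
    intro i
    have : ∀ m, x (i % d + d * m) = z ^ m • x (i % d) := by
      intro m
      induction m with
      | zero => simp
      | succ m ih => rw [Nat.mul_succ, ← add_assoc, hxz, ih, smul_smul, pow_succ']
    rw [← this (i / d), Nat.mod_add_div]
  have hgen : ∀ (S : Submodule R ((ℕ →₀ R) ⧸ K)), (∀ i, x i ∈ S) → ∀ y, y ∈ S := by
    intro S hS y
    obtain ⟨p, rfl⟩ := K.mkQ_surjective y
    induction p using Finsupp.induction_linear with
    | zero => simp
    | add p q hp hq => rw [map_add]; exact S.add_mem hp hq
    | single i c =>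
      have : (Finsupp.single i c : ℕ →₀ R) = c • Finsupp.single i 1 := by simp
      rw [this, map_smul]
      exact S.smul_mem _ (hS i)
  have hmk : ∀ {n : ℕ} (c : Fin n → R), ∑ i, c i • x i = 0 →
      ∑ i, c i • Finsupp.single (i : ℕ) (1 : R) ∈ K := by
    intro n c hc
    rw [← Submodule.Quotient.mk_eq_zero K, ← Submodule.mkQ_apply, map_sum, ← hc]
    exact Finset.sum_congr rfl fun i _ => map_smul _ _ _
  -- First elimination: quasi-periodicity removes all x_i with i ≥ d, and the `d` recursion
  -- relations remain.
  have hpres₁ : IsPresentedBy (fun i : Fin d => x i) (quasiPeriodicMatrix t a r d z) := by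
    refine ⟨fun y => ?_, fun i => ?_, fun c hc => ?_⟩
    · have := hgen (Submodule.span R (Set.range fun i : Fin d => x i)) (fun i => by
        rw [hxdiv]
        exact Submodule.smul_mem _ _ (Submodule.subset_span ⟨⟨i % d, Nat.mod_lt _ hd0⟩, rfl⟩)) y
      obtain ⟨c, hc⟩ := (Submodule.mem_span_range_iff_exists_fun R).1 this
      exact ⟨c, hc.symm⟩
    · rw [sum_quasiPeriodicMatrix_smul hd0, sub_eq_zero, hxrec i]
      exact Finset.sum_congr rfl fun j _ => by rw [hxdiv]
    -- The map `p` carries out the elimination on the free module. It sends every defining relation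
    -- into the row space of the matrix and fixes the chosen generators, so any relation among these
    -- lies in the row space.
    · let p : (ℕ →₀ R) →ₗ[R] (Fin d → R) := Finsupp.linearCombination R fun i =>
        z ^ (i / d) • (Pi.single ⟨i % d, Nat.mod_lt _ hd0⟩ 1 : Fin d → R)
      have hp : ∀ i, p (Finsupp.single i 1) =
          z ^ (i / d) • (Pi.single ⟨i % d, Nat.mod_lt _ hd0⟩ 1 : Fin d → R) := fun i => by
        simp only [p, Finsupp.linearCombination_single, one_smul]
      have hpi : ∀ i : Fin d, p (Finsupp.single i 1) = Pi.single i 1 := fun i => by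
        rw [hp, Nat.div_eq_of_lt i.2, pow_zero, one_smul]
        congr 1
        exact Fin.ext (Nat.mod_eq_of_lt i.2)
      have hle : K ≤ (LinearMap.range (quasiPeriodicMatrix t a r d z).vecMulLinear).comap p := by
        rw [hK, quasiPeriodicRelations, Submodule.span_le]
        rintro _ (⟨i, rfl⟩ | ⟨i, rfl⟩)
        · refine ⟨z ^ (i / d) • Pi.single ⟨i % d, Nat.mod_lt _ hd0⟩ 1, ?_⟩
          rw [map_smul, Matrix.vecMulLinear_apply, Matrix.single_one_vecMul]
          have h1 := sum_quasiPeriodicMatrix_smul (t := t) (a := a) (r := r) hd0 z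
            (fun l : Fin d => (Pi.single l 1 : Fin d → R)) ⟨i % d, Nat.mod_lt _ hd0⟩
          have h2 : ∑ l, quasiPeriodicMatrix t a r d z ⟨i % d, Nat.mod_lt _ hd0⟩ l •
              (Pi.single l 1 : Fin d → R) =
              (quasiPeriodicMatrix t a r d z).row ⟨i % d, Nat.mod_lt _ hd0⟩ := by
            funext m
            simp [Pi.single_apply]
          rw [← h2, h1, map_sub, map_sum, map_smul, hp, smul_sub, smul_comm, Finset.smul_sum]
          congr 1
          refine Finset.sum_congr rfl fun j _ => ?_
          have h3 : (i + j) / d = i / d + (i % d + j) / d := by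
            conv_lhs => rw [← Nat.mod_add_div i d, add_right_comm, Nat.add_mul_div_left _ _ hd0]
            exact add_comm _ _
          rw [map_smul, hp, h3, pow_add, smul_comm, ← smul_smul, apply_mod_of_periodic hd]
          simp only [Nat.mod_add_mod]
        · refine ⟨0, ?_⟩
          rw [map_zero, map_sub, map_smul, hp, hp, Nat.add_div_right _ hd0, pow_succ', ← smul_smul]
          simp only [Nat.add_mod_right, sub_self]
      obtain ⟨y, hy⟩ := hle (hmk c hc)
      refine ⟨y, ?_⟩
      rw [Matrix.vecMulLinear_apply] at hy
      rw [hy, map_sum]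
      simp only [map_smul, hpi]
      funext m
      simp [Pi.single_apply]
  -- Second elimination: the recursion removes all x_i with i ≥ r, and the `r` relations x_{d+l} = z
  -- x_l remain.
  have hpres₂ : IsPresentedBy (fun l : Fin r => x l)
      (Matrix.scalar (Fin r) z - monodromy t a r d) := by
    refine ⟨fun y => ?_, fun l => ?_, fun c hc => ?_⟩
    · have := hgen (Submodule.span R (Set.range fun i : Fin r => x i)) (fun i => by
        rw [hxrec.eq_sum ha i hr0]
        exact Submodule.sum_mem _ fun l _ =>
          Submodule.smul_mem _ _ (Submodule.subset_span ⟨l, rfl⟩)) y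
      obtain ⟨c, hc⟩ := (Submodule.mem_span_range_iff_exists_fun R).1 this
      exact ⟨c, hc.symm⟩
    · have h1 := hxrec.eq_sum ha (d + l) hr0
      rw [add_comm, hxz] at h1
      simp only [Matrix.sub_apply, Matrix.scalar_apply, Matrix.diagonal_apply, sub_smul,
        Finset.sum_sub_distrib, ite_smul, zero_smul, Finset.sum_ite_eq, Finset.mem_univ, if_true]
      rw [h1, sub_eq_zero]
      simp [monodromy, add_comm]
    · let p : (ℕ →₀ R) →ₗ[R] (Fin r → R) := Finsupp.linearCombination R (recSeq t a r)
      have hp : ∀ i, p (Finsupp.single i 1) = recSeq t a r i := fun i => by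
        simp only [p, Finsupp.linearCombination_single, one_smul]
      have hle : K ≤ (LinearMap.range
          (Matrix.scalar (Fin r) z - monodromy t a r d).vecMulLinear).comap p := by
        rw [hK, quasiPeriodicRelations, Submodule.span_le]
        rintro _ (⟨i, rfl⟩ | ⟨i, rfl⟩)
        · refine ⟨0, ?_⟩
          rw [map_zero, map_sub, map_smul, map_sum, hp, eq_comm, sub_eq_zero,
            isRecSolution_recSeq t ha i]
          exact Finset.sum_congr rfl fun j _ => by rw [map_smul, hp]
        · refine ⟨-recSeq t a r i, ?_⟩
          rw [Matrix.vecMulLinear_apply, map_sub, map_smul, hp, hp, recSeq_add_period ha hd,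
            Matrix.vecMul_sub, Matrix.neg_vecMul, Matrix.neg_vecMul, sub_neg_eq_add, neg_add_eq_sub]
          congr 1
          funext m
          rw [Matrix.scalar_apply, Matrix.vecMul_diagonal, mul_comm]
          rfl
      obtain ⟨y, hy⟩ := hle (hmk c hc)
      refine ⟨y, ?_⟩
      rw [Matrix.vecMulLinear_apply] at hy
      rw [hy, map_sum]
      simp only [map_smul, hp, recSeq_of_lt]
      funext m
      simp [Pi.single_apply]
  exact ⟨hpres₁.det_dvd_det hpres₂, hpres₂.det_dvd_det hpres₁⟩

end Difference

end Taelman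

end

noncomputable section

namespace Taelman

/-! ### The determinant as a polynomial in t and z: constant term and weighted degree. -/

section SpectralCurve

theorem quasiPeriodicMatrix_map {R R' : Type*} [CommRing R] [CommRing R'] (ψ : R →+* R') (t : R)
    (a : ℕ → ℕ → R) (r d : ℕ) (z : R) :
    (quasiPeriodicMatrix t a r d z).map ψ =
      quasiPeriodicMatrix (ψ t) (fun i j => ψ (a i j)) r d (ψ z) := by
  ext i l
  simp [quasiPeriodicMatrix, map_sum, apply_ite ψ]

/-- An entry below the diagonal arises only when i + j wraps around past d, and then it carries a
positive power of z = 0. The matrix is thus upper triangular. -/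
theorem det_quasiPeriodicMatrix_zero {R : Type*} [CommRing R] (t : R) (a : ℕ → ℕ → R) (r d : ℕ) :
    (quasiPeriodicMatrix t a r d 0).det = ∏ i : Fin d, (t - a i 0) := by
  rw [Matrix.det_of_isUpperTriangular]
  · refine Finset.prod_congr rfl fun i _ => ?_
    simp only [quasiPeriodicMatrix, Matrix.of_apply, if_true]
    congr 1
    rw [Finset.sum_eq_single 0]
    · simp [Nat.mod_eq_of_lt i.2, Nat.div_eq_of_lt i.2]
    · intro j _ hj
      split_ifs with h
      · rw [zero_pow, mul_zero]
        intro h0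
        have := (Nat.div_eq_zero_iff_lt (by have := i.2; omega)).1 h0
        rw [Nat.mod_eq_of_lt this] at h
        omega
      · rfl
    · simp
  · intro i l hil
    simp only [id] at hil
    simp only [quasiPeriodicMatrix, Matrix.of_apply]
    rw [if_neg hil.ne', zero_sub, neg_eq_zero]
    refine Finset.sum_eq_zero fun j _ => ?_
    split_ifs with h
    · rw [zero_pow, mul_zero]
      intro h0
      have := (Nat.div_eq_zero_iff_lt (by have := i.2; omega)).1 h0
      rw [Nat.mod_eq_of_lt this] at h
      have : (l : ℕ) < i := hil
      omega
    · rfl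

theorem det_quasiPeriodicMatrix_order_zero {R : Type*} [CommRing R] (t : R) (a : ℕ → ℕ → R)
    (d : ℕ) (z : R) : (quasiPeriodicMatrix t a 0 d z).det = ∏ i : Fin d, (t - a i 0) := by
  have : quasiPeriodicMatrix t a 0 d z = Matrix.diagonal fun i : Fin d => t - a i 0 := by
    ext i l
    simp only [quasiPeriodicMatrix, Matrix.of_apply, zero_add, Finset.range_one,
      Finset.sum_singleton, add_zero, Nat.mod_eq_of_lt i.2, Nat.div_eq_of_lt i.2, pow_zero, mul_one,
      Matrix.diagonal_apply, Fin.val_inj]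
    split_ifs <;> simp
  rw [this, Matrix.det_diagonal]

/-- Scaling column l by X^l multiplies the determinant by X^{∑ l}, while row i then has degree at
most D + i. The sums over i and l cancel and leave d D. -/
theorem natDegree_det_le_of_weighted {S : Type*} [CommRing S] {d D : ℕ}
    (M : Matrix (Fin d) (Fin d) S[X])
    (hM : ∀ i l : Fin d, (M i l * X ^ (l : ℕ)).natDegree ≤ D + i) : M.det.natDegree ≤ d * D := by
  nontriviality S
  rcases eq_or_ne M.det 0 with h0 | h0
  · simp [h0]
  have h1 : (M * Matrix.diagonal fun l : Fin d => (X : S[X]) ^ (l : ℕ)).det =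
      M.det * X ^ (∑ l : Fin d, (l : ℕ)) := by
    rw [Matrix.det_mul, Matrix.det_diagonal, Finset.prod_pow_eq_pow_sum]
  have h2 : (M * Matrix.diagonal fun l : Fin d => (X : S[X]) ^ (l : ℕ)).det.natDegree ≤
      ∑ i : Fin d, (D + (i : ℕ)) := by
    rw [← Matrix.det_transpose, Matrix.det_apply]
    refine natDegree_sum_le_of_forall_le _ _ fun σ _ => ?_
    refine (natDegree_smul_le _ _).trans ((natDegree_prod_le _ _).trans ?_)
    refine Finset.sum_le_sum fun i _ => ?_
    rw [Matrix.transpose_apply, Matrix.mul_diagonal]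
    exact hM _ _
  rw [h1, natDegree_mul_X_pow _ h0, Finset.sum_add_distrib] at h2
  simpa using h2

variable {E : Type*} [Field E]

/-- The characteristic polynomial of the monodromy, up to a constant factor: the determinant of
`t - ∑_j a_{ij} S ^ j` on the sequences with `x_{i+d} = z x_i`, as an element of `E[t][z]`. -/
def spectralPoly (a : ℕ → ℕ → E) (r d : ℕ) : E[X][X] :=
  (quasiPeriodicMatrix (C X : E[X][X]) (fun i j => C (C (a i j))) r d X).det

/-- The monodromy matrix over `E[t]`. -/
abbrev polyMonodromy (a : ℕ → ℕ → E) (r d : ℕ) : Matrix (Fin r) (Fin r) E[X] :=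
  monodromy (X : E[X]) (fun i j => C (a i j)) r d

theorem eval₂_spectralPoly {R : Type*} [CommRing R] (ψ : E[X] →+* R) (z : R) (a : ℕ → ℕ → E)
    (r d : ℕ) : (spectralPoly a r d).eval₂ ψ z =
      (quasiPeriodicMatrix (ψ X) (fun i j => ψ (C (a i j))) r d z).det := by
  rw [← coe_eval₂RingHom, spectralPoly, RingHom.map_det, RingHom.mapMatrix_apply,
    quasiPeriodicMatrix_map]
  simp

theorem spectralPoly_coeff_zero (a : ℕ → ℕ → E) (r d : ℕ) :
    (spectralPoly a r d).coeff 0 = ∏ i : Fin d, (X - C (a i 0)) := by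
  rw [coeff_zero_eq_eval_zero, eval, eval₂_spectralPoly, det_quasiPeriodicMatrix_zero]
  rfl

/-- The two determinants divide each other in E[t][z], whose units are the nonzero constants of `E`.
-/
theorem exists_charpoly_polyMonodromy {a : ℕ → ℕ → E} {r d : ℕ} (hd0 : 0 < d) (hr0 : r ≠ 0)
    (ha : ∀ i, a i r ≠ 0) (hd : ∀ i j, a (i + d) j = a i j) :
    ∃ c : E, c ≠ 0 ∧ (polyMonodromy a r d).charpoly = C (C c) * spectralPoly a r d := by
  have hu : ∀ i, IsUnit (C (a i r) : E[X]) := fun i => isUnit_C.2 (ha i).isUnit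
  have h := det_quasiPeriodicMatrix_dvd (R := E[X][X]) (t := C X)
    (a := fun i j => C (C (a i j))) (r := r) hd0 hr0 (fun i => (hu i).map C)
    (fun i j => by simp only [hd]) X
  have h1 : (Matrix.scalar (Fin r) (X : E[X][X]) -
      monodromy (C X : E[X][X]) (fun i j => C (C (a i j))) r d).det =
      (polyMonodromy a r d).charpoly := by
    rw [Matrix.charpoly, Matrix.charmatrix]
    congr 2
    refine Matrix.ext fun l m => ?_
    simp only [monodromy, Matrix.of_apply, RingHom.mapMatrix_apply, Matrix.map_apply]
    exact recSeq_map (t := X) (a := fun i j => C (a i j)) C hu _ _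
  rw [h1] at h
  obtain ⟨u, hu'⟩ := associated_of_dvd_dvd h.1 h.2
  obtain ⟨v, hv, hvu⟩ := Polynomial.isUnit_iff.1 u.isUnit
  obtain ⟨c, hc, hcv⟩ := Polynomial.isUnit_iff.1 hv
  refine ⟨c, hc.ne_zero, ?_⟩
  rw [← hu', ← hvu, ← hcv, mul_comm]
  rfl

/-- The substitution `t = y ^ r`, `z = z y ^ d`. -/
def weightHom (E : Type*) [Field E] (r d : ℕ) : E[X][X] →+* E[X][X] :=
  eval₂RingHom (eval₂RingHom ((C : E[X] →+* E[X][X]).comp C) (X ^ r)) (C X * X ^ d)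

/-- The monomial t^α z^β goes to z^β y^{rα+dβ}. As `r ≠ 0`, distinct monomials have distinct images,
so nothing cancels and the y-degree measures the weighted degree. -/
theorem coeff_coeff_weightHom {r : ℕ} (hr : r ≠ 0) (d : ℕ) (P : E[X][X]) (α β : ℕ) :
    ((weightHom E r d P).coeff (r * α + d * β)).coeff β = (P.coeff β).coeff α := by
  induction P using Polynomial.induction_on' with
  | add p q hp hq => simp [hp, hq]
  | monomial m p =>
    induction p using Polynomial.induction_on' with
    | add p q hp hq =>
      rw [map_add, map_add, coeff_add, coeff_add, hp, hq, coeff_add, coeff_add]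
    | monomial n c =>
      have : weightHom E r d (monomial m (monomial n c)) =
          C (C c * X ^ m) * X ^ (r * n + d * m) := by
        simp only [weightHom, coe_eval₂RingHom, eval₂_monomial, RingHom.comp_apply, map_mul,
          map_pow, mul_pow, pow_add, pow_mul]
        ring
      rw [this, coeff_C_mul, coeff_X_pow, coeff_monomial]
      by_cases hm : m = β
      · subst hm
        rw [if_pos rfl, coeff_monomial]
        by_cases hn : n = α
        · subst hn
          simp
        · rw [if_neg hn, if_neg]
          · simp
          · intro h
            have h2 : r * α = r * n := by omega
            exact hn (Nat.eq_of_mul_eq_mul_left (Nat.pos_of_ne_zero hr) h2).symm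
      · rw [if_neg hm]
        split_ifs
        · rw [mul_one, coeff_C_mul, coeff_X_pow, if_neg (Ne.symm hm)]
          simp
        · simp

/-- With weight r for t, d for z and 1 for the shift S, the operator t - ∑_{j ≤ r} a_{ij} S^j has
weight at most r, so its d × d determinant has weight at most d r. -/
theorem natDegree_weightHom_spectralPoly_le (a : ℕ → ℕ → E) (r d : ℕ) :
    (weightHom E r d (spectralPoly a r d)).natDegree ≤ d * r := by
  rw [weightHom, coe_eval₂RingHom, eval₂_spectralPoly]
  refine natDegree_det_le_of_weighted _ fun i l => ?_
  simp only [quasiPeriodicMatrix, Matrix.of_apply, sub_mul, Finset.sum_mul, coe_eval₂RingHom,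
    eval₂_X, eval₂_C, RingHom.comp_apply]
  refine (natDegree_sub_le _ _).trans (max_le ?_ ?_)
  · split_ifs with h
    · rw [← pow_add, h]
      exact natDegree_X_pow_le _
    · simp
  · refine natDegree_sum_le_of_forall_le _ _ fun j hj => ?_
    split_ifs with h
    · rw [mul_pow, ← C_pow, ← pow_mul, mul_assoc, mul_assoc, ← pow_add]
      refine (natDegree_C_mul_le _ _).trans ((natDegree_C_mul_le _ _).trans
        ((natDegree_X_pow_le _).trans ?_))
      -- The wraps and the column weight add up to d ⌊(i+j)/d⌋ + (i+j) mod d = i + j ≤ i + r.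
      have h1 := Nat.div_add_mod ((i : ℕ) + j) d
      have h2 := Finset.mem_range.1 hj
      omega
    · simp

/-- The Newton polygon form of the Riemann hypothesis for Frobenius, obtained purely from weights.
-/
theorem natDegree_coeff_spectralPoly_le (a : ℕ → ℕ → E) {r : ℕ} (hr : r ≠ 0) (d β : ℕ)
    (h : (spectralPoly a r d).coeff β ≠ 0) :
    r * ((spectralPoly a r d).coeff β).natDegree + d * β ≤ d * r := by
  refine le_trans ?_ (natDegree_weightHom_spectralPoly_le a r d)
  refine le_natDegree_of_ne_zero fun h0 => ?_
  have := coeff_coeff_weightHom hr d (spectralPoly a r d)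
    ((spectralPoly a r d).coeff β).natDegree β
  rw [h0, coeff_zero, coeff_natDegree] at this
  exact h (leadingCoeff_eq_zero.1 this.symm)

end SpectralCurve

end Taelman

end

noncomputable section

namespace Taelman

/-! ### Bases of Tate modules -/

section TateBasis

variable {R : Type*} [CommRing R] {V : Type*} [AddCommGroup V] [Module R V] {h : R}

theorem Torsion.pow_smul_val {m : ℕ} (x : Torsion V h m) : h ^ m • x.val = 0 :=
  (Submodule.mem_torsionBySet_iff _ _).1 x.2
    ⟨h ^ m, Ideal.pow_mem_pow (Ideal.mem_span_singleton_self h) m⟩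

/-- An element of `V` that is killed by `h ^ m`, as a torsion element. -/
def Torsion.ofVal {m : ℕ} (v : V) (hv : h ^ m • v = 0) : Torsion V h m :=
  ⟨v, (Submodule.mem_torsionBySet_iff _ _).2 fun a => by
    obtain ⟨b, hb⟩ : h ^ m ∣ a.1 := by
      rw [← Ideal.mem_span_singleton, ← Ideal.span_singleton_pow]
      exact a.2
    rw [hb, mul_comm, mul_smul, hv, smul_zero]⟩

theorem Torsion.ext_val {m : ℕ} {x y : Torsion V h m} (hxy : x.val = y.val) : x = y :=
  Subtype.ext hxy

/-- The component in `V[h ^ m]` of an element of the Tate module. -/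
def tateComponent (m : ℕ) : tateModule V h →+ V where
  toFun x := (x.1 m).val
  map_zero' := rfl
  map_add' _ _ := rfl

theorem smul_tateComponent_succ (x : tateModule V h) (m : ℕ) :
    h • tateComponent (m + 1) x = tateComponent m x := x.2 m

theorem pow_smul_tateComponent (x : tateModule V h) (m k : ℕ) :
    h ^ k • tateComponent (m + k) x = tateComponent m x := by
  induction k with
  | zero => simp
  | succ k ih => rw [pow_succ, mul_smul, ← add_assoc, smul_tateComponent_succ, ih]

theorem tateComponent_smul {m : ℕ} (a : AdicCompletion (Ideal.span {h}) R) (x : tateModule V h)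
    (r : R) (hr : AdicCompletion.evalₐ (Ideal.span {h}) m a = Ideal.Quotient.mk _ r) :
    tateComponent m (a • x) = r • tateComponent m x :=
  Torsion.val_smul a (x.1 m) r hr

theorem tateModule_ext {x y : tateModule V h} (hxy : ∀ m, tateComponent m x = tateComponent m y) :
    x = y :=
  Subtype.ext (funext fun m => Torsion.ext_val (hxy m))

/-- Repeated division by `h` lifts a torsion point to a compatible system. -/
theorem exists_tateComponent_one (hsurj : ∀ v : V, ∃ w, h • w = v) (v : V) (hv : h • v = 0) :
    ∃ x : tateModule V h, tateComponent 1 x = v := by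
  choose s hs using hsurj
  -- Component 0 must vanish, so `v` sits at index 1 and the iterates of the division `s` start
  -- there.
  let u : ℕ → V := fun m => Nat.rec 0 (fun m _ => s^[m] v) m
  have hu : ∀ m, h • u (m + 1) = u m := by
    rintro (_ | m)
    · exact hv
    · change h • s^[m + 1] v = s^[m] v
      rw [Function.iterate_succ_apply', hs]
  have hpow : ∀ m, h ^ m • u m = 0 := by
    intro m
    induction m with
    | zero => exact smul_zero _
    | succ m ih => rw [pow_succ, mul_smul, hu, ih]
  exact ⟨⟨fun m => Torsion.ofVal (u m) (hpow m), hu⟩, rfl⟩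

variable {s : ℕ} (x : Fin s → tateModule V h)

/-- The multiple h^m v lies in V[h]. Expanding it in the generators and subtracting the same
combination at level m + 1 leaves an element killed by h^m. -/
theorem exists_eq_sum_tateComponent
    (hgen : ∀ v : V, h • v = 0 → ∃ c : Fin s → R, v = ∑ i, c i • tateComponent 1 (x i))
    (m : ℕ) (v : V) (hv : h ^ m • v = 0) :
    ∃ c : Fin s → R, v = ∑ i, c i • tateComponent m (x i) := by
  induction m generalizing v with
  | zero => exact ⟨0, by simpa using hv⟩
  | succ m ih =>
    obtain ⟨c, hc⟩ := hgen (h ^ m • v) (by rw [smul_smul, ← pow_succ', hv])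
    obtain ⟨b, hb⟩ := ih (v - ∑ i, c i • tateComponent (m + 1) (x i)) (by
      rw [smul_sub, hc, Finset.smul_sum, sub_eq_zero]
      refine Finset.sum_congr rfl fun i _ => ?_
      rw [smul_comm, add_comm m 1, pow_smul_tateComponent])
    refine ⟨fun i => h * b i + c i, ?_⟩
    rw [sub_eq_iff_eq_add] at hb
    rw [hb, ← Finset.sum_add_distrib]
    refine Finset.sum_congr rfl fun i _ => ?_
    rw [add_smul, mul_comm, mul_smul, smul_tateComponent_succ]

/-- Multiplying by h^m gives a relation at level 1, so every coefficient is divisible by h; dividing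
it out lowers the level by one. -/
theorem dvd_of_sum_tateComponent_eq_zero
    (hind : ∀ c : Fin s → R, ∑ i, c i • tateComponent 1 (x i) = 0 → ∀ i, h ∣ c i)
    (m : ℕ) (c : Fin s → R)
    (hc : ∑ i, c i • tateComponent m (x i) = 0) (i : Fin s) : h ^ m ∣ c i := by
  induction m generalizing c i with
  | zero => simp
  | succ m ih =>
    have h1 := hind c (by
      rw [← smul_zero (h ^ m), ← hc, Finset.smul_sum]
      refine Finset.sum_congr rfl fun i _ => ?_
      rw [smul_comm, add_comm m 1, pow_smul_tateComponent])
    choose b hb using h1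
    rw [hb i, pow_succ']
    refine mul_dvd_mul_left _ (ih b ?_ i)
    rw [← hc]
    refine Finset.sum_congr rfl fun i _ => ?_
    rw [hb i, mul_comm, mul_smul, smul_tateComponent_succ]

theorem tateComponent_sum_smul {m : ℕ} (g : Fin s → AdicCompletion (Ideal.span {h}) R)
    (c : Fin s → R)
    (hc : ∀ i, AdicCompletion.evalₐ (Ideal.span {h}) m (g i) = Ideal.Quotient.mk _ (c i)) :
    tateComponent m (∑ i, g i • x i) = ∑ i, c i • tateComponent m (x i) := by
  rw [map_sum]
  exact Finset.sum_congr rfl fun i _ => tateComponent_smul _ _ _ (hc i)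

theorem linearIndependent_tate
    (hind : ∀ c : Fin s → R, ∑ i, c i • tateComponent 1 (x i) = 0 → ∀ i, h ∣ c i) :
    LinearIndependent (AdicCompletion (Ideal.span {h}) R) x := by
  rw [Fintype.linearIndependent_iff]
  intro g hg i
  refine AdicCompletion.ext_evalₐ fun m => ?_
  choose c hc using fun i =>
    Ideal.Quotient.mk_surjective (AdicCompletion.evalₐ (Ideal.span {h}) m (g i))
  have h1 := tateComponent_sum_smul x g c (fun i => (hc i).symm)
  rw [hg, map_zero] at h1
  have h2 := dvd_of_sum_tateComponent_eq_zero x hind m c h1.symm i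
  rw [← hc i, map_zero, Ideal.Quotient.eq_zero_iff_mem, Ideal.span_singleton_pow,
    Ideal.mem_span_singleton]
  exact h2

/-- The coefficients of `y` at level m are unique modulo h^m. Those of successive levels are
therefore congruent and converge in the completion. -/
theorem span_tate_eq_top
    (hgen : ∀ v : V, h • v = 0 → ∃ c : Fin s → R, v = ∑ i, c i • tateComponent 1 (x i))
    (hind : ∀ c : Fin s → R, ∑ i, c i • tateComponent 1 (x i) = 0 → ∀ i, h ∣ c i) :
    ⊤ ≤ Submodule.span (AdicCompletion (Ideal.span {h}) R) (Set.range x) := by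
  intro y _
  rw [Submodule.mem_span_range_iff_exists_fun]
  choose c hc using fun m => exists_eq_sum_tateComponent x hgen m (tateComponent m y)
    (Torsion.pow_smul_val (y.1 m))
  have hcauchy : ∀ i m, c m i ≡ c (m + 1) i
      [SMOD ((Ideal.span {h} : Ideal R) ^ m • ⊤ : Submodule R R)] := by
    intro i m
    rw [SModEq.sub_mem, Ideal.smul_top_eq_map, Algebra.algebraMap_self, Ideal.map_id,
      Submodule.restrictScalars_self,
      Ideal.span_singleton_pow, Ideal.mem_span_singleton]
    refine dvd_of_sum_tateComponent_eq_zero x hind m (fun i => c m i - c (m + 1) i) ?_ i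
    simp only [sub_smul, Finset.sum_sub_distrib]
    rw [← hc m, sub_eq_zero, ← smul_tateComponent_succ, hc (m + 1), Finset.smul_sum]
    refine Finset.sum_congr rfl fun i _ => ?_
    rw [smul_comm, smul_tateComponent_succ]
  let g : Fin s → AdicCompletion (Ideal.span {h}) R := fun i =>
    AdicCompletion.mk _ _ (AdicCompletion.AdicCauchySequence.mk _ _ (fun m => c m i) (hcauchy i))
  refine ⟨g, tateModule_ext fun m => ?_⟩
  rw [tateComponent_sum_smul x g (c m) fun i => AdicCompletion.evalₐ_mk _ _ _, ← hc m]

end TateBasis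

end Taelman

end

noncomputable section

namespace Taelman

/-! ### Additive polynomials -/

section Additive

variable {E : Type*} [Field E] (q : ℕ) (α : ℕ → E) (r : ℕ)

/-- The additive polynomial `∑_{j ≤ r} α_j X ^ (q ^ j)`. -/
def additivePoly : E[X] := ∑ j ∈ Finset.range (r + 1), C (α j) * X ^ q ^ j

/-- The `n`-fold composite of `∑_{j ≤ r} α_j X ^ (q ^ j)` with itself. -/
def additiveIter (n : ℕ) : E[X] := (additivePoly q α r).comp^[n] X

theorem additiveIter_succ (n : ℕ) :
    additiveIter q α r (n + 1) = (additivePoly q α r).comp (additiveIter q α r n) := by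
  rw [additiveIter, Function.iterate_succ_apply']
  rfl

variable {q α r}

theorem natDegree_additivePoly (hq : 1 < q) (hα : α r ≠ 0) :
    (additivePoly q α r).natDegree = q ^ r := by
  rw [additivePoly, Finset.sum_range_succ]
  rw [natDegree_add_eq_right_of_natDegree_lt]
  · exact natDegree_C_mul_X_pow _ _ hα
  · rw [natDegree_C_mul_X_pow _ _ hα]
    refine lt_of_le_of_lt (natDegree_sum_le_of_forall_le (n := q ^ r - 1) _ _ fun j hj => ?_) ?_
    · refine (natDegree_C_mul_X_pow_le _ _).trans ?_
      exact Nat.le_sub_one_of_lt (Nat.pow_lt_pow_right hq (Finset.mem_range.1 hj))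
    · exact Nat.sub_one_lt (pow_ne_zero _ (by omega))

theorem natDegree_additiveIter (hq : 1 < q) (hα : α r ≠ 0) (n : ℕ) :
    (additiveIter q α r n).natDegree = q ^ (r * n) := by
  induction n with
  | zero => simp [additiveIter]
  | succ n ih =>
    rw [additiveIter_succ, natDegree_comp, natDegree_additivePoly hq hα, ih, ← pow_add]
    congr 1
    ring

theorem derivative_additivePoly (hq : (q : E) = 0) :
    derivative (additivePoly q α r) = C (α 0) := by
  rw [additivePoly, Finset.sum_range_succ', derivative_add, derivative_sum,
    Finset.sum_eq_zero, zero_add]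
  · simp
  · intro j _
    rw [derivative_C_mul, derivative_X_pow]
    simp [hq]

theorem derivative_additiveIter (hq : (q : E) = 0) (n : ℕ) :
    derivative (additiveIter q α r n) = C (α 0 ^ n) := by
  induction n with
  | zero => simp [additiveIter]
  | succ n ih =>
    rw [additiveIter_succ, derivative_comp, ih, derivative_additivePoly hq, C_comp, ← C_mul,
      pow_succ]

theorem additiveIter_rank_zero (n : ℕ) : additiveIter q α 0 n = C (α 0 ^ n) * X := by
  induction n with
  | zero => simp [additiveIter]
  | succ n ih =>
    rw [additiveIter_succ, ih, additivePoly]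
    simp only [zero_add, Finset.range_one, Finset.sum_singleton, pow_zero, pow_one, mul_comp,
      C_comp, X_comp, pow_succ', C_mul]
    ring

variable {Fq : Type*} [Field Fq] [Algebra Fq E]

variable (q α r) in
/-- The polynomial that describes the action of `a` on the `Fq[X]`-module `E` in which `X` acts
as an additive polynomial. -/
def actionPoly (a : Fq[X]) : E[X] := a.sum fun n c => C (algebraMap Fq E c) * additiveIter q α r n

theorem eval_additiveIter {T : E →ₗ[Fq] E} (hT : ∀ x, T x = (additivePoly q α r).eval x) (n : ℕ)
    (x : E) : (additiveIter q α r n).eval x = (T ^ n) x := by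
  induction n with
  | zero => simp [additiveIter]
  | succ n ih => rw [additiveIter_succ, eval_comp, ih, ← hT, pow_succ', Module.End.mul_apply]

theorem eval_actionPoly {T : E →ₗ[Fq] E} (hT : ∀ x, T x = (additivePoly q α r).eval x)
    (a : Fq[X]) (x : E) : (actionPoly q α r a).eval x = aeval T a x := by
  rw [actionPoly, Polynomial.sum, eval_finsetSum, aeval_eq_sum_range, LinearMap.sum_apply,
    ← sum_over_range' a (f := fun n c => (c • T ^ n) x) (by simp) _ (Nat.lt_succ_self _),
    Polynomial.sum]
  refine Finset.sum_congr rfl fun n _ => ?_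
  rw [eval_mul, eval_C, eval_additiveIter hT, LinearMap.smul_apply, Algebra.smul_def]

/-- In the relevant characteristic only the linear term of an additive polynomial survives
differentiation. A nonzero constant derivative will give separability. -/
theorem derivative_actionPoly (hq : (q : E) = 0) (a : Fq[X]) :
    derivative (actionPoly q α r a) = C (aeval (α 0) a) := by
  rw [actionPoly, Polynomial.sum, derivative_sum, aeval_eq_sum_range, map_sum,
    ← sum_over_range' a (f := fun n c => C (c • α 0 ^ n)) (by simp) _ (Nat.lt_succ_self _),
    Polynomial.sum]
  refine Finset.sum_congr rfl fun n _ => ?_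
  rw [derivative_C_mul, derivative_additiveIter hq, ← C_mul, Algebra.smul_def]

/-- For `r = 0` the coefficient `α 0` may vanish; the polynomial is then `C (aeval (α 0) a) * X`,
and its degree comes from `ha`. -/
theorem natDegree_actionPoly (hq : 1 < q) (hα : r ≠ 0 → α r ≠ 0) {a : Fq[X]}
    (ha : aeval (α 0) a ≠ 0) : (actionPoly q α r a).natDegree = q ^ (r * a.natDegree) := by
  rcases eq_or_ne r 0 with rfl | hr
  · have : actionPoly q α 0 a = C (aeval (α 0) a) * X := by
      rw [actionPoly, Polynomial.sum, aeval_eq_sum_range, map_sum, Finset.sum_mul,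
        ← sum_over_range' a (f := fun n c => C (c • α 0 ^ n) * X) (by simp) _
          (Nat.lt_succ_self _), Polynomial.sum]
      refine Finset.sum_congr rfl fun n _ => ?_
      rw [additiveIter_rank_zero, ← mul_assoc, ← C_mul, Algebra.smul_def]
    rw [this, natDegree_C_mul_X _ ha]
    simp
  · have ha0 : a ≠ 0 := fun h => ha (by simp [h])
    have hlead : algebraMap Fq E a.leadingCoeff ≠ 0 := by
      simpa using ha0
    rw [actionPoly, sum_over_range' a (by simp) _ (Nat.lt_succ_self _), Finset.sum_range_succ,
      coeff_natDegree]
    have h1 : (C (algebraMap Fq E a.leadingCoeff) * additiveIter q α r a.natDegree).natDegree =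
        q ^ (r * a.natDegree) := by
      rw [natDegree_C_mul hlead, natDegree_additiveIter hq (hα hr)]
    rw [natDegree_add_eq_right_of_natDegree_lt, h1]
    rw [h1]
    refine lt_of_le_of_lt
      (natDegree_sum_le_of_forall_le (n := q ^ (r * a.natDegree) - 1) _ _ fun j hj => ?_) ?_
    · refine (natDegree_C_mul_le _ _).trans ?_
      rw [natDegree_additiveIter hq (hα hr)]
      exact Nat.le_sub_one_of_lt (Nat.pow_lt_pow_right hq
        (Nat.mul_lt_mul_of_pos_left (Finset.mem_range.1 hj) (Nat.pos_of_ne_zero hr)))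
    · exact Nat.sub_one_lt (pow_ne_zero _ (by omega))

/-- The kernel is the root set of a separable polynomial, so over an algebraically closed field its
size is the degree. -/
theorem natCard_ker_aeval [IsAlgClosed E] (hq : 1 < q) (hq0 : (q : E) = 0)
    (hα : r ≠ 0 → α r ≠ 0) {T : E →ₗ[Fq] E} (hT : ∀ x, T x = (additivePoly q α r).eval x)
    {a : Fq[X]} (ha : aeval (α 0) a ≠ 0) :
    Nat.card {x : E // aeval T a x = 0} = q ^ (r * a.natDegree) := by
  classical
  have hsep : (actionPoly q α r a).Separable := by
    rw [separable_def, derivative_actionPoly hq0]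
    exact ⟨0, C (aeval (α 0) a)⁻¹, by rw [zero_mul, zero_add, ← C_mul, inv_mul_cancel₀ ha, C_1]⟩
  have hne : actionPoly q α r a ≠ 0 := hsep.ne_zero
  have h1 := card_rootSet_eq_natDegree (K := E) hsep (IsAlgClosed.splits _)
  rw [natDegree_actionPoly hq hα ha, ← Nat.card_eq_fintype_card] at h1
  rw [← h1]
  refine Nat.card_congr (Equiv.subtypeEquivRight fun x => ?_)
  rw [mem_rootSet, ← eval_actionPoly hT, coe_aeval_eq_eval]
  simp [hne]

theorem aeval_surjective [IsAlgClosed E] (hq : 1 < q)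
    (hα : r ≠ 0 → α r ≠ 0) {T : E →ₗ[Fq] E} (hT : ∀ x, T x = (additivePoly q α r).eval x)
    {a : Fq[X]} (ha : aeval (α 0) a ≠ 0) (y : E) : ∃ x, aeval T a x = y := by
  have hdeg := natDegree_actionPoly hq hα ha
  obtain ⟨x, hx⟩ := IsAlgClosed.exists_root (actionPoly q α r a - C y) (by
    have : (actionPoly q α r a - C y).natDegree = q ^ (r * a.natDegree) := by
      rw [natDegree_sub_C, hdeg]
    intro h0
    rw [natDegree_eq_of_degree_eq_some h0] at this
    exact pow_ne_zero _ (by omega) this.symm)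
  refine ⟨x, ?_⟩
  rw [IsRoot, eval_sub, eval_C, sub_eq_zero, eval_actionPoly hT] at hx
  exact hx

/-- The functions `x ↦ (T ^ k x) ^ (q ^ l)` with `l < r` and `k < deg a` are linearly independent
on the kernel of `a`. -/
theorem eq_zero_of_forall_sum_eq_zero [IsAlgClosed E] (hq : 1 < q) (hq0 : (q : E) = 0)
    (hα : r ≠ 0 → α r ≠ 0) {T : E →ₗ[Fq] E} (hT : ∀ x, T x = (additivePoly q α r).eval x)
    {a : Fq[X]} (ha : aeval (α 0) a ≠ 0) (y : Fin r → ℕ → E)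
    (hy : ∀ x, aeval T a x = 0 →
      ∑ l, ∑ k ∈ Finset.range a.natDegree, y l k * ((T ^ k) x) ^ q ^ (l : ℕ) = 0) :
    ∀ l, ∀ k < a.natDegree, y l k = 0 := by
  rcases eq_or_ne r 0 with rfl | hr
  · exact fun l => l.elim0
  classical
  have hα' := hα hr
  set e := a.natDegree with he
  let F : Fin r × ℕ → E[X] := fun p =>
    C (y p.1 p.2) * additiveIter q α r p.2 ^ q ^ (p.1 : ℕ)
  let I : Finset (Fin r × ℕ) := Finset.univ ×ˢ Finset.range e
  have hnd : ∀ p : Fin r × ℕ,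
      (additiveIter q α r p.2 ^ q ^ (p.1 : ℕ)).natDegree = q ^ (p.1 + r * p.2) := by
    intro p
    rw [natDegree_pow, natDegree_additiveIter hq hα', pow_add]
  have hne : ∀ p : Fin r × ℕ, additiveIter q α r p.2 ^ q ^ (p.1 : ℕ) ≠ 0 := by
    intro p h0
    have := hnd p
    rw [h0, natDegree_zero] at this
    exact pow_ne_zero _ (by omega) this.symm
  have hlt : ∀ p ∈ I, (p.1 : ℕ) + r * p.2 < r * e := by
    intro p hp
    have h1 := Finset.mem_range.1 (Finset.mem_product.1 hp).2
    have h2 := p.1.2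
    have h3 : r * (p.2 + 1) ≤ r * e := Nat.mul_le_mul_left _ h1
    rw [mul_add, mul_one] at h3
    omega
  -- The polynomial has degree less than q^{re} and vanishes on the kernel, which has q^{re}
  -- elements.
  have hzero : ∑ p ∈ I, F p = 0 := by
    have : Finite {x : E // aeval T a x = 0} := Nat.finite_of_card_ne_zero (by
      rw [natCard_ker_aeval hq hq0 hα hT ha]
      exact pow_ne_zero _ (by omega))
    have hfin : {x : E | aeval T a x = 0}.Finite := this
    refine eq_zero_of_natDegree_lt_card_of_eval_eq_zero' _ hfin.toFinset (fun x hx => ?_) ?_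
    · rw [eval_finsetSum, ← hy x (by simpa using hx), Finset.sum_product]
      refine Finset.sum_congr rfl fun l _ => Finset.sum_congr rfl fun k _ => ?_
      rw [eval_mul, eval_C, eval_pow, eval_additiveIter hT]
    · have hc : hfin.toFinset.card = q ^ (r * e) := by
        rw [← Nat.card_eq_card_finite_toFinset hfin]
        exact natCard_ker_aeval hq hq0 hα hT ha
      rw [hc]
      refine lt_of_le_of_lt (natDegree_sum_le_of_forall_le (n := q ^ (r * e) - 1) _ _
        fun p hp => ?_) (Nat.sub_one_lt (pow_ne_zero _ (by omega)))
      refine (natDegree_C_mul_le _ _).trans ?_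
      rw [hnd]
      exact Nat.le_sub_one_of_lt (Nat.pow_lt_pow_right hq (hlt p hp))
  -- Nonzero summands have degrees q^{l+rk} with l < r. These are distinct, as l is the residue of
  -- the exponent modulo r, so a vanishing sum forces every summand to vanish.
  have hdeg := degree_sum_eq_of_disjoint F I (by
    intro p hp p' hp' hpp' hdd
    have h1 : y p.1 p.2 ≠ 0 := fun h => hp.2 (by simp [F, h])
    have h2 : y p'.1 p'.2 ≠ 0 := fun h => hp'.2 (by simp [F, h])
    have h3 : (F p).natDegree = (F p').natDegree := natDegree_eq_of_degree_eq hdd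
    simp only [F] at h3
    rw [natDegree_C_mul h1, natDegree_C_mul h2, hnd, hnd] at h3
    have h4 := Nat.pow_right_injective hq h3
    have h5 : (p.1 : ℕ) = p'.1 := by
      have := congrArg (· % r) h4
      simpa [Nat.add_mul_mod_self_left, Nat.mod_eq_of_lt p.1.2, Nat.mod_eq_of_lt p'.1.2] using this
    have h6 : p.2 = p'.2 := Nat.eq_of_mul_eq_mul_left (Nat.pos_of_ne_zero hr) (by omega)
    exact hpp' (Prod.ext (Fin.ext h5) h6))
  rw [hzero, degree_zero, eq_comm, Finset.sup_eq_bot_iff] at hdeg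
  intro l k hk
  have := hdeg (l, k) (Finset.mem_product.2 ⟨Finset.mem_univ _, Finset.mem_range.2 hk⟩)
  rw [degree_eq_bot] at this
  simpa [F, hne (l, k)] using this

end Additive

end Taelman

end

noncomputable section

namespace Taelman

/-! ### Duality between torsion points and the quotients `E[t] / a` -/

section Duality

variable {E : Type*} [Field E] {g : E[X]} (hg : g.Monic)

/-- The coefficient of `t ^ (deg g - 1)` on `E[t] / g`. -/
def topCoeff : AdjoinRoot g →ₗ[E] E :=
  (lcoeff E (g.natDegree - 1)).comp (AdjoinRoot.modByMonicHom hg)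

theorem topCoeff_mk (p : E[X]) :
    topCoeff hg (AdjoinRoot.mk g p) = (p %ₘ g).coeff (g.natDegree - 1) := rfl

/-- Nondegeneracy of the residue pairing: a suitable power of t moves the leading coefficient of the
reduced representative into degree deg g - 1 without any further reduction. -/
theorem eq_zero_of_topCoeff {y : AdjoinRoot g}
    (hy : ∀ k, topCoeff hg (AdjoinRoot.root g ^ k * y) = 0) : y = 0 := by
  obtain ⟨p₀, rfl⟩ := AdjoinRoot.mk_surjective y
  set p := p₀ %ₘ g with hp
  have hpp : AdjoinRoot.mk g p₀ = AdjoinRoot.mk g p :=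
    (AdjoinRoot.mk_leftInverse hg (AdjoinRoot.mk g p₀)).symm
  rw [hpp] at hy ⊢
  by_contra hne
  have hp0 : p ≠ 0 := fun h => hne (by rw [h, map_zero])
  have hlt : p.natDegree < g.natDegree :=
    natDegree_lt_natDegree hp0 (degree_modByMonic_lt _ hg)
  have h1 := hy (g.natDegree - 1 - p.natDegree)
  rw [← AdjoinRoot.mk_X, ← map_pow, ← map_mul, topCoeff_mk, (modByMonic_eq_self_iff hg).2] at h1
  · rw [coeff_X_pow_mul', if_pos (by omega),
      show g.natDegree - 1 - (g.natDegree - 1 - p.natDegree) = p.natDegree by omega] at h1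
    exact hp0 (leadingCoeff_eq_zero.1 h1)
  · refine degree_lt_degree ?_
    rw [natDegree_X_pow_mul _ hp0]
    omega

theorem ext_topCoeff {y y' : AdjoinRoot g}
    (hy : ∀ k, topCoeff hg (AdjoinRoot.root g ^ k * y) =
      topCoeff hg (AdjoinRoot.root g ^ k * y')) : y = y' := by
  refine sub_eq_zero.1 (eq_zero_of_topCoeff hg fun k => ?_)
  rw [mul_sub, map_sub, hy, sub_self]

/-- Every linear form on `E[t] / g` is of the form `x ↦ topCoeff (x * y)`. -/
theorem exists_topCoeff_eq (L : AdjoinRoot g →ₗ[E] E) :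
    ∃ y, ∀ x, topCoeff hg (x * y) = L x := by
  have : Module.Finite E (AdjoinRoot g) := hg.finite_adjoinRoot
  let D : AdjoinRoot g →ₗ[E] (AdjoinRoot g →ₗ[E] E) :=
    LinearMap.mk₂ E (fun y x => topCoeff hg (x * y)) (fun y y' x => by rw [mul_add, map_add])
      (fun c y x => by rw [mul_smul_comm, map_smul]) (fun y x x' => by rw [add_mul, map_add])
      (fun c y x => by rw [smul_mul_assoc, map_smul])
  have hinj : Function.Injective D := by
    rw [injective_iff_map_eq_zero]
    intro y hy
    exact eq_zero_of_topCoeff hg fun k => LinearMap.congr_fun hy _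
  have hsurj : Function.Surjective D :=
    (LinearMap.injective_iff_surjective_of_finrank_eq_finrank
      (Subspace.dual_finrank_eq (K := E) (V := AdjoinRoot g)).symm).1 hinj
  obtain ⟨y, hy⟩ := hsurj L
  exact ⟨y, fun x => LinearMap.congr_fun hy x⟩

theorem topCoeff_map (ψ : E →+* E) (hψ : g.map ψ = g) (y : AdjoinRoot g) :
    topCoeff hg (AdjoinRoot.map ψ g g (dvd_of_eq hψ.symm) y) = ψ (topCoeff hg y) := by
  obtain ⟨p, rfl⟩ := AdjoinRoot.mk_surjective y
  have : AdjoinRoot.map ψ g g (dvd_of_eq hψ.symm) (AdjoinRoot.mk g p) =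
      AdjoinRoot.mk g (p.map ψ) := by
    rw [AdjoinRoot.map, AdjoinRoot.lift_mk, ← eval₂_map, ← AdjoinRoot.aeval_eq]
    rfl
  rw [this, topCoeff_mk, topCoeff_mk]
  conv_lhs => rw [← hψ, ← map_modByMonic ψ hg, hψ]
  rw [coeff_map]

/-- E[t]/g is finite-dimensional over `E`, so injectivity gives surjectivity, and preimages of the
unit vectors form a left inverse. -/
theorem isUnit_of_vecMul_injective {ι : Type*} [Fintype ι] [DecidableEq ι]
    {W : Matrix ι ι (AdjoinRoot g)} (hg : g.Monic)
    (hW : ∀ y : ι → AdjoinRoot g, Matrix.vecMul y W = 0 → y = 0) : IsUnit W := by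
  have : Module.Finite E (AdjoinRoot g) := hg.finite_adjoinRoot
  let F : (ι → AdjoinRoot g) →ₗ[E] (ι → AdjoinRoot g) := W.vecMulLinear.restrictScalars E
  have hinj : Function.Injective F := by
    rw [injective_iff_map_eq_zero]
    exact fun y hy => hW y hy
  have hsurj := LinearMap.injective_iff_surjective.1 hinj
  choose U hU using fun i => hsurj (Pi.single i 1)
  have h1 : Matrix.of U * W = 1 := by
    refine Matrix.ext fun i j => ?_
    have := congrFun (hU i) j
    rw [Matrix.one_eq_pi_single]
    exact this
  exact IsUnit.of_mul_eq_one_right _ h1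

end Duality

/-! ### Frobenius on torsion points is conjugate to the monodromy. -/

section ScalarQuotient

variable {Fq E : Type*} [Field Fq] [Field E] [Algebra Fq E] {a : Fq[X]}

/-- The quotient `E[t] / a`. -/
abbrev ScalarQuotient (E : Type*) [Field E] [Algebra Fq E] (a : Fq[X]) : Type _ :=
  AdjoinRoot (a.map (algebraMap Fq E))

theorem map_frobenius_map_algebraMap [Fintype Fq] (E : Type*) [Field E] [Algebra Fq E] (a : Fq[X]) :
    (a.map (algebraMap Fq E)).map (FiniteField.frobeniusAlgHom Fq E).toRingHom =
      a.map (algebraMap Fq E) := by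
  rw [Polynomial.map_map]
  congr 1
  exact RingHom.ext fun x => AlgHom.commutes (FiniteField.frobeniusAlgHom Fq E) x

/-- The action of the `q`-Frobenius of `E` on `E[t] / a`, through the coefficients. -/
def coeffFrobenius [Fintype Fq] (E : Type*) [Field E] [Algebra Fq E] (a : Fq[X]) :
    ScalarQuotient E a →+* ScalarQuotient E a :=
  AdjoinRoot.map (FiniteField.frobeniusAlgHom Fq E).toRingHom _ _
    (dvd_of_eq (map_frobenius_map_algebraMap E a).symm)

theorem topCoeff_coeffFrobenius [Fintype Fq] (ha : a.Monic) (y : ScalarQuotient E a) :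
    topCoeff (ha.map _) (coeffFrobenius E a y) = topCoeff (ha.map _) y ^ Fintype.card Fq :=
  topCoeff_map (ha.map _) (FiniteField.frobeniusAlgHom Fq E).toRingHom
    (map_frobenius_map_algebraMap E a) y

theorem topCoeff_iterate_coeffFrobenius [Fintype Fq] (ha : a.Monic) (n : ℕ) (y : ScalarQuotient E a) :
    topCoeff (ha.map _) ((coeffFrobenius E a)^[n] y) =
      topCoeff (ha.map _) y ^ Fintype.card Fq ^ n := by
  induction n with
  | zero => simp
  | succ n ih =>
    rw [Function.iterate_succ_apply', topCoeff_coeffFrobenius ha, ih, ← pow_mul, ← pow_succ]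

theorem coeffFrobenius_root [Fintype Fq] : coeffFrobenius E a (AdjoinRoot.root _) = AdjoinRoot.root _ :=
  AdjoinRoot.map_root _ _ _ _

theorem coeffFrobenius_of [Fintype Fq] (c : E) : coeffFrobenius E a (AdjoinRoot.of _ c) =
    AdjoinRoot.of _ (c ^ Fintype.card Fq) :=
  AdjoinRoot.map_of _ _ _ _ _

variable (E a) in
/-- The canonical map from `Fq[t]` to `E[t] / a`. -/
def toScalarQuotient : Fq[X] →+* ScalarQuotient E a :=
  (AdjoinRoot.mk _).comp (mapRingHom (algebraMap Fq E))

theorem toScalarQuotient_apply (c : Fq[X]) : toScalarQuotient E a c =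
    AdjoinRoot.mk _ (c.map (algebraMap Fq E)) := rfl

theorem coeffFrobenius_toScalarQuotient [Fintype Fq] (c : Fq[X]) :
    coeffFrobenius E a (toScalarQuotient E a c) = toScalarQuotient E a c := by
  have : (coeffFrobenius E a).comp (toScalarQuotient E a) = toScalarQuotient E a := by
    refine Polynomial.ringHom_ext (fun x => ?_) ?_
    · rw [RingHom.comp_apply, toScalarQuotient_apply, map_C, AdjoinRoot.mk_C, coeffFrobenius_of,
        ← map_pow, FiniteField.pow_card]
    · rw [RingHom.comp_apply, toScalarQuotient_apply, map_X, AdjoinRoot.mk_X, coeffFrobenius_root]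
  exact RingHom.congr_fun this c

/-- The element of `E[t] / a` with `topCoeff (t ^ k ω) = T ^ k v` for all `k`, for a torsion
point `v`. -/
theorem exists_dualElement (ha : a.Monic) (T : E →ₗ[Fq] E) (v : E) (hv : aeval T a v = 0) :
    ∃ ω : ScalarQuotient E a, ∀ k, topCoeff (ha.map _) (AdjoinRoot.root _ ^ k * ω) = (T ^ k) v := by
  -- The form c t^k ↦ c T^k v kills the multiples of a because a(T) v = 0. It descends to E[t]/a,
  -- and the residue pairing represents it by ω.
  let L₀ : E[X] →ₗ[E] E :=
    Polynomial.lsum fun k => LinearMap.toSpanSingleton E E ((T ^ k) v)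
  have hL₀ : ∀ k (c : E), L₀ (C c * X ^ k) = c * (T ^ k) v := by
    intro k c
    simp only [L₀, C_mul_X_pow_eq_monomial, Polynomial.lsum_apply]
    rw [sum_monomial_index _ _ (by simp), LinearMap.toSpanSingleton_apply, smul_eq_mul]
  have hL₀' : ∀ k (b : Fq[X]), L₀ (X ^ k * b.map (algebraMap Fq E)) = (T ^ k) (aeval T b v) := by
    intro k b
    induction b using Polynomial.induction_on' with
    | add p p' hp hp' =>
      rw [Polynomial.map_add, mul_add, map_add, hp, hp', map_add, LinearMap.add_apply, map_add]
    | monomial n c =>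
      rw [map_monomial, ← C_mul_X_pow_eq_monomial, mul_left_comm, ← pow_add, hL₀, aeval_monomial,
        Module.End.mul_apply, Module.algebraMap_end_apply, map_smul, pow_add, Module.End.mul_apply,
        Algebra.smul_def]
  have hker : (Ideal.span {a.map (algebraMap Fq E)}).restrictScalars E ≤ LinearMap.ker L₀ := by
    intro p hp
    obtain ⟨b, rfl⟩ := Ideal.mem_span_singleton.1 hp
    rw [LinearMap.mem_ker]
    clear hp
    induction b using Polynomial.induction_on' with
    | add p p' hp hp' => rw [mul_add, map_add, hp, hp', add_zero]
    | monomial n c =>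
      rw [← C_mul_X_pow_eq_monomial, mul_comm, mul_assoc, ← smul_eq_C_mul, map_smul, hL₀', hv,
        map_zero, smul_zero]
  let L : ScalarQuotient E a →ₗ[E] E :=
    (Submodule.liftQ _ L₀ hker).comp
      (Submodule.Quotient.restrictScalarsEquiv E
        (Ideal.span {a.map (algebraMap Fq E)})).symm.toLinearMap
  have hL : ∀ p, L (AdjoinRoot.mk _ p) = L₀ p := fun p => rfl
  obtain ⟨ω, hω⟩ := exists_topCoeff_eq (ha.map (algebraMap Fq E)) L
  refine ⟨ω, fun k => ?_⟩
  rw [hω, ← AdjoinRoot.mk_X, ← map_pow, hL]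
  simpa using hL₀ k 1

/-- The passage from torsion points to dual elements is linear over Fq[t]: c ω is dual to c(T) v. -/
theorem topCoeff_toScalarQuotient_mul (ha : a.Monic) {T : E →ₗ[Fq] E} {v : E} {ω : ScalarQuotient E a}
    (hω : ∀ k, topCoeff (ha.map _) (AdjoinRoot.root _ ^ k * ω) = (T ^ k) v) (c : Fq[X]) (k : ℕ) :
    topCoeff (ha.map _) (AdjoinRoot.root _ ^ k * (toScalarQuotient E a c * ω)) =
      (T ^ k) (aeval T c v) := by
  induction c using Polynomial.induction_on' with
  | add p p' hp hp' =>
    rw [map_add, add_mul, mul_add, map_add, hp, hp', map_add, LinearMap.add_apply, map_add]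
  | monomial n c =>
    have : AdjoinRoot.root _ ^ k * (toScalarQuotient E a (monomial n c) * ω) =
        algebraMap Fq E c • (AdjoinRoot.root _ ^ (k + n) * ω) := by
      rw [toScalarQuotient_apply, map_monomial, ← C_mul_X_pow_eq_monomial, map_mul, map_pow,
        AdjoinRoot.mk_X, AdjoinRoot.mk_C, Algebra.smul_def, AdjoinRoot.algebraMap_eq, pow_add]
      ring
    rw [this, map_smul, hω, aeval_monomial, Module.End.mul_apply, Module.algebraMap_end_apply,
      map_smul, pow_add, Module.End.mul_apply, smul_eq_mul, Algebra.smul_def]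

/-- The characteristic polynomial of the Frobenius on a free torsion module is that of the
monodromy. -/
theorem charpoly_frobenius_torsion [Fintype Fq] (ha : a.Monic) [IsAlgClosed E] {α : ℕ → E} {r d : ℕ}
    (hα : r ≠ 0 → α r ≠ 0) (hd : ∀ j, α j ^ Fintype.card Fq ^ d = α j) {T : E →ₗ[Fq] E}
    (hT : ∀ x, T x = (additivePoly (Fintype.card Fq) α r).eval x) (ha0 : aeval (α 0) a ≠ 0)
    (v : Fin r → E) (hv : ∀ j, aeval T a (v j) = 0)
    (hgen : ∀ x, aeval T a x = 0 → ∃ c : Fin r → Fq[X], x = ∑ j, aeval T (c j) (v j))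
    (N : Matrix (Fin r) (Fin r) Fq[X])
    (hN : ∀ j, v j ^ Fintype.card Fq ^ d = ∑ i, aeval T (N i j) (v i)) :
    (N.map (toScalarQuotient E a)).charpoly =
      ((polyMonodromy (fun i j => α j ^ Fintype.card Fq ^ i) r d).map
        (AdjoinRoot.mk (a.map (algebraMap Fq E)))).charpoly := by
  rcases eq_or_ne r 0 with hr | hr
  · subst hr
    congr 1
    exact Subsingleton.elim _ _
  set q := Fintype.card Fq with hqdef
  have hq : 1 < q := Fintype.one_lt_card
  have hq0 : (q : E) = 0 := by
    have h1 : ((q : Fq) : Fq) = 0 := FiniteField.cast_card_eq_zero Fq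
    rw [← map_natCast (algebraMap Fq E), h1, map_zero]
  let S := ScalarQuotient E a
  let lam : S →ₗ[E] E := topCoeff (ha.map (algebraMap Fq E))
  let θ : S := AdjoinRoot.root (a.map (algebraMap Fq E))
  let σ : S →+* S := coeffFrobenius E a
  choose ω hω using fun j => exists_dualElement ha T (v j) (hv j)
  -- An analogue of the Moore matrix; it will intertwine monodromy and Frobenius.
  let W : Matrix (Fin r) (Fin r) S := Matrix.of fun l j => σ^[l] (ω j)
  have hσθ : ∀ n, σ^[n] θ = θ := fun n => by
    induction n with
    | zero => rfl
    | succ n ih => rw [Function.iterate_succ_apply', ih]; exact coeffFrobenius_root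
  have hlamσ : ∀ n k y, lam (θ ^ k * σ^[n] y) = lam (θ ^ k * y) ^ q ^ n := fun n k y => by
    rw [← topCoeff_iterate_coeffFrobenius ha]
    congr 1
    change _ = σ^[n] (θ ^ k * y)
    rw [iterate_map_mul, iterate_map_pow, hσθ]
  have hσc : ∀ n c, σ^[n] (toScalarQuotient E a c) = toScalarQuotient E a c := fun n c => by
    induction n with
    | zero => rfl
    | succ n ih => rw [Function.iterate_succ_apply', ih]; exact coeffFrobenius_toScalarQuotient c
  have hσof : ∀ n c, σ^[n] (AdjoinRoot.of _ c) = AdjoinRoot.of _ (c ^ q ^ n) := fun n c => by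
    induction n with
    | zero => simp
    | succ n ih =>
      rw [Function.iterate_succ_apply', ih, pow_succ, pow_mul]; exact coeffFrobenius_of _
  have hlamof : ∀ (c : E) (y : S), lam (AdjoinRoot.of _ c * y) = c * lam y := fun c y => by
    rw [← AdjoinRoot.algebraMap_eq, ← Algebra.smul_def, map_smul, smul_eq_mul]
  have hTx : ∀ x, T x = ∑ j ∈ Finset.range (r + 1), α j * x ^ q ^ j := fun x => by
    rw [hT, additivePoly, eval_finsetSum]
    simp
  -- The formula T x = ∑ α_i x^{q^i} becomes a σ-linear equation for ω, since applying σ raises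
  -- `topCoeff` to the power q. Its σ^i-twists say that the sequence σ^i ω solves the difference
  -- equation.
  have hrel₀ : ∀ j, θ * ω j = ∑ i ∈ Finset.range (r + 1), AdjoinRoot.of _ (α i) * σ^[i] (ω j) := by
    intro j
    refine ext_topCoeff (ha.map (algebraMap Fq E)) fun k => ?_
    change lam (θ ^ k * (θ * ω j)) = lam (θ ^ k * _)
    rw [← mul_assoc, ← pow_succ, Finset.mul_sum, map_sum]
    have h1 : lam (θ ^ (k + 1) * ω j) = T ((T ^ k) (v j)) := by
      rw [← Module.End.mul_apply, ← pow_succ']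
      exact hω j (k + 1)
    rw [h1, hTx]
    refine Finset.sum_congr rfl fun i _ => ?_
    rw [mul_left_comm, hlamof, hlamσ, ← hω j k]
  let aS : ℕ → ℕ → S := fun i j => AdjoinRoot.mk (a.map (algebraMap Fq E)) (C (α j ^ q ^ i))
  have hrec : ∀ j, IsRecSolution θ aS r (fun i => σ^[i] (ω j)) := by
    intro j i
    have h1 := congrArg (σ^[i]) (hrel₀ j)
    rw [iterate_map_mul, hσθ] at h1
    rw [smul_eq_mul, h1]
    have h2 : ∀ (s : Finset ℕ) (F : ℕ → S), σ^[i] (∑ k ∈ s, F k) = ∑ k ∈ s, σ^[i] (F k) := by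
      intro s F
      rw [← RingHom.coe_pow, map_sum]
    rw [h2]
    refine Finset.sum_congr rfl fun k _ => ?_
    rw [iterate_map_mul, hσof, ← Function.iterate_add_apply]
    rfl
  have hunit : ∀ i, IsUnit (C (α r ^ q ^ i) : E[X]) := fun i =>
    isUnit_C.2 (pow_ne_zero _ (hα hr)).isUnit
  set B := (polyMonodromy (fun i j => α j ^ q ^ i) r d).map
    (AdjoinRoot.mk (a.map (algebraMap Fq E))) with hB
  have hBmon : B = monodromy θ aS r d := by
    refine Matrix.ext fun l m => ?_
    rw [hB, Matrix.map_apply]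
    exact (recSeq_map (t := (X : E[X])) (a := fun i j => C (α j ^ q ^ i))
      (AdjoinRoot.mk (a.map (algebraMap Fq E))) hunit _ _).symm
  -- Both sides have entries σ^{d+l} ω_j: on the left by the recursion, on the right because σ^d ω_j
  -- is dual to the Frobenius image of v_j.
  have hBW : B * W = W * N.map (toScalarQuotient E a) := by
    refine Matrix.ext fun l j => ?_
    have h1 := (hrec j).eq_sum (fun i => (hunit i).map _) (d + l) hr
    have h2 : (B * W) l j = σ^[d + l] (ω j) := by
      rw [h1, hBmon, Matrix.mul_apply]
      rfl
    have h3 : σ^[d] (ω j) = ∑ i, toScalarQuotient E a (N i j) * ω i := by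
      refine ext_topCoeff (ha.map (algebraMap Fq E)) fun k => ?_
      change lam (θ ^ k * _) = lam (θ ^ k * _)
      rw [hlamσ, Finset.mul_sum, map_sum]
      have h4 : ∀ i, lam (θ ^ k * (toScalarQuotient E a (N i j) * ω i)) =
          (T ^ k) (aeval T (N i j) (v i)) := fun i =>
        topCoeff_toScalarQuotient_mul ha (hω i) _ _
      simp only [h4]
      rw [← map_sum, ← hN j]
      have h5 : lam (θ ^ k * ω j) = (T ^ k) (v j) := hω j k
      rw [h5]
      -- The q^d-power map fixes the coefficients α_j, hence commutes with `T`.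
      have h6 : ∀ x, (T x) ^ q ^ d = T (x ^ q ^ d) := by
        intro x
        have hF : ∀ x : E, x ^ q ^ d = (FiniteField.frobeniusAlgHom Fq E ^ d) x := by
          intro x
          rw [AlgHom.coe_pow, FiniteField.coe_frobeniusAlgHom, pow_iterate]
        rw [hTx, hTx, hF, map_sum]
        refine Finset.sum_congr rfl fun i _ => ?_
        rw [map_mul, ← hF, ← hF, hd, ← pow_mul, ← pow_mul, mul_comm (q ^ i)]
      have h7 : ∀ k x, ((T ^ k) x) ^ q ^ d = (T ^ k) (x ^ q ^ d) := by
        intro k x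
        induction k with
        | zero => simp
        | succ k ih => rw [pow_succ', Module.End.mul_apply, h6, ih, Module.End.mul_apply]
      exact h7 k (v j)
    rw [h2, add_comm d, Function.iterate_add_apply, h3, ← RingHom.coe_pow, map_sum,
      Matrix.mul_apply]
    refine Finset.sum_congr rfl fun i _ => ?_
    rw [map_mul, RingHom.coe_pow, hσc, mul_comm]
    rfl
  -- A row vector killed by `W` gives, through its coordinates `Y` in powers of t, a relation
  -- between the functions (T^k x)^{q^l} on the torsion, and these are linearly independent.
  have hWunit : IsUnit W := by
    refine isUnit_of_vecMul_injective (ha.map _) fun y hy => ?_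
    have hmonic := ha.map (algebraMap Fq E)
    let Y : Fin r → ℕ → E := fun l k => (AdjoinRoot.modByMonicHom hmonic (y l)).coeff k
    have hnd : (a.map (algebraMap Fq E)).natDegree = a.natDegree := ha.natDegree_map _
    have hYlt : ∀ l k, a.natDegree ≤ k → Y l k = 0 := by
      intro l k hk
      obtain ⟨p, hp⟩ := AdjoinRoot.mk_surjective (y l)
      simp only [Y, ← hp, AdjoinRoot.modByMonicHom_mk]
      refine coeff_eq_zero_of_degree_lt ((degree_modByMonic_lt _ hmonic).trans_le ?_)
      rw [degree_eq_natDegree hmonic.ne_zero, hnd]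
      exact_mod_cast hk
    have hyY : ∀ l, y l = ∑ k ∈ Finset.range a.natDegree, AdjoinRoot.of _ (Y l k) * θ ^ k := by
      intro l
      have h1 := AdjoinRoot.mk_leftInverse hmonic (y l)
      conv_lhs => rw [← h1]
      have h2 : (AdjoinRoot.modByMonicHom hmonic (y l)) =
          ∑ k ∈ Finset.range a.natDegree, C (Y l k) * X ^ k := by
        ext k
        rw [finsetSum_coeff]
        simp only [coeff_C_mul, coeff_X_pow, mul_ite, mul_one, mul_zero, Finset.sum_ite_eq,
          Finset.mem_range]
        split_ifs with h
        · rfl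
        · exact hYlt l k (not_lt.1 h)
      conv_lhs => rw [h2]
      rw [map_sum]
      refine Finset.sum_congr rfl fun k _ => ?_
      rw [map_mul, map_pow, AdjoinRoot.mk_X, AdjoinRoot.mk_C]
    have hY := eq_zero_of_forall_sum_eq_zero hq hq0 hα hT ha0 Y (by
      intro x hx
      obtain ⟨c, hc⟩ := hgen x hx
      let ωx : S := ∑ j, toScalarQuotient E a (c j) * ω j
      have hωx : ∀ k, lam (θ ^ k * ωx) = (T ^ k) x := by
        intro k
        have h4 : ∀ j, lam (θ ^ k * (toScalarQuotient E a (c j) * ω j)) =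
            (T ^ k) (aeval T (c j) (v j)) := fun j =>
          topCoeff_toScalarQuotient_mul ha (hω j) _ _
        simp only [ωx]
        rw [Finset.mul_sum, map_sum, hc, map_sum]
        exact Finset.sum_congr rfl fun j _ => h4 j
      have h1 : ∑ l, y l * σ^[l] ωx = 0 := by
        have h2 : ∀ l : Fin r, y l * σ^[l] ωx =
            ∑ j, toScalarQuotient E a (c j) * (y l * W l j) := by
          intro l
          simp only [ωx]
          rw [← RingHom.coe_pow, map_sum, Finset.mul_sum]
          refine Finset.sum_congr rfl fun j _ => ?_
          rw [map_mul, RingHom.coe_pow, hσc, mul_left_comm]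
          rfl
        simp only [h2]
        rw [Finset.sum_comm]
        refine Finset.sum_eq_zero fun j _ => ?_
        rw [← Finset.mul_sum]
        have h3 : ∑ l, y l * W l j = 0 := congrFun hy j
        rw [h3, mul_zero]
      have h2 := congrArg lam h1
      rw [map_zero, map_sum] at h2
      rw [← h2]
      refine Finset.sum_congr rfl fun l _ => ?_
      rw [hyY l, Finset.sum_mul, map_sum]
      refine Finset.sum_congr rfl fun k _ => ?_
      rw [mul_assoc, hlamof, hlamσ, hωx])
    funext l
    rw [hyY l, Pi.zero_apply]
    refine Finset.sum_eq_zero fun k hk => ?_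
    rw [hY l k (Finset.mem_range.1 hk), map_zero, zero_mul]
  obtain ⟨U, hU⟩ := hWunit
  have h1 := Matrix.charpoly_units_conj U (N.map (toScalarQuotient E a))
  rw [hU, ← hBW, ← hU, mul_assoc,
    Matrix.mul_nonsing_inv _ ((Matrix.isUnit_iff_isUnit_det _).1 U.isUnit), mul_one] at h1
  exact h1.symm

end ScalarQuotient

end Taelman

end

/-! ### From torsion levels to Tate modules: the Frobenius polynomial as monodromy polynomial. -/

noncomputable section

namespace Taelman

/-- V[h] is a vector space over the finite field Fq[t]/h, and its cardinality forces dimension `r`.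
-/
theorem exists_torsion_basis {Fq : Type*} [Field Fq] [Fintype Fq] {h : Fq[X]} (hh : Irreducible h)
    {V : Type*} [AddCommGroup V] [Module Fq[X] V] {r : ℕ}
    (hcard : Nat.card {v : V // h • v = 0} = Fintype.card Fq ^ (r * h.natDegree)) :
    ∃ v : Fin r → V, (∀ j, h • v j = 0) ∧
      (∀ w : V, h • w = 0 → ∃ c : Fin r → Fq[X], w = ∑ i, c i • v i) ∧
      (∀ c : Fin r → Fq[X], ∑ i, c i • v i = 0 → ∀ i, h ∣ c i) := by
  let K := Fq[X] ⧸ Ideal.span {h}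
  let M := Submodule.torsionBy Fq[X] V h
  have hmax : (Ideal.span {h}).IsMaximal := PrincipalIdealRing.isMaximal_of_irreducible hh
  let _ : Field K := Ideal.Quotient.field _
  have hmem : ∀ v, v ∈ M ↔ h • v = 0 := fun v => Submodule.mem_torsionBy_iff _ _
  have hM : Nat.card M = Fintype.card Fq ^ (r * h.natDegree) := by
    rw [← hcard]
    exact Nat.card_congr (Equiv.subtypeEquivRight hmem)
  have hq : Fintype.card Fq ≠ 0 := Fintype.card_ne_zero
  have hfinM : Finite M := Nat.finite_of_card_ne_zero (by rw [hM]; exact pow_ne_zero _ hq)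
  have hfinK : Module.Finite K M := Module.Finite.of_finite
  have hK : Nat.card K = Fintype.card Fq ^ h.natDegree := by
    have : Module.Finite Fq K := (AdjoinRoot.powerBasis hh.ne_zero).finite
    rw [Module.natCard_eq_pow_finrank (K := Fq) (V := K), Nat.card_eq_fintype_card,
      finrank_quotient_span_eq_natDegree]
  have hrank : Module.finrank K M = r := by
    have h1 := Module.natCard_eq_pow_finrank (K := K) (V := M)
    rw [hM, hK, ← pow_mul] at h1
    have h2 := Nat.pow_right_injective (Fintype.one_lt_card (α := Fq)) h1
    have h3 : 0 < h.natDegree := Irreducible.natDegree_pos hh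
    rw [mul_comm] at h2
    exact (Nat.eq_of_mul_eq_mul_left h3 h2).symm
  let b : Module.Basis (Fin r) K M := Module.finBasisOfFinrankEq K M hrank
  have hsmul : ∀ (c : Fq[X]) (m : M), (Ideal.Quotient.mk (Ideal.span {h}) c : K) • m = c • m :=
    fun c m => rfl
  refine ⟨fun j => (b j : V), fun j => (hmem _).1 (b j).2, fun w hw => ?_, fun c hc i => ?_⟩
  · choose c hc using fun i => Ideal.Quotient.mk_surjective (b.repr ⟨w, (hmem w).2 hw⟩ i)
    refine ⟨c, ?_⟩
    have h1 := congrArg Subtype.val (b.sum_repr ⟨w, (hmem w).2 hw⟩)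
    simp only [← hc, hsmul] at h1
    rw [← h1]
    simp
  · have h1 : ∑ i, (Ideal.Quotient.mk (Ideal.span {h}) (c i) : K) • b i = 0 := by
      refine Subtype.ext ?_
      simp only [hsmul]
      simpa using hc
    have h2 := Fintype.linearIndependent_iff.1 b.linearIndependent _ h1 i
    rwa [Ideal.Quotient.eq_zero_iff_mem, Ideal.mem_span_singleton] at h2

variable {Fq : Type*} [Field Fq]

theorem toScalarQuotient_eq_zero_iff (E : Type*) [Field E] [Algebra Fq E] (a c : Fq[X]) :
    toScalarQuotient E a c = 0 ↔ a ∣ c := by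
  rw [toScalarQuotient_apply, AdjoinRoot.mk_eq_zero]
  exact Polynomial.map_dvd_map' _

/-- The `h`-adic completion of `Fq[t]` maps to `E[t] / h ^ m`. -/
def completionToScalarQuotient (E : Type*) [Field E] [Algebra Fq E] (h : Fq[X]) (m : ℕ) :
    AdicCompletion (Ideal.span {h}) Fq[X] →+* ScalarQuotient E (h ^ m) :=
  (Ideal.Quotient.lift (Ideal.span {h} ^ m) (toScalarQuotient E (h ^ m)) (fun c hc => by
    rw [Ideal.span_singleton_pow, Ideal.mem_span_singleton] at hc
    exact (toScalarQuotient_eq_zero_iff E _ c).2 hc)).comp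
    (AdicCompletion.evalₐ (Ideal.span {h}) m).toRingHom

theorem completionToScalarQuotient_eq (E : Type*) [Field E] [Algebra Fq E] (h : Fq[X]) (m : ℕ)
    (x : AdicCompletion (Ideal.span {h}) Fq[X]) (c : Fq[X])
    (hc : AdicCompletion.evalₐ (Ideal.span {h}) m x = Ideal.Quotient.mk _ c) :
    completionToScalarQuotient E h m x = toScalarQuotient E (h ^ m) c := by
  rw [completionToScalarQuotient, RingHom.comp_apply]
  change Ideal.Quotient.lift _ _ _ (AdicCompletion.evalₐ (Ideal.span {h}) m x) = _
  rw [hc, Ideal.Quotient.lift_mk]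

theorem completion_ext (E : Type*) [Field E] [Algebra Fq E] {h : Fq[X]}
    {x y : AdicCompletion (Ideal.span {h}) Fq[X]}
    (hxy : ∀ m, completionToScalarQuotient E h m x = completionToScalarQuotient E h m y) :
    x = y := by
  refine AdicCompletion.ext_evalₐ fun m => ?_
  obtain ⟨c, hc⟩ := Ideal.Quotient.mk_surjective (AdicCompletion.evalₐ (Ideal.span {h}) m x)
  obtain ⟨c', hc'⟩ := Ideal.Quotient.mk_surjective (AdicCompletion.evalₐ (Ideal.span {h}) m y)
  have h1 := hxy m
  rw [completionToScalarQuotient_eq E h m x c hc.symm,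
    completionToScalarQuotient_eq E h m y c' hc'.symm, ← sub_eq_zero, ← map_sub,
    toScalarQuotient_eq_zero_iff] at h1
  rw [← hc, ← hc', Ideal.Quotient.eq, Ideal.span_singleton_pow, Ideal.mem_span_singleton]
  exact h1

theorem completionToScalarQuotient_algebraMap (E : Type*) [Field E] [Algebra Fq E] (h : Fq[X])
    (m : ℕ) (c : Fq[X]) : completionToScalarQuotient E h m (algebraMap _ _ c) =
      toScalarQuotient E (h ^ m) c :=
  completionToScalarQuotient_eq E h m _ c (AlgHom.commutes _ _)

theorem algebraMap_completion_injective {h : Fq[X]} (hh : Irreducible h) :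
    Function.Injective (algebraMap Fq[X] (AdicCompletion (Ideal.span {h}) Fq[X])) := by
  rw [injective_iff_map_eq_zero]
  intro c hc
  by_contra h0
  have h1 : h ^ (c.natDegree + 1) ∣ c := by
    rw [← toScalarQuotient_eq_zero_iff Fq, ← completionToScalarQuotient_algebraMap, hc, map_zero]
  have h2 := natDegree_le_of_dvd h1 h0
  rw [natDegree_pow] at h2
  have h3 : 0 < h.natDegree := Irreducible.natDegree_pos hh
  nlinarith

/-- Once deg h^m exceeds deg p, the polynomial p is its own remainder modulo h^m, so it equals the
remainder of c, which has coefficients in `Fq`. -/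
theorem exists_map_eq_of_forall_mk_eq {E : Type*} [Field E] [Algebra Fq E] {h : Fq[X]}
    (hmonic : h.Monic) (hirr : Irreducible h) (p : E[X])
    (hp : ∀ m, ∃ c, toScalarQuotient E (h ^ m) c = AdjoinRoot.mk _ p) :
    ∃ c : Fq[X], c.map (algebraMap Fq E) = p := by
  obtain ⟨c, h1⟩ := hp (p.natDegree + 1)
  set m := p.natDegree + 1 with hm
  rw [toScalarQuotient_apply, AdjoinRoot.mk_eq_mk] at h1
  have hmon : ((h ^ m).map (algebraMap Fq E)).Monic := (hmonic.pow m).map _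
  have hlt : p.degree < ((h ^ m).map (algebraMap Fq E)).degree := by
    refine degree_lt_degree ?_
    rw [(hmonic.pow m).natDegree_map, natDegree_pow]
    have h3 : 0 < h.natDegree := Irreducible.natDegree_pos hirr
    nlinarith
  refine ⟨c %ₘ (h ^ m), ?_⟩
  rw [map_modByMonic _ (hmonic.pow m)]
  refine Eq.trans ?_ ((modByMonic_eq_self_iff hmon).2 hlt)
  rw [← sub_eq_zero, ← sub_modByMonic]
  exact (modByMonic_eq_zero_iff_dvd hmon).2 h1

theorem aeval_thetaBar_eq_zero_iff (f : MonicPrime Fq) (p : Fq[X]) :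
    aeval (thetaBar f) p = 0 ↔ f.1 ∣ p := by
  rw [thetaBar, aeval_algebraMap_apply, AdjoinRoot.aeval_eq,
    map_eq_zero_iff _ (algebraMap (AdjoinRoot f.1) (ResidueClosure f)).injective,
    AdjoinRoot.mk_eq_zero]

theorem not_dvd_of_ne {f h : MonicPrime Fq} (hne : h ≠ f) : ¬ f.1 ∣ h.1 := by
  intro hd
  have h1 : Associated f.1 h.1 := f.2.2.associated_of_dvd h.2.2 hd
  exact hne (Subtype.ext (eq_of_monic_of_associated f.2.1 h.2.1 h1).symm)

/-- Without some h ≠ f the condition defining `frobeniusCharpoly` would be vacuous. -/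
theorem exists_monicPrime_ne (f : MonicPrime Fq) : ∃ h : MonicPrime Fq, h ≠ f := by
  by_cases hf : f.1 = X
  · refine ⟨⟨X - C 1, monic_X_sub_C 1, irreducible_X_sub_C 1⟩, fun h => ?_⟩
    have h1 : (X - C 1 : Fq[X]) = X := (congrArg Subtype.val h).trans hf
    have h2 := congrArg (eval 0) h1
    simp at h2
  · exact ⟨⟨X, monic_X, irreducible_X⟩, fun h => hf (congrArg Subtype.val h).symm⟩

namespace DrinfeldModule

variable {r : ℕ} (φ : DrinfeldModule Fq r) (f : MonicPrime Fq)

/-- The coefficients of the reduction of `φ_θ` at `f`. -/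
def redCoeff (j : ℕ) : ResidueClosure f :=
  if hj : j < r + 1 then aeval (thetaBar f) (φ.coeff ⟨j, hj⟩) else 0

theorem redCoeff_zero : φ.redCoeff f 0 = thetaBar f := by
  rw [redCoeff, dif_pos (Nat.succ_pos r)]
  have : φ.coeff ⟨0, Nat.succ_pos r⟩ = X := φ.coeff_zero
  rw [this, aeval_X]

theorem bddAbove_reductionRank :
    BddAbove {i : ℕ | ∃ hi : i < r + 1, ¬ f.1 ∣ φ.coeff ⟨i, hi⟩} :=
  ⟨r, fun _ hi => Nat.lt_succ_iff.1 hi.1⟩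

theorem redCoeff_eq_zero {j : ℕ} (hj : φ.reductionRank f < j) : φ.redCoeff f j = 0 := by
  rw [redCoeff]
  split_ifs with h
  · rw [aeval_thetaBar_eq_zero_iff]
    by_contra hd
    exact absurd (le_csSup (φ.bddAbove_reductionRank f) ⟨h, hd⟩) (not_le.2 hj)
  · rfl

theorem redCoeff_reductionRank_ne_zero (h0 : φ.reductionRank f ≠ 0) :
    φ.redCoeff f (φ.reductionRank f) ≠ 0 := by
  have hne : {i : ℕ | ∃ hi : i < r + 1, ¬ f.1 ∣ φ.coeff ⟨i, hi⟩}.Nonempty := by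
    by_contra he
    rw [Set.not_nonempty_iff_eq_empty] at he
    exact h0 (by rw [reductionRank, he, csSup_empty]; rfl)
  obtain ⟨hi, hd⟩ : ∃ hi : φ.reductionRank f < r + 1, ¬ f.1 ∣ φ.coeff ⟨φ.reductionRank f, hi⟩ :=
    Nat.sSup_mem hne (φ.bddAbove_reductionRank f)
  rw [redCoeff, dif_pos hi, Ne, aeval_thetaBar_eq_zero_iff]
  exact hd

theorem reductionRank_le : φ.reductionRank f ≤ r := by
  by_contra h
  have h1 := φ.redCoeff_reductionRank_ne_zero f (by omega)
  rw [redCoeff, dif_neg (by omega)] at h1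
  exact h1 rfl

end DrinfeldModule

variable [Fintype Fq]

/-- A basis of the h-torsion is lifted to the Tate module. Modulo h^m its components generate the
h^m-torsion, so `charpoly_frobenius_torsion` applies with a = h^m at every level. -/
theorem exists_tate_basis_of_additive {E : Type*} [Field E] [Algebra Fq E] [IsAlgClosed E]
    {α : ℕ → E} {r d : ℕ} (hα : r ≠ 0 → α r ≠ 0) (hd : ∀ j, α j ^ Fintype.card Fq ^ d = α j)
    {T : E →ₗ[Fq] E} (hT : ∀ x, T x = (additivePoly (Fintype.card Fq) α r).eval x) {h : Fq[X]}
    (hmonic : h.Monic) (hirr : Irreducible h) (hh1 : aeval (α 0) h ≠ 0)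
    (F : Module.AEval' T →ₗ[Fq[X]] Module.AEval' T)
    (hF : ∀ x, F (Module.AEval'.of T x) = Module.AEval'.of T (x ^ Fintype.card Fq ^ d)) :
    ∃ b : Module.Basis (Fin r) (AdicCompletion (Ideal.span {h}) Fq[X])
      (tateModule (Module.AEval' T) h),
    ∀ m, (LinearMap.toMatrix b b (tateMap h F)).charpoly.map (completionToScalarQuotient E h m) =
      (polyMonodromy (fun i j => α j ^ Fintype.card Fq ^ i) r d).charpoly.map
        (AdjoinRoot.mk _) := by
  have hq : 1 < Fintype.card Fq := Fintype.one_lt_card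
  have hq0 : (Fintype.card Fq : E) = 0 := by
    rw [← map_natCast (algebraMap Fq E), FiniteField.cast_card_eq_zero, map_zero]
  have hh0 : ∀ m, aeval (α 0) (h ^ m) ≠ 0 := fun m => by
    rw [map_pow]
    exact pow_ne_zero _ hh1
  let o : E ≃ₗ[Fq] Module.AEval' T := Module.AEval'.of T
  have hsmul : ∀ (c : Fq[X]) (x : E), c • o x = o (aeval T c x) := fun c x =>
    (Module.AEval.of_aeval_smul T c x).symm
  have hsmul0 : ∀ (c : Fq[X]) (v : Module.AEval' T), c • v = 0 ↔ aeval T c (o.symm v) = 0 :=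
    fun c v => by
      obtain ⟨x, rfl⟩ := o.surjective v
      rw [hsmul, o.map_eq_zero_iff, o.symm_apply_apply]
  have hcard : Nat.card {v : Module.AEval' T // h • v = 0} =
      Fintype.card Fq ^ (r * h.natDegree) := by
    rw [← natCard_ker_aeval hq hq0 hα hT hh1]
    exact Nat.card_congr (o.symm.toEquiv.subtypeEquiv fun v => hsmul0 _ v)
  have hsurj : ∀ v : Module.AEval' T, ∃ w, h • w = v := fun v => by
    obtain ⟨x, hx⟩ := aeval_surjective hq hα hT hh1 (o.symm v)
    exact ⟨o x, by rw [hsmul, hx, o.apply_symm_apply]⟩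
  obtain ⟨v, hv, hgen, hind⟩ := exists_torsion_basis hirr hcard
  choose x hx using fun j => exists_tateComponent_one hsurj (v j) (hv j)
  simp only [← hx] at hgen hind
  let b : Module.Basis (Fin r) (AdicCompletion (Ideal.span {h}) Fq[X])
      (tateModule (Module.AEval' T) h) :=
    Module.Basis.mk (linearIndependent_tate x hind) (span_tate_eq_top x hgen hind)
  have hb : ∀ j, b j = x j := fun j => by rw [Module.Basis.mk_apply]
  refine ⟨b, fun m => ?_⟩
  set N := LinearMap.toMatrix b b (tateMap h F) with hNdef
  choose N' hN' using fun i j => Ideal.Quotient.mk_surjective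
    (AdicCompletion.evalₐ (Ideal.span {h}) m (N i j))
  have hNmap : N.map (completionToScalarQuotient E h m) =
      (Matrix.of N').map (toScalarQuotient E (h ^ m)) := by
    refine Matrix.ext fun i j => ?_
    exact completionToScalarQuotient_eq E h m _ _ (hN' i j).symm
  rw [← Matrix.charpoly_map, hNmap, ← Matrix.charpoly_map]
  refine charpoly_frobenius_torsion (hmonic.pow m) hα hd hT (hh0 m)
    (fun j => o.symm (tateComponent m (x j))) (fun j => ?_) (fun y hy => ?_) _ (fun j => ?_)
  · rw [← hsmul0]
    exact Torsion.pow_smul_val ((x j).1 m)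
  · obtain ⟨c, hc⟩ := exists_eq_sum_tateComponent x hgen m (o y) (by
      rw [hsmul0, o.symm_apply_apply, hy])
    refine ⟨c, o.injective ?_⟩
    rw [hc, map_sum]
    refine Finset.sum_congr rfl fun j _ => ?_
    rw [← hsmul, o.apply_symm_apply]
  · have h1 : tateMap h F (x j) = ∑ i, N i j • x i := by
      have h2 := b.sum_repr (tateMap h F (b j))
      simp only [hb] at h2
      rw [← h2]
      refine Finset.sum_congr rfl fun i _ => ?_
      rw [hNdef, LinearMap.toMatrix_apply, hb]
    have h2 := congrArg (tateComponent m) h1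
    rw [tateComponent_sum_smul x (fun i => N i j) (fun i => N' i j) (fun i => (hN' i j).symm)] at h2
    have h3 : tateComponent m (tateMap h F (x j)) =
        o ((o.symm (tateComponent m (x j))) ^ Fintype.card Fq ^ d) := by
      rw [← hF]
      change F (tateComponent m (x j)) = F (o (o.symm _))
      rw [o.apply_symm_apply]
    rw [h3] at h2
    refine o.injective ?_
    rw [h2, map_sum]
    refine Finset.sum_congr rfl fun i _ => ?_
    rw [Matrix.of_apply, ← hsmul, o.apply_symm_apply]

theorem aeval_thetaBar_pow (f : MonicPrime Fq) (p : Fq[X]) (i : ℕ) :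
    aeval (thetaBar f ^ Fintype.card Fq ^ i) p = aeval (thetaBar f) p ^ Fintype.card Fq ^ i := by
  rw [← DrinfeldModule.frobenius_pow_apply, ← DrinfeldModule.frobenius_pow_apply,
    aeval_algHom_apply]

namespace DrinfeldModule

variable {r : ℕ} (φ : DrinfeldModule Fq r) (f : MonicPrime Fq)

theorem redCoeff_pow (j : ℕ) :
    φ.redCoeff f j ^ Fintype.card Fq ^ f.1.natDegree = φ.redCoeff f j := by
  rw [redCoeff]
  split_ifs with h
  · rw [← aeval_thetaBar_pow, thetaBar_pow]
  · exact zero_pow (pow_ne_zero _ Fintype.card_ne_zero)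

theorem reductionAction_eq (x : ResidueClosure f) : φ.reductionAction f x =
    (additivePoly (Fintype.card Fq) (φ.redCoeff f) (φ.reductionRank f)).eval x := by
  have h1 : φ.reductionAction f x =
      ∑ j ∈ Finset.range (r + 1), φ.redCoeff f j * x ^ Fintype.card Fq ^ j := by
    rw [reductionAction, skewAction_apply, Finset.sum_range]
    refine Finset.sum_congr rfl fun i _ => ?_
    rw [frobenius_pow_apply, redCoeff, dif_pos i.2]
  rw [h1, additivePoly, eval_finsetSum]
  simp only [eval_mul, eval_C, eval_pow, eval_X]
  refine (Finset.sum_subset (Finset.range_mono (Nat.succ_le_succ (φ.reductionRank_le f)))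
    fun j _ hj => ?_).symm
  rw [φ.redCoeff_eq_zero f (by simpa using hj), zero_mul]

/-- The coefficients of the difference equation attached to the reduction of `φ` at `f`. -/
abbrev twistedCoeff (i j : ℕ) : ResidueClosure f := φ.redCoeff f j ^ Fintype.card Fq ^ i

/-- The characteristic polynomial of the monodromy of the reduction of `φ` at `f`. -/
def monodromyCharpoly : (ResidueClosure f)[X][X] :=
  (polyMonodromy (φ.twistedCoeff f) (φ.reductionRank f) f.1.natDegree).charpoly

theorem frobenius_of (x : ResidueClosure f) :
    φ.frobenius f (Module.AEval'.of (φ.reductionAction f) x) =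
      Module.AEval'.of (φ.reductionAction f) (x ^ Fintype.card Fq ^ f.1.natDegree) := by
  rw [← frobenius_pow_apply]
  rfl

theorem exists_tate_basis (h : MonicPrime Fq) (hne : h ≠ f) :
    ∃ b : Module.Basis (Fin (φ.reductionRank f)) (AdicCompletion (Ideal.span {h.1}) Fq[X])
      (tateModule (φ.ReductionModule f) h.1),
    ∀ m, (LinearMap.toMatrix b b (tateMap h.1 (φ.frobenius f))).charpoly.map
      (completionToScalarQuotient (ResidueClosure f) h.1 m) =
        (φ.monodromyCharpoly f).map (AdjoinRoot.mk _) :=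
  exists_tate_basis_of_additive (φ.redCoeff_reductionRank_ne_zero f) (φ.redCoeff_pow f)
    (φ.reductionAction_eq f) h.2.1 h.2.2 (by
      rw [φ.redCoeff_zero f]
      exact fun h0 => not_dvd_of_ne hne ((aeval_thetaBar_eq_zero_iff f _).1 h0))
    (φ.frobenius f) (φ.frobenius_of f)

/-- A single h suffices for descent to A: modulo each h^m the coefficients agree with those of a
matrix over the completion, hence are represented over `Fq`. -/
theorem exists_map_eq_monodromyCharpoly :
    ∃ P : Fq[X][X], P.map (mapRingHom (algebraMap Fq (ResidueClosure f))) =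
      φ.monodromyCharpoly f := by
  rw [← Polynomial.mem_lifts, Polynomial.lifts_iff_coeff_lifts]
  intro i
  obtain ⟨h, hne⟩ := exists_monicPrime_ne f
  obtain ⟨b, hb⟩ := φ.exists_tate_basis f h hne
  refine exists_map_eq_of_forall_mk_eq h.2.1 h.2.2 _ fun m => ?_
  have h1 := congrArg (fun Q => Q.coeff i) (hb m)
  simp only [coeff_map] at h1
  obtain ⟨c, hc⟩ := Ideal.Quotient.mk_surjective (AdicCompletion.evalₐ (Ideal.span {h.1}) m
    ((LinearMap.toMatrix b b (tateMap h.1 (φ.frobenius f))).charpoly.coeff i))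
  refine ⟨c, ?_⟩
  rw [← h1, completionToScalarQuotient_eq _ _ _ _ c hc.symm]

/-- Independence of h: the monodromy is defined without any reference to h. -/
theorem isFrobeniusCharpolyAt {P : Fq[X][X]}
    (hP : P.map (mapRingHom (algebraMap Fq (ResidueClosure f))) = φ.monodromyCharpoly f)
    (h : MonicPrime Fq) (hne : h ≠ f) : φ.IsFrobeniusCharpolyAt f h P := by
  obtain ⟨b, hb⟩ := φ.exists_tate_basis f h hne
  refine ⟨_, b, Polynomial.ext fun i => completion_ext (ResidueClosure f) fun m => ?_⟩
  have h1 := congrArg (fun Q => Q.coeff i) (hb m)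
  simp only [coeff_map] at h1
  rw [h1, coeff_map, completionToScalarQuotient_algebraMap, ← hP, coeff_map]
  rfl

/-- The characteristic polynomial of the Frobenius is that of the monodromy. -/
theorem frobeniusCharpoly_map :
    (φ.frobeniusCharpoly f).map (mapRingHom (algebraMap Fq (ResidueClosure f))) =
      φ.monodromyCharpoly f := by
  obtain ⟨P, hP⟩ := φ.exists_map_eq_monodromyCharpoly f
  have hex : ∃ P, ∀ h : MonicPrime Fq, h ≠ f → φ.IsFrobeniusCharpolyAt f h P :=
    ⟨P, φ.isFrobeniusCharpolyAt f hP⟩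
  rw [frobeniusCharpoly, dif_pos hex, ← hP]
  congr 1
  -- The chosen polynomial agrees with `P` by comparison at one h, because characteristic
  -- polynomials do not depend on the basis and A embeds in its completion.
  obtain ⟨h, hne⟩ := exists_monicPrime_ne f
  obtain ⟨s, b, hb⟩ := hex.choose_spec h hne
  obtain ⟨s', b', hb'⟩ := φ.isFrobeniusCharpolyAt f hP h hne
  have hinj := algebraMap_completion_injective h.2.2
  have : Module.Free (AdicCompletion (Ideal.span {h.1}) Fq[X])
    (tateModule (φ.ReductionModule f) h.1) := Module.Free.of_basis b
  have : Module.Finite (AdicCompletion (Ideal.span {h.1}) Fq[X])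
    (tateModule (φ.ReductionModule f) h.1) := Module.Finite.of_basis b
  rw [LinearMap.charpoly_toMatrix] at hb hb'
  exact Polynomial.map_injective _ hinj (hb.symm.trans hb')

end DrinfeldModule

end Taelman

end

/-! ### The twisted module in coordinates given by the conjugates of a root. -/

noncomputable section

namespace Taelman

variable {Fq : Type*} [Field Fq] [Fintype Fq]

theorem quasiPeriodicMatrix_eq_of_le {R : Type*} [CommRing R] (t : R) {a : ℕ → ℕ → R} {r r' : ℕ}
    (hr : r ≤ r') (d : ℕ) (z : R) (ha : ∀ i j, r < j → a i j = 0) :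
    quasiPeriodicMatrix t a r' d z = quasiPeriodicMatrix t a r d z := by
  refine Matrix.ext fun i l => ?_
  simp only [quasiPeriodicMatrix, Matrix.of_apply]
  congr 1
  refine (Finset.sum_subset (Finset.range_mono (Nat.succ_le_succ hr)) fun j _ hj => ?_).symm
  rw [ha i j (by simpa using hj), zero_mul, ite_self]

theorem charpoly_eq_of_mul_eq_mul {K : Type*} [Field K] {ι : Type*} [Fintype ι] [DecidableEq ι]
    {Y A G : Matrix ι ι K} (hY : Y.det ≠ 0) (h : Y * A = G * Y) : A.charpoly = G.charpoly := by
  obtain ⟨U, hU⟩ : IsUnit Y := (Matrix.isUnit_iff_isUnit_det _).2 hY.isUnit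
  have h1 := Matrix.charpoly_units_conj U A
  rw [hU, h, ← hU, mul_assoc, Matrix.mul_nonsing_inv _
    ((Matrix.isUnit_iff_isUnit_det _).1 U.isUnit), mul_one] at h1
  exact h1.symm

theorem map_eq_prod_of_roots {L : Type*} [Field L] [Algebra Fq L] {f : Fq[X]} (hf : f.Monic)
    {β : L} (hβ : aeval β f = 0)
    (hinj : Function.Injective fun i : Fin f.natDegree => β ^ Fintype.card Fq ^ (i : ℕ)) :
    f.map (algebraMap Fq L) =
      ∏ i : Fin f.natDegree, (X - C (β ^ Fintype.card Fq ^ (i : ℕ))) := by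
  refine (eq_of_monic_of_dvd_of_natDegree_le (monic_prod_of_monic _ _ fun i _ => monic_X_sub_C _)
    (hf.map _) ?_ ?_)
  · refine Finset.prod_dvd_of_coprime (fun i _ i' _ hii' => pairwise_coprime_X_sub_C hinj hii') ?_
    intro i _
    rw [dvd_iff_isRoot, IsRoot, eval_map_algebraMap]
    have h1 : β ^ Fintype.card Fq ^ (i : ℕ) = (FiniteField.frobeniusAlgHom Fq L ^ (i : ℕ)) β := by
      rw [AlgHom.coe_pow, FiniteField.coe_frobeniusAlgHom, pow_iterate]
    rw [h1, aeval_algHom_apply, hβ, map_zero]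
  · rw [hf.natDegree_map, natDegree_prod_of_monic _ _ fun i _ => monic_X_sub_C _]
    simp only [natDegree_X_sub_C]
    simp

/-- `K[X] / g` as a `K`-vector space. -/
def adjoinRootEquivQuotient {K : Type*} [Field K] (g : K[X]) :
    AdjoinRoot g ≃ₗ[K] (K[X] ⧸ (Ideal.span {g}).restrictScalars K) :=
  (Submodule.Quotient.restrictScalarsEquiv K (Ideal.span {g})).symm

/-- The basis `1, X, …, X ^ (d - 1)` of `K[X] / g`. -/
theorem exists_basis_quotient {K : Type*} [Field K] {g : K[X]} (hg : g.Monic) {d : ℕ}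
    (hd : g.natDegree = d) :
    ∃ b : Module.Basis (Fin d) K (K[X] ⧸ (Ideal.span {g}).restrictScalars K),
      ∀ l, b l = Submodule.Quotient.mk (X ^ (l : ℕ)) := by
  have hdim : (AdjoinRoot.powerBasis' hg).dim = d := hd
  refine ⟨((AdjoinRoot.powerBasis' hg).basis.map (adjoinRootEquivQuotient g)).reindex
    (finCongr hdim), fun l => ?_⟩
  rw [Module.Basis.reindex_apply, Module.Basis.map_apply, PowerBasis.basis_eq_pow,
    AdjoinRoot.powerBasis'_gen, ← AdjoinRoot.mk_X, ← map_pow]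
  rfl

namespace DrinfeldModule

variable {r : ℕ} (φ : DrinfeldModule Fq r) (n : ℕ)

theorem tauZ_pow_aeval {L : Type*} [Field L] [Algebra (ZField Fq n) L] (j : ℕ) (β : L)
    (p : (ZField Fq n)[X]) :
    aeval β ((tauZ Fq n ^ j) p) = aeval (β ^ Fintype.card Fq ^ j) p := by
  induction j generalizing β with
  | zero => simp
  | succ j ih =>
    rw [pow_succ', AlgHom.mul_apply, tauZ, expand_aeval, ← tauZ, ih, ← pow_mul, ← pow_succ']

/-- The determinant that describes the action of `ϕ_θ` on `𝔸 / f𝔸` after the choice of a root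
of `f`. -/
theorem map_fittingGenerator_twistModule {f : Fq[X]} (hf : f.Monic) (hf0 : 0 < f.natDegree)
    {L : Type*} [Field L] [Algebra (ZField Fq n) L] [Algebra Fq L]
    [IsScalarTower Fq (ZField Fq n) L]
    {β : L} (hβ : aeval β f = 0) (hβd : β ^ Fintype.card Fq ^ f.natDegree = β)
    (hinj : Function.Injective fun i : Fin f.natDegree => β ^ Fintype.card Fq ^ (i : ℕ))
    (hz : ∀ (k : Fin n) (i : ℕ), algebraMap (ZField Fq n) L (z Fq k) ≠ β ^ Fintype.card Fq ^ i) :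
    (fittingGenerator (ZField Fq n) (φ.TwistModule n f)).map (algebraMap (ZField Fq n) L) =
      (quasiPeriodicMatrix (X : L[X]) (fun i j => C (if hj : j < r + 1 then
        aeval (β ^ Fintype.card Fq ^ i) (φ.coeff ⟨j, hj⟩) else 0)) r f.natDegree
        (C (algebraMap (ZField Fq n) L (∏ k : Fin n, aeval (z Fq k) f)))).det := by
  set q := Fintype.card Fq with hq
  set d := f.natDegree with hd
  let a : ℕ → ℕ → L := fun i j => if hj : j < r + 1 then aeval (β ^ q ^ i) (φ.coeff ⟨j, hj⟩) else 0
  let V := (ZField Fq n)[X] ⧸ (Ideal.span {toZ Fq n f}).restrictScalars (ZField Fq n)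
  let T : V →ₗ[ZField Fq n] V := φ.twistQuotientAction n f
  obtain ⟨b, hb⟩ : ∃ b : Module.Basis (Fin d) (ZField Fq n) V,
      ∀ l, b l = Submodule.Quotient.mk (X ^ (l : ℕ)) :=
    exists_basis_quotient (hf.map (algebraMap Fq (ZField Fq n))) (hf.natDegree_map _)
  have hFrob : ∀ (i : ℕ) (x : L), x ^ q ^ i = (FiniteField.frobeniusAlgHom Fq L ^ i) x := by
    intro i x
    rw [AlgHom.coe_pow, FiniteField.coe_frobeniusAlgHom, pow_iterate]
  have hroot : ∀ i, aeval (β ^ q ^ i) f = 0 := fun i => by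
    rw [hFrob, aeval_algHom_apply, hβ, map_zero]
  have hrootZ : ∀ i, aeval (β ^ q ^ i) (toZ Fq n f) = 0 := fun i => by
    rw [toZ, coe_mapRingHom, aeval_map_algebraMap, hroot]
  let ev : ℕ → V →ₗ[ZField Fq n] L := fun i =>
    Submodule.liftQ _ (aeval (β ^ q ^ i)).toLinearMap (by
      intro p hp
      obtain ⟨c, rfl⟩ := Ideal.mem_span_singleton.1 hp
      rw [LinearMap.mem_ker, AlgHom.toLinearMap_apply, map_mul, hrootZ, zero_mul])
  have hev : ∀ i p, ev i (Submodule.Quotient.mk p) = aeval (β ^ q ^ i) p := fun i p => rfl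
  have hperiod : ∀ i, β ^ q ^ (i + d) = β ^ q ^ i := fun i => by
    rw [add_comm, pow_add, pow_mul, hβd]
  have hevd : ∀ i x, ev (i + d) x = ev i x := by
    intro i x
    obtain ⟨p, rfl⟩ := Submodule.Quotient.mk_surjective _ x
    rw [hev, hev, hperiod]
  let w : ℕ → L := fun i => ∏ k : Fin n, (algebraMap (ZField Fq n) L (z Fq k) - β ^ q ^ i)
  have hw0 : ∀ i, w i ≠ 0 := fun i =>
    Finset.prod_ne_zero_iff.2 fun k _ => sub_ne_zero.2 (hz k i)
  have hwd : ∀ i, w (i + d) = w i := fun i => by simp only [w, hperiod]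
  -- The rescaling absorbs the twist: the value of ℓ_j(z_1)⋯ℓ_j(z_n) at β^{q^i} is `pw (i + j) / pw
  -- i`. Over one period the factors multiply to ∏_k f(z_k), which becomes the multiplier `Z`.
  let pw : ℕ → L := fun i => ∏ m ∈ Finset.range i, w m
  have hpw0 : ∀ i, pw i ≠ 0 := fun i => Finset.prod_ne_zero_iff.2 fun m _ => hw0 m
  set Z : L := algebraMap (ZField Fq n) L (∏ k : Fin n, aeval (z Fq k) f) with hZ
  have hZpw : pw d = Z := by
    simp only [pw, w]
    rw [Finset.prod_comm, hZ, map_prod]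
    refine Finset.prod_congr rfl fun k _ => ?_
    rw [← aeval_algebraMap_apply, ← eval_map_algebraMap, map_eq_prod_of_roots hf hβ hinj, eval_prod,
      Finset.prod_range]
    simp only [eval_sub, eval_X, eval_C]
    rfl
  have hpwd : ∀ i, pw (i + d) = Z * pw i := by
    intro i
    rw [← hZpw]
    simp only [pw]
    rw [add_comm, Finset.prod_range_add]
    congr 1
    refine Finset.prod_congr rfl fun m _ => ?_
    rw [add_comm, hwd]
  let y : ℕ → V → L := fun i x => pw i * ev i x
  have hyT : ∀ i x, y i (T x) = ∑ j ∈ Finset.range (r + 1), a i j * y (i + j) x := by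
    intro i x
    obtain ⟨p, rfl⟩ := Submodule.Quotient.mk_surjective _ x
    have h1 : T (Submodule.Quotient.mk p) = Submodule.Quotient.mk (φ.twistAction n p) := rfl
    simp only [y]
    rw [h1, hev, twistAction, skewAction_apply, map_sum, Finset.mul_sum, Finset.sum_range]
    refine Finset.sum_congr rfl fun j _ => ?_
    rw [map_mul, tauZ_pow_aeval, hev, twistCoeff, map_mul, ← pow_mul, ← pow_add]
    have h2 : aeval (β ^ q ^ i) (toZ Fq n (φ.coeff j)) = a i j := by
      rw [toZ, coe_mapRingHom, aeval_map_algebraMap]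
      simp only [a]
      rw [dif_pos j.2]
    have h3 : pw (i + j) = pw i * aeval (β ^ q ^ i) (∏ k : Fin n, ell Fq (j : ℕ) k) := by
      simp only [pw]
      rw [Finset.prod_range_add, map_prod]
      congr 1
      simp only [w]
      rw [Finset.prod_comm]
      refine Finset.prod_congr rfl fun k _ => ?_
      rw [ell, map_prod]
      refine Finset.prod_congr rfl fun m _ => ?_
      rw [map_sub, aeval_C, map_pow, aeval_X, ← pow_mul, ← pow_add]
    rw [h2, h3]
    ring
  have hyd : ∀ i x, y (i + d) x = Z * y i x := fun i x => by
    simp only [y]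
    rw [hpwd, hevd, mul_assoc]
  have hydiv : ∀ i x, y i x = Z ^ (i / d) * y (i % d) x := by
    intro i x
    have : ∀ m, y (i % d + d * m) x = Z ^ m * y (i % d) x := by
      intro m
      induction m with
      | zero => simp
      | succ m ih => rw [Nat.mul_succ, ← add_assoc, hyd, ih, pow_succ', mul_assoc]
    rw [← this (i / d), Nat.mod_add_div]
  let Y : Matrix (Fin d) (Fin d) L := Matrix.of fun i l => y i (b l)
  have hYdet : Y.det ≠ 0 := by
    -- Invertibility uses that the conjugates are distinct and that no z_k equals one of them.
    have h1 : Y = Matrix.diagonal (fun i : Fin d => pw i) *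
        Matrix.vandermonde (fun i : Fin d => β ^ q ^ (i : ℕ)) := by
      refine Matrix.ext fun i l => ?_
      rw [Matrix.diagonal_mul, Matrix.vandermonde_apply]
      simp only [Y, y, Matrix.of_apply]
      rw [hb, hev, map_pow, aeval_X]
    rw [h1, Matrix.det_mul, Matrix.det_diagonal]
    exact mul_ne_zero (Finset.prod_ne_zero_iff.2 fun i _ => hpw0 i)
      (Matrix.det_vandermonde_ne_zero_iff.2 hinj)
  -- The matrix of ∑_j a_{ij} S^j on sequences with multiplier `Z`; the change of coordinates `Y`
  -- conjugates ϕ_θ into it.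
  let G : Matrix (Fin d) (Fin d) L := Matrix.of fun i l => ∑ j ∈ Finset.range (r + 1),
    if ((i : ℕ) + j) % d = l then a i j * Z ^ (((i : ℕ) + j) / d) else 0
  have hYG : Y * (LinearMap.toMatrix b b T).map (algebraMap (ZField Fq n) L) = G * Y := by
    refine Matrix.ext fun i l => ?_
    have h1 : (Y * (LinearMap.toMatrix b b T).map (algebraMap (ZField Fq n) L)) i l =
        y i (T (b l)) := by
      rw [Matrix.mul_apply]
      simp only [y, Y, Matrix.of_apply, Matrix.map_apply]
      conv_rhs => rw [← b.sum_repr (T (b l)), map_sum, Finset.mul_sum]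
      refine Finset.sum_congr rfl fun m _ => ?_
      rw [map_smul, LinearMap.toMatrix_apply, Algebra.smul_def]
      ring
    rw [h1, hyT, Matrix.mul_apply]
    simp only [G, Y, Matrix.of_apply, Finset.sum_mul, ite_mul, zero_mul]
    rw [Finset.sum_comm]
    refine Finset.sum_congr rfl fun j _ => ?_
    rw [Finset.sum_eq_single (⟨((i : ℕ) + j) % d, Nat.mod_lt _ hf0⟩ : Fin d)]
    · rw [if_pos rfl, hydiv (i + j), mul_assoc]
    · intro m _ hm
      rw [if_neg]
      intro h
      exact hm (Fin.ext h.symm)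
    · simp
  have hG : quasiPeriodicMatrix (X : L[X]) (fun i j => C (a i j)) r d (C Z) = G.charmatrix := by
    refine Matrix.ext fun i l => ?_
    simp only [quasiPeriodicMatrix, G, Matrix.of_apply, Matrix.charmatrix_apply,
      Matrix.diagonal_apply, map_sum, apply_ite C, map_mul, map_pow, map_zero]
  have h1 : fittingGenerator (ZField Fq n) (φ.TwistModule n f) =
      (LinearMap.toMatrix b b T).charpoly := fittingGenerator_aeval b T
  rw [h1, ← Matrix.charpoly_map, charpoly_eq_of_mul_eq_mul hYdet hYG]
  change _ = (quasiPeriodicMatrix (X : L[X]) (fun i j => C (a i j)) r d (C Z)).det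
  rw [hG]
  rfl

end DrinfeldModule

end Taelman

end

/-! ### The local factor at f and the Riemann hypothesis bound. -/

noncomputable section

namespace Taelman

variable {Fq : Type*} [Field Fq]

/-- The variable z_k is transcendental over `Fq`, whereas β is algebraic. -/
theorem algebraMap_z_ne {n : ℕ} {L : Type*} [Field L] [Algebra (ZField Fq n) L] [Algebra Fq L]
    [IsScalarTower Fq (ZField Fq n) L] {f : Fq[X]} (hf : f ≠ 0) {β : L} (hβ : aeval β f = 0)
    (k : Fin n) : algebraMap (ZField Fq n) L (z Fq k) ≠ β := by
  rintro rfl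
  rw [aeval_algebraMap_apply, map_eq_zero_iff _ (algebraMap (ZField Fq n) L).injective, z,
    aeval_algebraMap_apply, map_eq_zero_iff _ (IsFractionRing.injective _ _)] at hβ
  exact hf ((transcendental_iff.1 (MvPolynomial.transcendental_X Fq k)) f hβ)

variable [Fintype Fq]

/-- Frobenius has order deg f on the residue field, and its powers are determined by their values at
the root. -/
theorem thetaBar_pow_injective (f : MonicPrime Fq) :
    Function.Injective fun i : Fin f.1.natDegree => thetaBar f ^ Fintype.card Fq ^ (i : ℕ) := by
  have hf0 : f.1 ≠ 0 := f.2.2.ne_zero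
  let pb := AdjoinRoot.powerBasis hf0
  have : Module.Finite Fq (AdjoinRoot f.1) := pb.finite
  have : Finite (AdjoinRoot f.1) := Module.finite_of_finite Fq
  have hord : orderOf (FiniteField.frobeniusAlgHom Fq (AdjoinRoot f.1)) = f.1.natDegree := by
    rw [FiniteField.orderOf_frobeniusAlgHom, pb.finrank]
    rfl
  have hroot : ∀ i : ℕ, (FiniteField.frobeniusAlgHom Fq (AdjoinRoot f.1) ^ i)
      (AdjoinRoot.root f.1) = AdjoinRoot.root f.1 ^ Fintype.card Fq ^ i := fun i => by
    rw [AlgHom.coe_pow, FiniteField.coe_frobeniusAlgHom, pow_iterate]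
  intro i j hij
  have h1 : AdjoinRoot.root f.1 ^ Fintype.card Fq ^ (i : ℕ) =
      AdjoinRoot.root f.1 ^ Fintype.card Fq ^ (j : ℕ) := by
    refine (algebraMap (AdjoinRoot f.1) (ResidueClosure f)).injective ?_
    rw [map_pow, map_pow]
    exact hij
  have h2 : FiniteField.frobeniusAlgHom Fq (AdjoinRoot f.1) ^ (i : ℕ) =
      FiniteField.frobeniusAlgHom Fq (AdjoinRoot f.1) ^ (j : ℕ) := by
    refine AdjoinRoot.algHom_ext ?_
    rw [hroot, hroot, h1]
  refine Fin.ext (pow_injOn_Iio_orderOf (x := FiniteField.frobeniusAlgHom Fq (AdjoinRoot f.1))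
    ?_ ?_ h2)
  · rw [hord]
    exact i.2
  · rw [hord]
    exact j.2

theorem map_eq_prod_thetaBar (f : MonicPrime Fq) : f.1.map (algebraMap Fq (ResidueClosure f)) =
    ∏ i : Fin f.1.natDegree, (X - C (thetaBar f ^ Fintype.card Fq ^ (i : ℕ))) :=
  map_eq_prod_of_roots f.2.1 ((aeval_thetaBar_eq_zero_iff f _).2 dvd_rfl)
    (thetaBar_pow_injective f)

namespace DrinfeldModule

variable {r : ℕ} (φ : DrinfeldModule Fq r) (f : MonicPrime Fq)

/-- The polynomial `f + ∑_{i=1}^{r₀} c(f) p_i x ^ i = f D_f(x / f)`. -/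
def localPoly : Fq[X][X] :=
  C f.1 + ∑ i ∈ Finset.Icc 1 (φ.reductionRank f),
    C (C (φ.frobeniusConst f) * (φ.frobeniusCharpoly f).coeff i) * X ^ i

theorem localPoly_coeff {i : ℕ} (hi : i ∈ Finset.Icc 1 (φ.reductionRank f)) :
    (φ.localPoly f).coeff i = C (φ.frobeniusConst f) * (φ.frobeniusCharpoly f).coeff i := by
  have h0 : i ≠ 0 := by
    have := (Finset.mem_Icc.1 hi).1
    omega
  rw [localPoly, coeff_add, coeff_C_of_ne_zero h0, zero_add, finsetSum_coeff]
  simp only [coeff_C_mul, coeff_X_pow, mul_ite, mul_one, mul_zero]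
  rw [Finset.sum_ite_eq, if_pos hi]

/-- The determinant attached to the reduction of `φ` at `f`. -/
abbrev reductionSpectralPoly : (ResidueClosure f)[X][X] :=
  spectralPoly (φ.twistedCoeff f) (φ.reductionRank f) f.1.natDegree

theorem reductionSpectralPoly_coeff_zero :
    (φ.reductionSpectralPoly f).coeff 0 = f.1.map (algebraMap Fq (ResidueClosure f)) := by
  rw [spectralPoly_coeff_zero, map_eq_prod_thetaBar]
  simp only [twistedCoeff, φ.redCoeff_zero f]

theorem twistedCoeff_periodic (i j : ℕ) :
    φ.twistedCoeff f (i + f.1.natDegree) j = φ.twistedCoeff f i j := by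
  rw [twistedCoeff, add_comm, pow_add, pow_mul, φ.redCoeff_pow f]

/-- P is a constant c times the spectral polynomial, whose value at z = 0 is f. Comparing constant
terms gives P(0) = c f, so c(f) = c⁻¹ and the factor c cancels. For r₀ = 0 there is no monodromy,
and both sides reduce to f. -/
theorem localPoly_map :
    (φ.localPoly f).map (mapRingHom (algebraMap Fq (ResidueClosure f))) =
      φ.reductionSpectralPoly f := by
  rcases eq_or_ne (φ.reductionRank f) 0 with h0 | h0
  · have h1 : φ.reductionSpectralPoly f =
        C (f.1.map (algebraMap Fq (ResidueClosure f))) := by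
      rw [reductionSpectralPoly, spectralPoly, h0, det_quasiPeriodicMatrix_order_zero,
        map_eq_prod_thetaBar, map_prod]
      simp only [twistedCoeff, φ.redCoeff_zero f, C_sub]
    rw [h1, localPoly, h0]
    simp
  · obtain ⟨c, hc0, hc⟩ := exists_charpoly_polyMonodromy (a := φ.twistedCoeff f)
      f.2.2.natDegree_pos h0 (fun i => pow_ne_zero _ (φ.redCoeff_reductionRank_ne_zero f h0))
      (φ.twistedCoeff_periodic f)
    have hP := φ.frobeniusCharpoly_map f
    rw [monodromyCharpoly, hc] at hP
    have h1 : ((φ.frobeniusCharpoly f).coeff 0).map (algebraMap Fq (ResidueClosure f)) =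
        C c * f.1.map (algebraMap Fq (ResidueClosure f)) := by
      have h2 := congrArg (fun Q => Q.coeff 0) hP
      simp only [coeff_map, coeff_C_mul, φ.reductionSpectralPoly_coeff_zero f] at h2
      exact h2
    have h2 : algebraMap Fq (ResidueClosure f) (φ.frobeniusConst f) = c⁻¹ := by
      rw [frobeniusConst, map_inv₀, ← leadingCoeff_map, h1, leadingCoeff_mul, leadingCoeff_C,
        (f.2.1.map _).leadingCoeff, mul_one]
    have h3 : (C (C (φ.frobeniusConst f)) * φ.frobeniusCharpoly f).map
        (mapRingHom (algebraMap Fq (ResidueClosure f))) = φ.reductionSpectralPoly f := by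
      rw [Polynomial.map_mul, hP, map_C, coe_mapRingHom, map_C, h2, ← mul_assoc, ← C_mul, ← C_mul,
        inv_mul_cancel₀ hc0, C_1, C_1, one_mul]
    have hinj : Function.Injective (mapRingHom (algebraMap Fq (ResidueClosure f))) :=
      map_injective _ (algebraMap Fq (ResidueClosure f)).injective
    have h4 : (C (C (φ.frobeniusConst f)) * φ.frobeniusCharpoly f).coeff 0 = f.1 := by
      refine hinj ?_
      rw [← coeff_map, h3, φ.reductionSpectralPoly_coeff_zero f]
      rfl
    have h5 : (φ.frobeniusCharpoly f).natDegree ≤ φ.reductionRank f := by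
      have h6 : ((φ.frobeniusCharpoly f).map
          (mapRingHom (algebraMap Fq (ResidueClosure f)))).natDegree = φ.reductionRank f := by
        rw [φ.frobeniusCharpoly_map f, monodromyCharpoly, Matrix.charpoly_natDegree_eq_dim,
          Fintype.card_fin]
      rw [natDegree_map_eq_of_injective hinj] at h6
      exact h6.le
    rw [← h3]
    congr 1
    refine Polynomial.ext fun i => ?_
    rcases Nat.eq_zero_or_pos i with rfl | hi
    · rw [h4, localPoly, coeff_add, coeff_C_zero, finsetSum_coeff, Finset.sum_eq_zero, add_zero]
      intro j hj
      have := (Finset.mem_Icc.1 hj).1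
      rw [coeff_C_mul, coeff_X_pow, if_neg (by omega), mul_zero]
    · by_cases hir : i ≤ φ.reductionRank f
      · rw [φ.localPoly_coeff f (Finset.mem_Icc.2 ⟨hi, hir⟩), coeff_C_mul]
      · rw [coeff_C_mul, coeff_eq_zero_of_natDegree_lt (lt_of_le_of_lt h5 (not_le.1 hir)), mul_zero,
          localPoly, coeff_add, coeff_C_of_ne_zero (by omega), zero_add, finsetSum_coeff,
          Finset.sum_eq_zero]
        intro j hj
        have := (Finset.mem_Icc.1 hj).2
        rw [coeff_C_mul, coeff_X_pow, if_neg (by omega), mul_zero]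

/-- The Riemann hypothesis for the coefficients of the characteristic polynomial. -/
theorem natDegree_localCoeff_le {i : ℕ} (hi : i ∈ Finset.Icc 1 (φ.reductionRank f))
    (hne : C (φ.frobeniusConst f) * (φ.frobeniusCharpoly f).coeff i ≠ 0) :
    r * (C (φ.frobeniusConst f) * (φ.frobeniusCharpoly f).coeff i).natDegree +
      f.1.natDegree * i ≤ r * f.1.natDegree := by
  rw [← φ.localPoly_coeff f hi] at hne ⊢
  have hi' := Finset.mem_Icc.1 hi
  have h0 : φ.reductionRank f ≠ 0 := by omega
  have hle := φ.reductionRank_le f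
  have h1 : (φ.reductionSpectralPoly f).coeff i =
      ((φ.localPoly f).coeff i).map (algebraMap Fq (ResidueClosure f)) := by
    rw [← φ.localPoly_map f, coeff_map]
    rfl
  have h2 := natDegree_coeff_spectralPoly_le (φ.twistedCoeff f) h0 f.1.natDegree i (by
    rw [h1]
    exact (map_ne_zero_iff (mapRingHom (algebraMap Fq (ResidueClosure f)))
      (map_injective _ (algebraMap Fq (ResidueClosure f)).injective)).2 hne)
  rw [h1, natDegree_map] at h2
  have h3 : ((φ.localPoly f).coeff i).natDegree ≤ f.1.natDegree := by
    have : φ.reductionRank f * ((φ.localPoly f).coeff i).natDegree ≤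
        φ.reductionRank f * f.1.natDegree := by
      rw [mul_comm _ f.1.natDegree]
      omega
    exact Nat.le_of_mul_le_mul_left this (Nat.pos_of_ne_zero h0)
  obtain ⟨s, hs⟩ := Nat.exists_eq_add_of_le hle
  generalize ((φ.localPoly f).coeff i).natDegree = x at *
  generalize φ.reductionRank f = r₀ at *
  subst hs
  -- Weakening the bound from r₀ to r = r₀ + s costs only s times the inequality deg ≤ deg f.
  have h4 : s * x ≤ s * f.1.natDegree := Nat.mul_le_mul_left _ h3
  rw [add_mul, add_mul]
  rw [mul_comm f.1.natDegree r₀] at h2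
  omega

variable (n : ℕ)

/-- The monic generator of the Fitting ideal of `ϕ(𝔸 / f𝔸)`. -/
theorem fittingGenerator_twistModule :
    fittingGenerator (ZField Fq n) (φ.TwistModule n f.1) =
      (φ.localPoly f).eval₂ (toZ Fq n) (C (∏ k : Fin n, aeval (z Fq k) f.1)) := by
  let L := AlgebraicClosure (ZField Fq n)
  have hf0 : f.1 ≠ 0 := f.2.2.ne_zero
  have : Module.Finite Fq (AdjoinRoot f.1) := (AdjoinRoot.powerBasis hf0).finite
  have : Algebra.IsAlgebraic Fq (ResidueClosure f) :=
    Algebra.IsAlgebraic.trans Fq (AdjoinRoot f.1) (ResidueClosure f)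
  -- Both readings of the determinant must be compared over one field: `L` contains the z_k and,
  -- through ι, the conjugates of θ modulo f.
  let ι : ResidueClosure f →ₐ[Fq] L := IsAlgClosed.lift
  have hι : Function.Injective ι := ι.toRingHom.injective
  have hθ : ∀ i : ℕ, aeval (ι (thetaBar f) ^ Fintype.card Fq ^ i) f.1 = 0 := fun i => by
    rw [← map_pow, aeval_algHom_apply, aeval_thetaBar_pow,
      (aeval_thetaBar_eq_zero_iff f _).2 dvd_rfl, zero_pow (pow_ne_zero _ Fintype.card_ne_zero),
      map_zero]
  have h1 := φ.map_fittingGenerator_twistModule n (f := f.1) f.2.1 f.2.2.natDegree_pos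
    (L := L) (β := ι (thetaBar f)) (by simpa using hθ 0)
    (by rw [← map_pow, thetaBar_pow])
    (fun i j hij => thetaBar_pow_injective f
      (hι ((map_pow ι _ _).trans (hij.trans (map_pow ι _ _).symm))))
    (fun k i => algebraMap_z_ne hf0 (hθ i) k)
  refine map_injective _ (algebraMap (ZField Fq n) L).injective ?_
  rw [h1]
  have h2 : (fun i j => C (if hj : j < r + 1 then
      aeval (ι (thetaBar f) ^ Fintype.card Fq ^ i) (φ.coeff ⟨j, hj⟩) else 0) : ℕ → ℕ → L[X]) =
      fun i j => mapRingHom ι.toRingHom (C (φ.twistedCoeff f i j)) := by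
    funext i j
    rw [coe_mapRingHom, map_C, twistedCoeff, redCoeff]
    split_ifs
    · rw [← aeval_thetaBar_pow, ← map_pow, aeval_algHom_apply]
      rfl
    · rw [zero_pow (pow_ne_zero _ Fintype.card_ne_zero), map_zero, map_zero, C_0]
  rw [h2, quasiPeriodicMatrix_eq_of_le _ (φ.reductionRank_le f) _ _ (fun i j hj => by
    rw [twistedCoeff, φ.redCoeff_eq_zero f hj, zero_pow (pow_ne_zero _ Fintype.card_ne_zero), C_0,
      map_zero])]
  have h3 := eval₂_spectralPoly (mapRingHom ι.toRingHom)
    (C (algebraMap (ZField Fq n) L (∏ k : Fin n, aeval (z Fq k) f.1))) (φ.twistedCoeff f)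
    (φ.reductionRank f) f.1.natDegree
  rw [coe_mapRingHom, map_X] at h3
  have h4 : spectralPoly (φ.twistedCoeff f) (φ.reductionRank f) f.1.natDegree = _ :=
    (φ.localPoly_map f).symm
  rw [coe_mapRingHom, ← h3, h4, eval₂_map, ← coe_mapRingHom, hom_eval₂,
    coe_mapRingHom, map_C]
  congr 1
  refine Polynomial.ringHom_ext (fun x => ?_) ?_
  · simp only [RingHom.comp_apply, coe_mapRingHom, map_C, toZ]
    congr 1
    exact (ι.commutes x).trans (IsScalarTower.algebraMap_apply Fq (ZField Fq n) L x)
  · simp only [RingHom.comp_apply, coe_mapRingHom, map_X, toZ]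

end DrinfeldModule

end Taelman

end

noncomputable section

namespace Taelman

/-! ### Expanding infinite products over a nonarchimedean ring. -/

section EulerProduct

variable {K : Type*} [Field K] [UniformSpace K] [IsUniformAddGroup K]
  [NonarchimedeanRing K]
  {ι : Type*}

/-- A finite Euler product is the sum of the terms supported on its index set. -/
theorem hasSum_finsuppProd_of_support_subset {a : ι → ℕ → K} {s : ι → K} (ha0 : ∀ i, a i 0 = 1)
    (ha : ∀ i, HasSum (a i) (s i)) (T : Finset ι) :
    HasSum (fun e : {e : ι →₀ ℕ // e.support ⊆ T} => e.1.prod a) (∏ i ∈ T, s i) := by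
  classical
  induction T using Finset.induction_on with
  | empty =>
    let _ : Unique {e : ι →₀ ℕ // e.support ⊆ ∅} :=
      { default := ⟨0, by simp⟩
        uniq := fun e => Subtype.ext (Finsupp.support_eq_empty.1 (Finset.subset_empty.1 e.2)) }
    convert hasSum_unique (fun e : {e : ι →₀ ℕ // e.support ⊆ ∅} => e.1.prod a)
    rw [Finset.prod_empty]
    exact (Finsupp.prod_zero_index (h := a)).symm
  | insert i T hi ih =>
    have hmem : ∀ e : {e : ι →₀ ℕ // e.support ⊆ T}, e.1 i = 0 := fun e =>
      Finsupp.notMem_support_iff.1 fun h => hi (e.2 h)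
    let E : ℕ × {e : ι →₀ ℕ // e.support ⊆ T} ≃ {e : ι →₀ ℕ // e.support ⊆ insert i T} :=
      { toFun := fun p => ⟨p.2.1.update i p.1, by
          refine Finset.Subset.trans (Finsupp.support_update_subset ..) ?_
          exact Finset.insert_subset_insert _ p.2.2⟩
        invFun := fun e => (e.1 i, ⟨e.1.erase i, by
          rw [Finsupp.support_erase]
          exact fun j hj => Finset.mem_of_mem_insert_of_ne (e.2 (Finset.mem_of_mem_erase hj))
            (Finset.ne_of_mem_erase hj)⟩)
        left_inv := fun p => by
          refine Prod.ext (by simp) (Subtype.ext ?_)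
          ext j
          rcases eq_or_ne j i with rfl | hj
          · simp [hmem p.2]
          · simp [Finsupp.erase_ne hj]
        right_inv := fun e => Subtype.ext (by
          ext j
          rcases eq_or_ne j i with rfl | hj
          · simp
          · simp) }
    rw [Finset.prod_insert hi, ← E.hasSum_iff]
    refine ((ha i).mul_of_nonarchimedean ih).congr_fun fun p => ?_
    have h1 := Finsupp.mul_prod_erase' (p.2.1.update i p.1) i a ha0
    have h2 : p.2.1.erase i = p.2.1 := Finsupp.erase_of_notMem_support
      (Finsupp.notMem_support_iff.2 (hmem p.2))
    rw [Finsupp.erase_update_eq_erase, h2, Finsupp.coe_update, Function.update_self] at h1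
    exact h1.symm

/-- The product over T is the sum of the terms supported in T. Only finitely many terms lie outside
a given open subgroup; once T contains their supports, the difference from `S` is a sum of terms
inside the subgroup, which is also closed. -/
theorem hasProd_of_summable_finsuppProd {a : ι → ℕ → K} {s : ι → K} (ha0 : ∀ i, a i 0 = 1)
    (ha : ∀ i, HasSum (a i) (s i)) {S : K} (hS : HasSum (fun e : ι →₀ ℕ => e.prod a) S) :
    HasProd s S := by
  classical
  have h : Filter.Tendsto (fun T : Finset ι => S - ∏ i ∈ T, s i) Filter.atTop (nhds 0) := by
    rw [Filter.tendsto_def]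
    intro U hU
    obtain ⟨V, hV⟩ := NonarchimedeanRing.is_nonarchimedean U hU
    have hfin := hS.summable.tendsto_cofinite_zero (V.mem_nhds_zero)
    rw [Filter.mem_map, Filter.mem_cofinite] at hfin
    rw [Filter.mem_atTop_sets]
    refine ⟨hfin.toFinset.biUnion Finsupp.support, fun T hT => hV ?_⟩
    have h1 : HasSum ({e : ι →₀ ℕ | e.support ⊆ T}.indicator fun e => e.prod a) (∏ i ∈ T, s i) :=
      hasSum_subtype_iff_indicator.1 (hasSum_finsuppProd_of_support_subset ha0 ha T)
    have h2 := hS.sub h1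
    have h3 : IsClosed (V : Set K) := V.isClosed
    refine h3.mem_of_tendsto h2 (Filter.Eventually.of_forall fun t => ?_)
    refine V.toAddSubgroup.sum_mem fun e _ => ?_
    by_cases he : e.support ⊆ T
    · rw [Set.indicator_of_mem (show e ∈ {e : ι →₀ ℕ | e.support ⊆ T} from he), sub_self]
      exact V.zero_mem
    · rw [Set.indicator_of_notMem (show e ∉ {e : ι →₀ ℕ | e.support ⊆ T} from he), sub_zero]
      by_contra hc
      exact he (Finset.Subset.trans
        (Finset.subset_biUnion_of_mem Finsupp.support (hfin.mem_toFinset.2 hc)) hT)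
  have h2 := (tendsto_const_nhds (x := S)).sub h
  rw [HasProd, SummationFilter.unconditional_filter]
  simpa using h2

end EulerProduct

/-! ### Summability and inversion of series by valuation bounds. -/

section Valued

open WithZero

variable {K : Type*} [Field K] [Valued K ℤᵐ⁰]

theorem nonarchimedeanRing_of_valued : NonarchimedeanRing K where
  is_nonarchimedean U hU := by
    obtain ⟨γ, hγ⟩ := Valued.mem_nhds_zero.1 hU
    exact ⟨⟨Valued.v.restrict.ltAddSubgroup γ, Valued.isOpen_ball K γ.1⟩, hγ⟩

/-- Bounds are kept on powers of the valuation because the natural bound exp(-w/(r+1)) need not lie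
in the integral value group. -/
theorem pow_valuation_sum_le {ι : Type*} (r : ℕ) {B : ℤᵐ⁰} {s : Finset ι} {x : ι → K}
    (h : ∀ i ∈ s, Valued.v (x i) ^ (r + 1) ≤ B) : Valued.v (∑ i ∈ s, x i) ^ (r + 1) ≤ B := by
  classical
  induction s using Finset.induction_on with
  | empty => simp
  | insert i s hi ih =>
    rw [Finset.sum_insert hi]
    rcases le_max_iff.1 (Valued.v.map_add (x i) (∑ j ∈ s, x j)) with h1 | h1
    · exact (pow_le_pow_left₀ zero_le h1 _).trans (h i (Finset.mem_insert_self i s))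
    · exact (pow_le_pow_left₀ zero_le h1 _).trans
        (ih fun j hj => h j (Finset.mem_insert_of_mem hj))

/-- The coefficients of the inverse of a power series decay as those of the series. -/
theorem pow_valuation_coeff_inv_le {r d : ℕ} {P D : PowerSeries K} (hPD : P * D = 1)
    (hD0 : PowerSeries.coeff 0 D = 1)
    (hD : ∀ i, Valued.v (PowerSeries.coeff i D) ^ (r + 1) ≤ exp (-(d * i : ℕ) : ℤ)) (m : ℕ) :
    Valued.v (PowerSeries.coeff m P) ^ (r + 1) ≤ exp (-(d * m : ℕ) : ℤ) := by
  induction m using Nat.strong_induction_on with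
  | _ m ih =>
    have h := congrArg (PowerSeries.coeff m) hPD
    rw [PowerSeries.coeff_mul, Finset.Nat.sum_antidiagonal_eq_sum_range_succ
      (fun i j => PowerSeries.coeff i P * PowerSeries.coeff j D), Finset.sum_range_succ,
      Nat.sub_self, hD0, mul_one, PowerSeries.coeff_one] at h
    rw [← eq_sub_iff_add_eq', sub_eq_add_neg, add_comm] at h
    have hs : Valued.v (∑ i ∈ Finset.range m, PowerSeries.coeff i P * PowerSeries.coeff (m - i) D)
        ^ (r + 1) ≤ exp (-(d * m : ℕ) : ℤ) := by
      refine pow_valuation_sum_le r fun i hi => ?_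
      have hi' := Finset.mem_range.1 hi
      rw [map_mul, mul_pow]
      refine (mul_le_mul' (ih i hi') (hD (m - i))).trans_eq ?_
      rw [← exp_add]
      congr 1
      rw [← neg_add, ← Nat.cast_add, ← mul_add, Nat.add_sub_cancel' hi'.le]
    rcases Nat.eq_zero_or_pos m with rfl | hm
    · simp only [Finset.range_zero, Finset.sum_empty, neg_zero, if_true, zero_add] at h
      rw [h]
      simp
    · rw [if_neg hm.ne', add_zero] at h
      rw [h, Valuation.map_neg]
      exact hs

variable [CompleteSpace K]

/-- In a complete nonarchimedean field it suffices that the terms tend to zero, and only finitely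
many indices have small weight. -/
theorem summable_of_pow_valuation_le {ι : Type*} {x : ι → K} {r : ℕ} {w : ι → ℕ}
    (hw : ∀ N, {i | w i ≤ N}.Finite)
    (hx : ∀ i, Valued.v (x i) ^ (r + 1) ≤ exp (-(w i : ℤ))) : Summable x := by
  have := nonarchimedeanRing_of_valued (K := K)
  refine NonarchimedeanAddGroup.summable_of_tendsto_cofinite_zero ?_
  rw [(Valued.hasBasis_nhds_zero K ℤᵐ⁰).tendsto_right_iff]
  intro γ _
  have hγ : MonoidWithZeroHom.ValueGroup₀.embedding γ.1 ≠ 0 :=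
    (_root_.map_ne_zero _).2 γ.ne_zero
  obtain ⟨k, hk⟩ := exists_exp_neg_natCast_lt (pow_ne_zero (r + 1) hγ)
  rw [Filter.eventually_cofinite]
  refine (hw k).subset fun i hi => ?_
  by_contra hik
  refine hi ((Valuation.restrict_lt_iff_lt_embedding _).2 (lt_of_pow_lt_pow_left₀ (r + 1) zero_le
    (((hx i).trans ?_).trans_lt hk)))
  rw [exp_le_exp, neg_le_neg_iff]
  exact_mod_cast (not_le.1 hik).le

/-- The formal identity P D = 1 is evaluated at 1 by the Cauchy product; both series of coefficients
are summable. -/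
theorem hasSum_coeff_inv {r d : ℕ} (hd : 0 < d) {P D : PowerSeries K} (hPD : P * D = 1)
    (hD0 : PowerSeries.coeff 0 D = 1)
    (hD : ∀ i, Valued.v (PowerSeries.coeff i D) ^ (r + 1) ≤ exp (-(d * i : ℕ) : ℤ)) {y : K}
    (hy : HasSum (fun i => PowerSeries.coeff i D) y) :
    HasSum (fun i => PowerSeries.coeff i P) y⁻¹ := by
  have := nonarchimedeanRing_of_valued (K := K)
  have hP : Summable fun i => PowerSeries.coeff i P := by
    refine summable_of_pow_valuation_le (w := fun i => d * i) (fun N => ?_)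
      (pow_valuation_coeff_inv_le hPD hD0 hD)
    refine (Set.finite_Iic N).subset fun i hi => ?_
    exact (Nat.le_mul_of_pos_left i hd).trans hi
  have hPy := hP.mul_of_nonarchimedean hy.summable
  have h1 := hP.tsum_mul_tsum_eq_tsum_sum_antidiagonal hy.summable
    hPy
  simp only [← PowerSeries.coeff_mul, hPD, PowerSeries.coeff_one, tsum_ite_eq] at h1
  rw [hy.tsum_eq] at h1
  have h2 := eq_inv_of_mul_eq_one_left h1
  rw [← h2]
  exact hP.hasSum

end Valued

end Taelman

end

noncomputable section

namespace Taelman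

/-! ### Absolute values of polynomials in Laurent series in θ⁻¹. -/

section Valuation

open WithZero

variable (Fq : Type*) [Field Fq] (n : ℕ)

theorem valuation_algebraMap_le_one {k : Type*} [Field k] (c : k) :
    Valued.v (algebraMap k (LaurentSeries k) c) ≤ 1 := by
  have h := (LaurentSeries.valuation_le_iff_coeff_lt_eq_zero k (D := 0)
    (f := algebraMap k (LaurentSeries k) c)).2 fun m hm => by
      rw [HahnSeries.algebraMap_apply', PowerSeries.algebraMap_apply, Algebra.algebraMap_self_apply,
        HahnSeries.ofPowerSeries_C]
      exact HahnSeries.coeff_single_of_ne hm.ne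
  simpa using h

theorem toLaurent_X : toLaurent Fq n X = HahnSeries.single (-1 : ℤ) (1 : ZField Fq n) :=
  aeval_X _

theorem toLaurent_C (c : ZField Fq n) :
    toLaurent Fq n (C c) = algebraMap (ZField Fq n) (LaurentSeries (ZField Fq n)) c :=
  aeval_C _ _

theorem valuation_toLaurent_X_pow (m : ℕ) :
    Valued.v (toLaurent Fq n (X ^ m)) = exp (m : ℤ) := by
  rw [map_pow, map_pow, toLaurent_X, LaurentSeries.valuation_single_zpow, neg_neg, ← exp_nsmul]
  simp

theorem valuation_toLaurent_le (p : (ZField Fq n)[X]) :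
    Valued.v (toLaurent Fq n p) ≤ exp (p.natDegree : ℤ) := by
  rw [p.as_sum_range_C_mul_X_pow, map_sum]
  refine Valued.v.map_sum_le fun i hi => ?_
  rw [← p.as_sum_range_C_mul_X_pow, map_mul, map_mul, valuation_toLaurent_X_pow, toLaurent_C]
  refine (mul_le_of_le_one_left' (valuation_algebraMap_le_one _)).trans ?_
  rw [exp_le_exp]
  exact_mod_cast Nat.lt_succ_iff.1 (Finset.mem_range.1 hi)

theorem valuation_toLaurent_of_monic {p : (ZField Fq n)[X]} (hp : p.Monic) :
    Valued.v (toLaurent Fq n p) = exp (p.natDegree : ℤ) := by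
  rcases eq_or_ne p.eraseLead 0 with h0 | h0
  · have h1 := p.eraseLead_add_C_mul_X_pow
    rw [h0, zero_add, hp.leadingCoeff, C_1, one_mul] at h1
    conv_lhs => rw [← h1]
    exact valuation_toLaurent_X_pow Fq n _
  · have h1 := p.eraseLead_add_C_mul_X_pow
    rw [hp.leadingCoeff, C_1, one_mul] at h1
    conv_lhs => rw [← h1, map_add]
    rw [Valuation.map_add_eq_of_lt_right, valuation_toLaurent_X_pow]
    rw [valuation_toLaurent_X_pow]
    refine (valuation_toLaurent_le Fq n _).trans_lt ?_
    rw [exp_lt_exp]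
    have h2 : p.eraseLead.degree < p.degree := degree_eraseLead_lt hp.ne_zero
    exact_mod_cast natDegree_lt_natDegree h0 h2

theorem monic_toZ {p : Fq[X]} (hp : p.Monic) : (toZ Fq n p).Monic := hp.map _

theorem natDegree_toZ (p : Fq[X]) : (toZ Fq n p).natDegree = p.natDegree :=
  natDegree_map _

/-- The inclusion of `A` in `Fq(z_1, …, z_n)((θ⁻¹))`. -/
def embed : Fq[X] →+* LaurentSeries (ZField Fq n) := (toLaurent Fq n).toRingHom.comp (toZ Fq n)

theorem valuation_embed_le (p : Fq[X]) : Valued.v (embed Fq n p) ≤ exp (p.natDegree : ℤ) := by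
  rw [← natDegree_toZ Fq n]
  exact valuation_toLaurent_le Fq n _

theorem valuation_embed_of_monic {p : Fq[X]} (hp : p.Monic) :
    Valued.v (embed Fq n p) = exp (p.natDegree : ℤ) := by
  rw [← natDegree_toZ Fq n]
  exact valuation_toLaurent_of_monic Fq n (monic_toZ Fq n hp)

theorem embed_ne_zero {p : Fq[X]} (hp : p.Monic) : embed Fq n p ≠ 0 := by
  rw [← Valued.v.ne_zero_iff, valuation_embed_of_monic Fq n hp]
  exact exp_ne_zero

/-- The product `a(z_1) ⋯ a(z_n)` as an element of `Fq(z_1, …, z_n)((θ⁻¹))`. -/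
def evalProd : Fq[X] →* LaurentSeries (ZField Fq n) where
  toFun a := toLaurent Fq n (C (∏ k : Fin n, aeval (z Fq k) a))
  map_one' := by simp
  map_mul' a b := by rw [← map_mul, ← C_mul, ← Finset.prod_mul_distrib]; simp only [map_mul]

theorem valuation_evalProd_le_one (a : Fq[X]) : Valued.v (evalProd Fq n a) ≤ 1 := by
  rw [evalProd, MonoidHom.coe_mk, OneHom.coe_mk, toLaurent_C]
  exact valuation_algebraMap_le_one _

end Valuation

/-! ### Monic polynomials as finitely supported exponent functions. -/

section Factorization

variable {Fq : Type*} [Field Fq]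

/-- The monic polynomial `∏ f ^ e(f)`. -/
def monicOfFinsupp (e : MonicPrime Fq →₀ ℕ) : MonicPoly Fq :=
  ⟨e.prod fun f m => f.1 ^ m, monic_prod_of_monic _ _ fun f _ => f.2.1.pow _⟩

theorem monicOfFinsupp_val (e : MonicPrime Fq →₀ ℕ) :
    (monicOfFinsupp e).1 = e.prod fun f m => f.1 ^ m := rfl

theorem multiplicity_monicOfFinsupp (e : MonicPrime Fq →₀ ℕ) (f : MonicPrime Fq) :
    multiplicity f.1 (monicOfFinsupp e).1 = e f := by
  classical
  have hp : Prime f.1 := f.2.2.prime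
  refine multiplicity_eq_of_emultiplicity_eq_some ?_
  rw [monicOfFinsupp_val, Finsupp.prod, Finset.emultiplicity_prod hp]
  have h1 : ∀ g ∈ e.support, emultiplicity f.1 (g.1 ^ e g) = if g = f then (e f : ℕ∞) else 0 := by
    intro g _
    rw [emultiplicity_pow hp]
    split_ifs with h
    · subst h
      rw [(FiniteMultiplicity.of_prime_left hp g.2.2.ne_zero).emultiplicity_self, mul_one]
    · have : ¬ f.1 ∣ g.1 := fun hd => h (Subtype.ext (eq_of_monic_of_associated g.2.1 f.2.1
        (f.2.2.associated_of_dvd g.2.2 hd).symm))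
      rw [emultiplicity_eq_zero.2 this, mul_zero]
  rw [Finset.sum_congr rfl h1, Finset.sum_ite_eq']
  split_ifs with h
  · rfl
  · rw [Finsupp.notMem_support_iff.1 h]
    rfl

theorem monicOfFinsupp_injective : Function.Injective (monicOfFinsupp (Fq := Fq)) := by
  intro e e' h
  ext f
  rw [← multiplicity_monicOfFinsupp, h, multiplicity_monicOfFinsupp]

theorem monicOfFinsupp_surjective : Function.Surjective (monicOfFinsupp (Fq := Fq)) := by
  classical
  suffices h : ∀ (m : ℕ) (a : MonicPoly Fq), a.1.natDegree = m → ∃ e, monicOfFinsupp e = a from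
    fun a => h _ a rfl
  intro m
  induction m using Nat.strong_induction_on with
  | _ m ih =>
    intro a ha
    by_cases hu : IsUnit a.1
    · refine ⟨0, Subtype.ext ?_⟩
      rw [a.2.eq_one_of_isUnit hu, monicOfFinsupp_val, Finsupp.prod_zero_index]
    · obtain ⟨g, hg, hgi, b, hb⟩ := exists_monic_irreducible_factor a.1 hu
      have hbm : b.Monic := hg.of_mul_monic_left (hb ▸ a.2)
      have hdeg : b.natDegree < m := by
        rw [← ha, hb, hg.natDegree_mul hbm]
        have := hgi.natDegree_pos
        omega
      obtain ⟨e, he⟩ := ih _ hdeg ⟨b, hbm⟩ rfl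
      refine ⟨Finsupp.single ⟨g, hg, hgi⟩ 1 + e, Subtype.ext ?_⟩
      rw [hb, monicOfFinsupp_val, Finsupp.prod_add_index' (fun _ => pow_zero _)
        (fun _ _ _ => pow_add _ _ _), Finsupp.prod_single_index (h := fun (f : MonicPrime Fq) m => f.1 ^ m) (pow_zero _), pow_one,
        ← monicOfFinsupp_val, he]

/-- Unique factorization of monic polynomials. -/
def monicEquiv : (MonicPrime Fq →₀ ℕ) ≃ MonicPoly Fq :=
  Equiv.ofBijective monicOfFinsupp ⟨monicOfFinsupp_injective, monicOfFinsupp_surjective⟩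

theorem finite_natDegree_le [Finite Fq] (N : ℕ) : {a : MonicPoly Fq | a.1.natDegree ≤ N}.Finite := by
  have h : Finite (degreeLT Fq (N + 1)) := (degreeLTEquiv Fq (N + 1)).toEquiv.finite_iff.2
    inferInstance
  refine Set.Finite.of_injOn (f := Subtype.val) (t := (degreeLT Fq (N + 1) : Set Fq[X]))
    (fun a ha => ?_) Subtype.val_injective.injOn (Set.toFinite _)
  rw [SetLike.mem_coe, mem_degreeLT]
  exact (degree_le_of_natDegree_le ha).trans_lt (by exact_mod_cast Nat.lt_succ_self N)

end Factorization

end Taelman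

end

/-! ### Assembly: local series, convergence and the Euler product. -/

noncomputable section

namespace Taelman

namespace DrinfeldModule

open WithZero

variable {Fq : Type*} [Field Fq] [Fintype Fq] {r : ℕ} (φ : DrinfeldModule Fq r) (n : ℕ)
  (f : MonicPrime Fq)

theorem eulerFactor_coeff_zero : (φ.eulerFactor f).coeff 0 = 1 := by
  rw [eulerFactor, coeff_add, coeff_one_zero, finsetSum_coeff, Finset.sum_eq_zero, add_zero]
  intro i hi
  rw [coeff_C_mul, coeff_X_pow, if_neg, mul_zero]
  have := (Finset.mem_Icc.1 hi).1
  omega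

theorem eulerFactor_coeff {i : ℕ} (hi : i ≠ 0) : (φ.eulerFactor f).coeff i =
    if i ∈ Finset.Icc 1 (φ.reductionRank f) then
      C (φ.frobeniusConst f) * (φ.frobeniusCharpoly f).coeff i * f.1 ^ (i - 1) else 0 := by
  rw [eulerFactor, coeff_add, coeff_one, if_neg hi, zero_add, finsetSum_coeff]
  simp only [coeff_C_mul, coeff_X_pow, mul_ite, mul_one, mul_zero]
  rw [Finset.sum_ite_eq]

theorem muPrimePow_zero : φ.muPrimePow f 0 = 1 := by
  rw [muPrimePow, PowerSeries.coeff_zero_eq_constantCoeff_apply,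
    PowerSeries.constantCoeff_invOfUnit]
  simp

/-- The power series `∑ μ(f ^ m) f(z_1) ^ m ⋯ f(z_n) ^ m x ^ m / f ^ m`. -/
def localSeries : PowerSeries (LaurentSeries (ZField Fq n)) :=
  PowerSeries.rescale (evalProd Fq n f.1 / embed Fq n f.1)
    (PowerSeries.map (embed Fq n) (PowerSeries.invOfUnit (φ.eulerFactor f : PowerSeries Fq[X]) 1))

/-- The inverse `D_f(f(z_1) ⋯ f(z_n) x / f)` of the power series `localSeries`. -/
def localDenominator : PowerSeries (LaurentSeries (ZField Fq n)) :=
  PowerSeries.rescale (evalProd Fq n f.1 / embed Fq n f.1)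
    (PowerSeries.map (embed Fq n) (φ.eulerFactor f : PowerSeries Fq[X]))

theorem localSeries_mul_localDenominator :
    φ.localSeries n f * φ.localDenominator n f = 1 := by
  rw [localSeries, localDenominator, ← map_mul, ← map_mul, PowerSeries.invOfUnit_mul, map_one,
    map_one]
  rw [Polynomial.constantCoeff_coe, eulerFactor_coeff_zero, Units.val_one]

theorem coeff_localSeries (m : ℕ) : PowerSeries.coeff m (φ.localSeries n f) =
    (evalProd Fq n f.1 / embed Fq n f.1) ^ m * embed Fq n (φ.muPrimePow f m) := by
  rw [localSeries, PowerSeries.coeff_rescale, PowerSeries.coeff_map, muPrimePow]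

theorem coeff_localDenominator_zero : PowerSeries.coeff 0 (φ.localDenominator n f) = 1 := by
  rw [localDenominator, PowerSeries.coeff_rescale, PowerSeries.coeff_map, Polynomial.coeff_coe,
    eulerFactor_coeff_zero, map_one, pow_zero, mul_one]

theorem coeff_localDenominator {i : ℕ} (hi : i ≠ 0) :
    PowerSeries.coeff i (φ.localDenominator n f) =
      if i ∈ Finset.Icc 1 (φ.reductionRank f) then
        embed Fq n (C (φ.frobeniusConst f) * (φ.frobeniusCharpoly f).coeff i) /
          embed Fq n f.1 * evalProd Fq n f.1 ^ i else 0 := by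
  have h0 := embed_ne_zero Fq n f.2.1
  rw [localDenominator, PowerSeries.coeff_rescale, PowerSeries.coeff_map, Polynomial.coeff_coe,
    φ.eulerFactor_coeff f hi]
  split_ifs
  · obtain ⟨j, rfl⟩ := Nat.exists_eq_succ_of_ne_zero hi
    rw [map_mul _ _ (f.1 ^ _), map_pow, Nat.succ_sub_one, Nat.succ_eq_add_one,
      div_pow]
    field_simp
    ring
  · rw [map_zero, mul_zero]

/-- The coefficient is c(f) p_i / f times a power of ∏_k f(z_k), which is constant in θ and so has
absolute value at most 1. The rest is the bound r deg p_i + d i ≤ r d. -/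
theorem pow_valuation_coeff_localDenominator_le (i : ℕ) :
    Valued.v (PowerSeries.coeff i (φ.localDenominator n f)) ^ r ≤
      exp (-(f.1.natDegree * i : ℕ) : ℤ) := by
  rcases eq_or_ne i 0 with rfl | hi
  · rw [coeff_localDenominator_zero]
    simp
  · rw [φ.coeff_localDenominator n f hi]
    have hr : r ≠ 0 := by
      have := φ.rank_pos
      omega
    split_ifs with h
    · rcases eq_or_ne (C (φ.frobeniusConst f) * (φ.frobeniusCharpoly f).coeff i) 0 with h0 | h0
      · rw [h0, map_zero, zero_div, zero_mul, map_zero, zero_pow hr]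
        exact zero_le
      · have h1 := φ.natDegree_localCoeff_le f h h0
        rw [map_mul, map_pow, map_div₀, valuation_embed_of_monic Fq n f.2.1]
        have h2 : Valued.v (evalProd Fq n f.1) ^ i ≤ 1 :=
          pow_le_one₀ zero_le (valuation_evalProd_le_one Fq n f.1)
        have h3 := valuation_embed_le Fq n
          (C (φ.frobeniusConst f) * (φ.frobeniusCharpoly f).coeff i)
        refine (pow_le_pow_left₀ zero_le ((mul_le_of_le_one_right' h2).trans
          (div_le_div_of_nonneg_right h3 zero_le)) r).trans ?_
        rw [← exp_sub, ← exp_nsmul, exp_le_exp, nsmul_eq_mul]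
        zify at h1
        push_cast at h1 ⊢
        linarith
    · rw [map_zero, zero_pow hr]
      exact zero_le

theorem taelmanFactor_eq : φ.taelmanFactor n f = (1 + ∑ i ∈ Finset.Icc 1 (φ.reductionRank f),
    embed Fq n (C (φ.frobeniusConst f) * (φ.frobeniusCharpoly f).coeff i) /
      embed Fq n f.1 * evalProd Fq n f.1 ^ i)⁻¹ := by
  have h0 := embed_ne_zero Fq n f.2.1
  have h1 : toLaurent Fq n ((φ.localPoly f).eval₂ (toZ Fq n) (C (∏ k, aeval (z Fq k) f.1))) =
      embed Fq n f.1 + ∑ i ∈ Finset.Icc 1 (φ.reductionRank f),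
        embed Fq n (C (φ.frobeniusConst f) * (φ.frobeniusCharpoly f).coeff i) *
          evalProd Fq n f.1 ^ i := by
    rw [localPoly, eval₂_add, eval₂_C, eval₂_finsetSum, map_add, map_sum]
    congr 1
    refine Finset.sum_congr rfl fun i _ => ?_
    rw [eval₂_mul, eval₂_C, eval₂_pow, eval₂_X, map_mul, map_pow]
    rfl
  rw [taelmanFactor, fittingGenerator_quotient (monic_toZ Fq n f.2.1),
    fittingGenerator_twistModule, h1]
  change embed Fq n f.1 / _ = _
  rw [← inv_div, add_div, div_self h0, Finset.sum_div]
  simp only [div_mul_eq_mul_div]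

theorem hasSum_localDenominator :
    HasSum (fun i => PowerSeries.coeff i (φ.localDenominator n f)) (φ.taelmanFactor n f)⁻¹ := by
  rw [taelmanFactor_eq, inv_inv]
  have h := hasSum_sum_of_ne_finset_zero (L := .unconditional ℕ)
    (f := fun i => PowerSeries.coeff i (φ.localDenominator n f))
    (s := Finset.range (φ.reductionRank f + 1)) fun i hi => by
      rw [Finset.mem_range] at hi
      rw [φ.coeff_localDenominator n f (by omega), if_neg]
      rw [Finset.mem_Icc]
      omega
  convert h using 1
  rw [Finset.range_eq_Ico, Finset.sum_eq_sum_Ico_succ_bot (Nat.succ_pos _),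
    coeff_localDenominator_zero]
  congr 1
  refine Finset.sum_congr ?_ fun i hi => ?_
  · ext i
    simp only [Finset.mem_Icc, Finset.mem_Ico]
    omega
  · have := Finset.mem_Ico.1 hi
    rw [φ.coeff_localDenominator n f (by omega), if_pos]
    rw [Finset.mem_Icc]
    omega

theorem hasSum_localSeries :
    HasSum (fun i => PowerSeries.coeff i (φ.localSeries n f)) (φ.taelmanFactor n f) := by
  -- Writing r = s + 1 matches the exponent in the general valuation lemmas.
  obtain ⟨s, rfl⟩ := Nat.exists_eq_add_of_le' φ.rank_pos
  have h := hasSum_coeff_inv f.2.2.natDegree_pos (φ.localSeries_mul_localDenominator n f)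
    (φ.coeff_localDenominator_zero n f) (φ.pow_valuation_coeff_localDenominator_le n f)
    (φ.hasSum_localDenominator n f)
  rwa [inv_inv] at h

theorem mu_monicOfFinsupp (e : MonicPrime Fq →₀ ℕ) :
    φ.mu (monicOfFinsupp e) = e.prod φ.muPrimePow := by
  rw [mu, finprod_eq_prod_of_mulSupport_subset (s := e.support)]
  · simp only [multiplicity_monicOfFinsupp]
    rfl
  · intro f hf
    rw [Function.mem_mulSupport, multiplicity_monicOfFinsupp] at hf
    rw [Finset.mem_coe, Finsupp.mem_support_iff]
    intro h
    rw [h, muPrimePow_zero] at hf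
    exact hf rfl

theorem pellarinTerm_monicOfFinsupp (e : MonicPrime Fq →₀ ℕ) :
    φ.pellarinTerm n (monicOfFinsupp e) =
      e.prod fun f m => PowerSeries.coeff m (φ.localSeries n f) := by
  have h1 : φ.pellarinTerm n (monicOfFinsupp e) =
      embed Fq n (φ.mu (monicOfFinsupp e)) * evalProd Fq n (monicOfFinsupp e).1 /
        embed Fq n (monicOfFinsupp e).1 := by
    rw [pellarinTerm, map_mul, ← map_prod C]
    rfl
  rw [h1, mu_monicOfFinsupp, monicOfFinsupp_val]
  simp only [Finsupp.prod, map_prod, map_pow, coeff_localSeries]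
  rw [← Finset.prod_mul_distrib, ← Finset.prod_div_distrib]
  refine Finset.prod_congr rfl fun f _ => ?_
  rw [div_pow]
  ring

/-- The term is a product of coefficients of local series at the primes dividing a, and the local
bounds exp(-deg(f) e(f)) multiply to exp(-deg a). -/
theorem pow_valuation_pellarinTerm_le (e : MonicPrime Fq →₀ ℕ) :
    Valued.v (φ.pellarinTerm n (monicOfFinsupp e)) ^ r ≤
      exp (-((monicOfFinsupp e).1.natDegree : ℤ)) := by
  obtain ⟨s, rfl⟩ := Nat.exists_eq_add_of_le' φ.rank_pos
  rw [pellarinTerm_monicOfFinsupp, monicOfFinsupp_val, Finsupp.prod, Finsupp.prod, map_prod,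
    ← Finset.prod_pow, natDegree_prod_of_monic _ _ fun f _ => f.2.1.pow _]
  refine (Finset.prod_le_prod' fun f _ => pow_valuation_coeff_inv_le
    (φ.localSeries_mul_localDenominator n f) (φ.coeff_localDenominator_zero n f)
    (φ.pow_valuation_coeff_localDenominator_le n f) (e f)).trans_eq ?_
  have h : ∀ (s : Finset (MonicPrime Fq)) (w : MonicPrime Fq → ℕ),
      ∏ f ∈ s, (exp (-(w f : ℤ)) : ℤᵐ⁰) = exp (-((∑ f ∈ s, w f : ℕ) : ℤ)) := by
    classical
    intro s w
    induction s using Finset.induction_on with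
    | empty => simp
    | insert i s hi ih =>
      rw [Finset.prod_insert hi, Finset.sum_insert hi, ih, ← exp_add, Nat.cast_add, neg_add]
  rw [h]
  congr 3
  refine Finset.sum_congr rfl fun f _ => ?_
  rw [f.2.1.natDegree_pow, mul_comm]

theorem summable_pellarinTerm :
    Summable fun e : MonicPrime Fq →₀ ℕ => φ.pellarinTerm n (monicOfFinsupp e) := by
  have h := φ.pow_valuation_pellarinTerm_le n
  obtain ⟨s, rfl⟩ := Nat.exists_eq_add_of_le' φ.rank_pos
  exact summable_of_pow_valuation_le (w := fun e => (monicOfFinsupp e).1.natDegree)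
    (fun N => (finite_natDegree_le N).preimage monicOfFinsupp_injective.injOn) h

theorem hasProd_taelmanFactor : HasProd (fun f : MonicPrime Fq => φ.taelmanFactor n f)
    (∑' e : MonicPrime Fq →₀ ℕ, φ.pellarinTerm n (monicOfFinsupp e)) := by
  have := nonarchimedeanRing_of_valued (K := LaurentSeries (ZField Fq n))
  refine hasProd_of_summable_finsuppProd
    (a := fun f m => PowerSeries.coeff m (φ.localSeries n f)) (fun f => ?_)
    (φ.hasSum_localSeries n) ?_
  · rw [coeff_localSeries, muPrimePow_zero, map_one, pow_zero, mul_one]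
  · simp only [← pellarinTerm_monicOfFinsupp]
    exact (φ.summable_pellarinTerm n).hasSum

theorem hasSum_pellarinTerm :
    HasSum (fun a : MonicPoly Fq => φ.pellarinTerm n a) (φ.taelmanLValue n) := by
  rw [← (monicEquiv (Fq := Fq)).hasSum_iff, taelmanLValue, (φ.hasProd_taelmanFactor n).tprod_eq]
  exact (φ.summable_pellarinTerm n).hasSum

end DrinfeldModule

end Taelman

end

theorem theorem1p1 {Fq : Type*} [Field Fq] [Fintype Fq] {r : ℕ}
    (φ : Taelman.DrinfeldModule Fq r) (n : ℕ) :
    Multipliable (fun f : Taelman.MonicPrime Fq => φ.taelmanFactor n f) ∧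
      HasSum (fun a : Taelman.MonicPoly Fq => φ.pellarinTerm n a) (φ.taelmanLValue n) := by
  exact ⟨(φ.hasProd_taelmanFactor n).multipliable, φ.hasSum_pellarinTerm n⟩
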